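/- Let $n\ge 2$ and let $\varphi:[0,\infty)\to\mathbb{R}$ satisfy $\varphi(0)=0$, be $C^3$ on $(0,\infty)$, and be such that, for some constants $k_2\ge k_1>0$ and $k_3>0$ and for all $r>0$, $$\varphi'(r)\varphi''(r)>0,\qquad k_1\le \frac{r\varphi''(r)}{\varphi'(r)}\le k_2,\qquad \left|\frac{r\varphi'''(r)}{\varphi''(r)}\right|\le k_3 .$$ Let $\Gamma(t)=(t,\varphi(|t|))\in\mathbb{R}^{n+1}$ for $t\in\mathbb{R}^n$. Let $\Omega$ be a measurable complex-valued function on $\mathbb{R}^n$ such that $\Omega(t)/|t|^n$ is homogeneous of degree $-n$ on $\mathbb{R}^n\setminus\{0\}$, $\Omega$ is bounded on the unit sphere $\mathbb{S}^{n-1}$, and $\int_{\mathbb{S}^{n-1}}\Omega\,d\sigma=0$, where $\sigma$ is the surface measure. Let $\beta>2\alpha>0$, and for Schwartz functions $f$ on $\mathbb{R}^{n+1}$ put $$\mathcal{R}f(x)=\int_{\mathbb{R}^n}f(x-\Gamma(t))\frac{e^{-2\pi i|t|^{-\beta}}\,\Omega(t)}{|t|^{\alpha+n}}\,dt:=\lim_{\varepsilon\to0^+}\int_{|t|>\varepsilon}f(x-\Gamma(t))\frac{e^{-2\pi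 i|t|^{-\beta}}\,\Omega(t)}{|t|^{\alpha+n}}\,dt .$$ The truncated integrals converge absolutely and the limit exists for every $x\in\mathbb{R}^{n+1}$. Moreover: (1) $\mathcal{R}$ extends to a bounded linear operator on $L^2(\mathbb{R}^{n+1})$; (2) for every real $p$ with $\frac{\beta}{\beta-\alpha}<p<\frac{\beta}{\alpha}$, $\mathcal{R}$ extends to a bounded linear operator on $L^p(\mathbb{R}^{n+1})$. -/

import Mathlib

open MeasureTheory Filter Topology
open scoped ENNReal SchwartzMap

noncomputable section

namespace RadialHypersingular

/-- Conditions on the radial profile `φ` with constants `k₁, k₂, k₃`; regularity is only required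
away from the origin, so that e.g. `φ r = r ^ (1 + γ)` is admissible for every `γ > 0`. -/
structure IsAdmissibleProfile (φ : ℝ → ℝ) (k₁ k₂ k₃ : ℝ) : Prop where
  contDiffOn : ContDiffOn ℝ 3 φ (Set.Ioi 0)
  zero : φ 0 = 0
  k₁_pos : 0 < k₁
  k₁_le_k₂ : k₁ ≤ k₂
  k₃_pos : 0 < k₃
  deriv_mul_pos : ∀ r : ℝ, 0 < r → 0 < deriv φ r * iteratedDeriv 2 φ r
  le_ratio : ∀ r : ℝ, 0 < r → k₁ ≤ r * iteratedDeriv 2 φ r / deriv φ r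
  ratio_le : ∀ r : ℝ, 0 < r → r * iteratedDeriv 2 φ r / deriv φ r ≤ k₂
  abs_ratio_le : ∀ r : ℝ, 0 < r → |r * iteratedDeriv 3 φ r / iteratedDeriv 2 φ r| ≤ k₃

/-- Conditions on the angular factor `Ω`: the kernel `Ω(t) / |t| ^ n` is (measurable and)
homogeneous of degree `-n`, and `Ω` is bounded and of mean zero on the unit sphere. -/
structure IsAdmissibleAngular {n : ℕ} (Ω : EuclideanSpace ℝ (Fin n) → ℂ) : Prop where
  aestronglyMeasurable : AEStronglyMeasurable Ω volume
  homogeneous : ∀ (r : ℝ) (t : EuclideanSpace ℝ (Fin n)), 0 < r → t ≠ 0 →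
    Ω (r • t) / ((‖r • t‖ ^ n : ℝ) : ℂ) = ((r ^ (-(n : ℤ)) : ℝ) : ℂ) * (Ω t / ((‖t‖ ^ n : ℝ) : ℂ))
  bounded_sphere : ∃ M : ℝ, ∀ t ∈ Metric.sphere (0 : EuclideanSpace ℝ (Fin n)) 1, ‖Ω t‖ ≤ M
  mean_zero : ∫ ω : Metric.sphere (0 : EuclideanSpace ℝ (Fin n)) 1, Ω ω
    ∂((volume : Measure (EuclideanSpace ℝ (Fin n))).toSphere) = 0

/-- The radial hypersurface `Γ(t) = (t, φ(|t|))` in `ℝ^{n+1}`. -/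
def surface {n : ℕ} (φ : ℝ → ℝ) (t : EuclideanSpace ℝ (Fin n)) :
    EuclideanSpace ℝ (Fin (n + 1)) :=
  WithLp.toLp 2 (Fin.snoc (α := fun _ => ℝ) (fun i => t i) (φ ‖t‖))

/-- The oscillating kernel `e^{-2πi|t|^{-β}} Ω(t) / |t|^{α+n}`. -/
def kernel {n : ℕ} (Ω : EuclideanSpace ℝ (Fin n) → ℂ) (α β : ℝ)
    (t : EuclideanSpace ℝ (Fin n)) : ℂ :=
  Complex.exp (-2 * Real.pi * Complex.I * ((‖t‖ ^ (-β) : ℝ) : ℂ)) * Ω t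
    / ((‖t‖ ^ (α + n) : ℝ) : ℂ)

/-- The integrand `t ↦ f(x - Γ(t)) e^{-2πi|t|^{-β}} Ω(t) / |t|^{α+n}`. -/
def integrand {n : ℕ} (φ : ℝ → ℝ) (Ω : EuclideanSpace ℝ (Fin n) → ℂ) (α β : ℝ)
    (f : EuclideanSpace ℝ (Fin (n + 1)) → ℂ) (x : EuclideanSpace ℝ (Fin (n + 1)))
    (t : EuclideanSpace ℝ (Fin n)) : ℂ :=
  f (x - surface φ t) * kernel Ω α β t

/-- The integral truncated to `|t| > ε`. -/
def truncated {n : ℕ} (φ : ℝ → ℝ) (Ω : EuclideanSpace ℝ (Fin n) → ℂ) (α β ε : ℝ)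
    (f : EuclideanSpace ℝ (Fin (n + 1)) → ℂ) (x : EuclideanSpace ℝ (Fin (n + 1))) : ℂ :=
  ∫ t in {t : EuclideanSpace ℝ (Fin n) | ε < ‖t‖}, integrand φ Ω α β f x t

/-- The hypersingular integral `𝓡 f(x)`, understood as the limit of truncations as `ε → 0⁺`. -/
def hypersingular {n : ℕ} (φ : ℝ → ℝ) (Ω : EuclideanSpace ℝ (Fin n) → ℂ) (α β : ℝ)
    (f : EuclideanSpace ℝ (Fin (n + 1)) → ℂ) (x : EuclideanSpace ℝ (Fin (n + 1))) : ℂ :=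
  limUnder (𝓝[>] (0 : ℝ)) (fun ε => truncated φ Ω α β ε f x)

/-- The truncated integrals converge absolutely, and their limit as `ε → 0⁺` exists, at every
point and for every Schwartz function. -/
def IsWellDefined {n : ℕ} (φ : ℝ → ℝ) (Ω : EuclideanSpace ℝ (Fin n) → ℂ) (α β : ℝ) : Prop :=
  ∀ (f : 𝓢(EuclideanSpace ℝ (Fin (n + 1)), ℂ)) (x : EuclideanSpace ℝ (Fin (n + 1))),
    (∀ ε : ℝ, 0 < ε → IntegrableOn (integrand φ Ω α β f x) {t | ε < ‖t‖} volume) ∧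
    Tendsto (fun ε => truncated φ Ω α β ε f x) (𝓝[>] (0 : ℝ)) (𝓝 (hypersingular φ Ω α β f x))

/-- `𝓡`, given on Schwartz functions by the limit of truncations, is (the restriction of) a
bounded linear operator on `L^p(ℝ^{n+1})`. -/
def IsBoundedOnLp {n : ℕ} (φ : ℝ → ℝ) (Ω : EuclideanSpace ℝ (Fin n) → ℂ) (α β : ℝ)
    (p : ℝ≥0∞) : Prop :=
  ∃ (T : Lp ℂ p (volume : Measure (EuclideanSpace ℝ (Fin (n + 1)))) →ₗ[ℂ]
        Lp ℂ p (volume : Measure (EuclideanSpace ℝ (Fin (n + 1))))) (C : ℝ),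
    (∀ g, ‖T g‖ ≤ C * ‖g‖) ∧
    ∀ f : 𝓢(EuclideanSpace ℝ (Fin (n + 1)), ℂ),
      T (f.toLp p volume) =ᵐ[volume] hypersingular φ Ω α β f

end RadialHypersingular

end

noncomputable section

namespace RadialHypersingular

/-! ### Oscillatory integrals in one variable -/

/-! The operator is cut dyadically in `|t|`. The piece on `a < |t| ≤ 2a` is convolution with a
finite complex measure carried by the surface. The kernel has size `a^{-α-n}` on a set of volume
about `a^n`, so the piece has norm `≲ a^{-α}` on `L¹` and on `L^∞`, which diverges as `a → 0`. The
oscillation has to produce a compensating gain on `L²`, where the norm is the supremum of the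
multiplier `m(ξ, η)`. The claim (`exists_norm_multiplier_le`) is `|m| ≲ a^{-α+βκ/2}` for every `κ <
1`, uniformly in the frequency.

There are two regimes, separated at `|ξ| ≈ a^{-β-1}`, the size of the derivative of `r^{-β}`.

Small `ξ`: integrate in `r` first, for each fixed direction `θ`. The phase is `r (θ·ξ) + η φ(r) +
r^{-β}`. Since `φ'` and `φ''` have one common, constant sign, either `η φ''` reinforces the convex
term `β(β+1) r^{-β-2}`, and van der Corput's second derivative test gains `a^{β/2}`; or `η φ'`
reinforces the negative term `-β r^{-β-1}`, which already beats `θ·ξ`, and there is no stationary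
point. Either way the bound does not depend on `η` (`exists_norm_integral_radial_le`).

Large `ξ`: integrate in `θ` first and keep only the size of the radial factor. What is needed is
decay of `(Ω dσ)^(rξ)` averaged over `r ∈ (a, 2a]`. As `Ω` is merely bounded, stationary phase on
the sphere is not available. Instead the mean square over `r`, taken against a Gaussian, is a double
integral over `(θ, θ')` of a Gaussian in `a ξ·(θ - θ')`, which is at most `(a|ξ|)^{-κ}` times the
`κ`-energy of a one-dimensional projection of the sphere. That energy is finite for `κ < 1`
(`exists_sphere_energy_le`). With `a|ξ| ≳ a^{-β}` this gains `a^{βκ/2}`.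

Marcinkiewicz interpolation between `L¹`, `L²` and `L^∞`, with the dependence on the endpoint norms
kept explicit, gives norm `≲ a^{-α+κβs/2}` on `L^p` with `s = min(2 - 2/p, 2/p)`. The stated range
of `p` is exactly `βs > 2α`, so for `κ` close to `1` the dyadic norms form a geometric series
(`exists_eLpNorm_truncated_le`). Fatou's lemma passes to the limit of the truncations, and density
of Schwartz functions yields the extension to `L^p`.

The pointwise limit is a separate matter: integrating `e^{-2πi r^{-β}}` by parts along each ray
replaces `r^{-1-α}` by `r^{β-α-1}`, integrable at the origin (`norm_integral_ray_le`). -/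

/-- The oscillating factor `e^{-2πix}`. -/
def osc (x : ℝ) : ℂ := Complex.exp (-2 * Real.pi * Complex.I * (x : ℂ))

lemma norm_osc (x : ℝ) : ‖osc x‖ = 1 := by
  have : (-2 * Real.pi * Complex.I * (x : ℂ)) = ((-2 * Real.pi * x : ℝ) : ℂ) * Complex.I := by
    push_cast; ring
  rw [osc, this, Complex.norm_exp_ofReal_mul_I]

lemma osc_add (x y : ℝ) : osc (x + y) = osc x * osc y := by
  rw [osc, osc, osc, ← Complex.exp_add]
  congr 1
  push_cast
  ring

lemma continuous_osc : Continuous osc := by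
  unfold osc
  fun_prop

lemma HasDerivAt.osc {F : ℝ → ℝ} {F' x : ℝ} (h : HasDerivAt F F' x) :
    HasDerivAt (fun y => osc (F y)) (osc (F x) * (-2 * Real.pi * Complex.I * (F' : ℂ))) x := by
  unfold RadialHypersingular.osc
  exact (h.ofReal_comp.const_mul (-2 * Real.pi * Complex.I)).cexp

/-- Integration by parts in an oscillatory integral. -/
lemma norm_integral_osc_mul_deriv_le {a b : ℝ} (hab : a ≤ b) {F F' : ℝ → ℝ} {h h' : ℝ → ℂ}
    (hF : ∀ x ∈ Set.Icc a b, HasDerivAt F (F' x) x) (hF' : ContinuousOn F' (Set.Icc a b))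
    (hh : ∀ x ∈ Set.Icc a b, HasDerivAt h (h' x) x) (hh' : ContinuousOn h' (Set.Icc a b)) :
    ‖∫ x in a..b, osc (F x) * ((F' x : ℂ) * h x)‖ ≤ ‖h a‖ + ‖h b‖ + ∫ x in a..b, ‖h' x‖ := by
  have hI : Set.uIcc a b = Set.Icc a b := Set.uIcc_of_le hab
  have hFc : ContinuousOn F (Set.Icc a b) := fun x hx => (hF x hx).continuousAt.continuousWithinAt
  have hhc : ContinuousOn h (Set.Icc a b) := fun x hx => (hh x hx).continuousAt.continuousWithinAt
  have hec : ContinuousOn (fun x => osc (F x)) (Set.Icc a b) := continuous_osc.comp_continuousOn hFc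
  have hF'c : ContinuousOn (fun x => (F' x : ℂ)) (Set.Icc a b) :=
    Complex.continuous_ofReal.comp_continuousOn hF'
  have i1 : IntervalIntegrable (fun x => osc (F x) * ((F' x : ℂ) * h x)) volume a b :=
    (hI ▸ hec.mul (hF'c.mul hhc) : ContinuousOn _ (Set.uIcc a b)).intervalIntegrable
  have i2 : IntervalIntegrable (fun x => osc (F x) * h' x) volume a b :=
    (hI ▸ hec.mul hh' : ContinuousOn _ (Set.uIcc a b)).intervalIntegrable
  have key := intervalIntegral.integral_eq_sub_of_hasDerivAt (a := a) (b := b)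
    (f := fun x => osc (F x) * h x)
    (f' := fun x => (-2 * Real.pi * Complex.I) * (osc (F x) * ((F' x : ℂ) * h x)) + osc (F x) * h' x)
    (by
      intro x hx
      rw [hI] at hx
      exact ((HasDerivAt.osc (hF x hx)).mul (hh x hx)).congr_deriv (by ring))
    ((i1.const_mul _).add i2)
  rw [intervalIntegral.integral_add (i1.const_mul _) i2, intervalIntegral.integral_const_mul] at key
  set J := ∫ x in a..b, osc (F x) * ((F' x : ℂ) * h x)
  have e1 : (-2 * Real.pi * Complex.I) * J =
      osc (F b) * h b - osc (F a) * h a - ∫ x in a..b, osc (F x) * h' x := by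
    rw [← key]; ring
  have e2 : ‖(-2 * Real.pi * Complex.I) * J‖ = 2 * Real.pi * ‖J‖ := by
    simp [abs_of_pos Real.pi_pos]
  have e3 : ‖∫ x in a..b, osc (F x) * h' x‖ ≤ ∫ x in a..b, ‖h' x‖ := by
    refine (intervalIntegral.norm_integral_le_integral_norm hab).trans_eq ?_
    simp [norm_osc]
  have e4 : 2 * Real.pi * ‖J‖ ≤ ‖h a‖ + ‖h b‖ + ∫ x in a..b, ‖h' x‖ := by
    rw [← e2, e1]
    refine (norm_sub_le _ _).trans ?_
    refine (add_le_add (norm_sub_le _ _) e3).trans_eq ?_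
    simp [norm_osc]; ring
  -- The factor `1/(2π)` is discarded.
  nlinarith [Real.pi_gt_three, norm_nonneg J]

/-- First derivative test: no stationary points. -/
lemma norm_integral_osc_le_of_deriv {a b : ℝ} (hab : a ≤ b) {F F' F'' : ℝ → ℝ} {ψ ψ' : ℝ → ℝ}
    (hF : ∀ x ∈ Set.Icc a b, HasDerivAt F (F' x) x)
    (hF' : ∀ x ∈ Set.Icc a b, HasDerivAt F' (F'' x) x) (hF'' : ContinuousOn F'' (Set.Icc a b))
    (hψ : ∀ x ∈ Set.Icc a b, HasDerivAt ψ (ψ' x) x) (hψ' : ContinuousOn ψ' (Set.Icc a b))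
    {δ P Q K : ℝ} (hδ : 0 < δ) (hP0 : 0 ≤ P) (hFδ : ∀ x ∈ Set.Icc a b, δ ≤ |F' x|)
    (hP : ∀ x ∈ Set.Icc a b, |ψ x| ≤ P) (hQ : ∀ x ∈ Set.Icc a b, |ψ' x| ≤ Q)
    (hK : ∫ x in a..b, |F'' x| / F' x ^ 2 ≤ K) :
    ‖∫ x in a..b, osc (F x) * (ψ x : ℂ)‖ ≤ 2 * P / δ + Q * (b - a) / δ + P * K := by
  have hI : Set.uIcc a b = Set.Icc a b := Set.uIcc_of_le hab
  have hne : ∀ x ∈ Set.Icc a b, F' x ≠ 0 := fun x hx h0 => by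
    have := hFδ x hx; rw [h0, abs_zero] at this; linarith
  have cF' : ContinuousOn F' (Set.Icc a b) := fun x hx =>
    (hF' x hx).continuousAt.continuousWithinAt
  have cψ : ContinuousOn ψ (Set.Icc a b) := fun x hx =>
    (hψ x hx).continuousAt.continuousWithinAt
  have ch' : ContinuousOn (fun x => (ψ' x * F' x - ψ x * F'' x) / F' x ^ 2) (Set.Icc a b) :=
    ((hψ'.mul cF').sub (cψ.mul hF'')).div (cF'.pow 2) fun x hx => pow_ne_zero _ (hne x hx)
  -- Write `ψ = F' · (ψ / F')` and integrate by parts. The derivative of `ψ / F'` splits into `ψ' /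
  -- F'`, controlled by `Q / δ`, and `ψ F'' / F'²`, controlled by `P K`.
  have key := norm_integral_osc_mul_deriv_le hab hF cF'
    (h := fun x => ((ψ x / F' x : ℝ) : ℂ))
    (h' := fun x => (((ψ' x * F' x - ψ x * F'' x) / F' x ^ 2 : ℝ) : ℂ))
    (fun x hx => ((hψ x hx).div (hF' x hx) (hne x hx)).ofReal_comp)
    (Complex.continuous_ofReal.comp_continuousOn ch')
  have e1 : ∫ x in a..b, osc (F x) * ((F' x : ℂ) * ((ψ x / F' x : ℝ) : ℂ)) =
      ∫ x in a..b, osc (F x) * (ψ x : ℂ) := by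
    apply intervalIntegral.integral_congr
    intro x hx
    rw [hI] at hx
    have : (F' x : ℂ) ≠ 0 := by exact_mod_cast hne x hx
    simp only
    push_cast
    rw [mul_div_cancel₀ _ this]
  rw [e1] at key
  have hend : ∀ x ∈ Set.Icc a b, ‖((ψ x / F' x : ℝ) : ℂ)‖ ≤ P / δ := by
    intro x hx
    rw [Complex.norm_real, Real.norm_eq_abs, abs_div]
    exact div_le_div₀ hP0 (hP x hx) hδ (hFδ x hx)
  have cK : ContinuousOn (fun x => |F'' x| / F' x ^ 2) (Set.Icc a b) :=
    hF''.abs.div (cF'.pow 2) fun x hx => pow_ne_zero _ (hne x hx)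
  have iK : IntervalIntegrable (fun x => |F'' x| / F' x ^ 2) volume a b :=
    (hI ▸ cK : ContinuousOn _ (Set.uIcc a b)).intervalIntegrable
  have e2 : ∫ x in a..b, ‖(((ψ' x * F' x - ψ x * F'' x) / F' x ^ 2 : ℝ) : ℂ)‖ ≤
      ∫ x in a..b, (Q / δ + P * (|F'' x| / F' x ^ 2)) := by
    apply intervalIntegral.integral_mono_on hab
    · apply ContinuousOn.intervalIntegrable
      rw [hI]
      exact (Complex.continuous_ofReal.comp_continuousOn ch').norm
    · exact intervalIntegrable_const.add (iK.const_mul P)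
    · intro x hx
      have h0 := hne x hx
      have hpos : 0 < |F' x| := abs_pos.mpr h0
      rw [Complex.norm_real, Real.norm_eq_abs]
      have : (ψ' x * F' x - ψ x * F'' x) / F' x ^ 2 = ψ' x / F' x - ψ x * (F'' x / F' x ^ 2) := by
        field_simp
      rw [this]
      refine (abs_sub _ _).trans ?_
      rw [abs_div, abs_mul, abs_div (F'' x), abs_of_nonneg (sq_nonneg (F' x))]
      refine add_le_add ?_ ?_
      · exact div_le_div₀ ((abs_nonneg _).trans (hQ x hx)) (hQ x hx) hδ (hFδ x hx)
      · exact mul_le_mul_of_nonneg_right (hP x hx) (by positivity)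
  rw [intervalIntegral.integral_add intervalIntegrable_const (iK.const_mul P),
    intervalIntegral.integral_const, intervalIntegral.integral_const_mul, smul_eq_mul] at e2
  have e3 := mul_le_mul_of_nonneg_left hK hP0
  have e4 := hend a (Set.left_mem_Icc.mpr hab)
  have e5 := hend b (Set.right_mem_Icc.mpr hab)
  calc _ ≤ _ := key
    _ ≤ P / δ + P / δ + ((b - a) * (Q / δ) + P * K) := by linarith
    _ = _ := by ring

/-- One-sided second derivative test, starting from a point where the derivative is nonnegative. -/
lemma norm_integral_osc_le_of_deriv2_right {a b : ℝ} (hab : a ≤ b) {F F' F'' : ℝ → ℝ} {ψ ψ' : ℝ → ℝ}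
    (hF : ∀ x ∈ Set.Icc a b, HasDerivAt F (F' x) x)
    (hF' : ∀ x ∈ Set.Icc a b, HasDerivAt F' (F'' x) x) (hF'' : ContinuousOn F'' (Set.Icc a b))
    (hψ : ∀ x ∈ Set.Icc a b, HasDerivAt ψ (ψ' x) x) (hψ' : ContinuousOn ψ' (Set.Icc a b))
    {δ P Q : ℝ} (hδ : 0 < δ) (ha : 0 ≤ F' a) (hFδ : ∀ x ∈ Set.Icc a b, δ ^ 2 ≤ F'' x)
    (hP : ∀ x ∈ Set.Icc a b, |ψ x| ≤ P) (hQ : ∀ x ∈ Set.Icc a b, |ψ' x| ≤ Q) :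
    ‖∫ x in a..b, osc (F x) * (ψ x : ℂ)‖ ≤ (4 * P + Q * (b - a)) / δ := by
  have hP0 : 0 ≤ P := (abs_nonneg _).trans (hP a (Set.left_mem_Icc.mpr hab))
  have hQ0 : 0 ≤ Q := (abs_nonneg _).trans (hQ a (Set.left_mem_Icc.mpr hab))
  have cF : ContinuousOn F (Set.Icc a b) := fun x hx => (hF x hx).continuousAt.continuousWithinAt
  have cF' : ContinuousOn F' (Set.Icc a b) := fun x hx =>
    (hF' x hx).continuousAt.continuousWithinAt
  have cψ : ContinuousOn ψ (Set.Icc a b) := fun x hx =>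
    (hψ x hx).continuousAt.continuousWithinAt
  -- Since `F' a ≥ 0`, the lower bound on `F''` integrates to linear growth of `F'`.
  have hlow : ∀ x ∈ Set.Icc a b, δ ^ 2 * (x - a) ≤ F' x := by
    intro x hx
    have := Convex.mul_sub_le_image_sub_of_le_deriv (convex_Icc a b) cF'
      (fun y hy => ((hF' y (interior_subset hy)).differentiableAt).differentiableWithinAt)
      (C := δ ^ 2)
      (fun y hy => by rw [(hF' y (interior_subset hy)).deriv]; exact hFδ y (interior_subset hy))
      a (Set.left_mem_Icc.mpr hab) x hx hx.1
    linarith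
  have triv : ∀ u v, a ≤ u → u ≤ v → v ≤ b →
      ‖∫ x in u..v, osc (F x) * (ψ x : ℂ)‖ ≤ P * (v - u) := by
    intro u v hu huv hv
    have := intervalIntegral.norm_integral_le_of_norm_le_const (a := u) (b := v) (C := P)
      (f := fun x => osc (F x) * (ψ x : ℂ)) (by
        intro x hx
        rw [Set.uIoc_of_le huv] at hx
        rw [norm_mul, norm_osc, one_mul, Complex.norm_real, Real.norm_eq_abs]
        exact hP x ⟨by linarith [hx.1], by linarith [hx.2]⟩)
    rwa [abs_of_nonneg (by linarith)] at this
  by_cases hb : b ≤ a + 1 / δ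
  · refine (triv a b le_rfl hab le_rfl).trans ?_
    rw [le_div_iff₀ hδ]
    have h1 : (b - a) * δ ≤ 1 := by
      rw [← le_div_iff₀ hδ]; linarith
    have h2 : 0 ≤ Q * (b - a) := mul_nonneg hQ0 (by linarith)
    nlinarith
  · push Not at hb
    -- Up to `c` the trivial bound costs `P / δ`; beyond `c` one has `F' ≥ δ² · (1/δ) = δ` and the
    -- first derivative test applies.
    set c := a + 1 / δ with hc
    have hac : a ≤ c := by have : 0 < 1 / δ := by positivity
                           linarith
    have hsub : Set.Icc c b ⊆ Set.Icc a b := Set.Icc_subset_Icc_left hac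
    have hge : ∀ x ∈ Set.Icc c b, δ ≤ F' x := by
      intro x hx
      refine le_trans ?_ (hlow x (hsub hx))
      have : 1 / δ ≤ x - a := by linarith [hx.1]
      calc δ = δ ^ 2 * (1 / δ) := by field_simp
        _ ≤ _ := by gcongr
    have hne : ∀ x ∈ Set.Icc c b, F' x ≠ 0 := fun x hx => (hδ.trans_le (hge x hx)).ne'
    have hcb : c ≤ b := hb.le
    have hK : ∫ x in c..b, |F'' x| / F' x ^ 2 ≤ 1 / δ := by
      have h1 : ∫ x in c..b, |F'' x| / F' x ^ 2 = ∫ x in c..b, F'' x / F' x ^ 2 := by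
        apply intervalIntegral.integral_congr
        intro x hx
        rw [Set.uIcc_of_le hcb] at hx
        simp only
        rw [abs_of_nonneg ((sq_nonneg δ).trans (hFδ x (hsub hx)))]
      -- Positivity of `F''` makes the variation of `1 / F'` telescope.
      have h2 : ∫ x in c..b, F'' x / F' x ^ 2 = -(F' b)⁻¹ - -(F' c)⁻¹ := by
        apply intervalIntegral.integral_eq_sub_of_hasDerivAt (f := fun x => -(F' x)⁻¹)
        · intro x hx
          rw [Set.uIcc_of_le hcb] at hx
          exact ((hF' x (hsub hx)).inv (hne x hx)).neg.congr_deriv (by ring)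
        · apply ContinuousOn.intervalIntegrable
          rw [Set.uIcc_of_le hcb]
          exact (hF''.mono hsub).div ((cF'.mono hsub).pow 2) fun x hx => pow_ne_zero _ (hne x hx)
      rw [h1, h2]
      have hb' : 0 < F' b := hδ.trans_le (hge b (Set.right_mem_Icc.mpr hcb))
      have : (F' c)⁻¹ ≤ δ⁻¹ := inv_anti₀ hδ (hge c (Set.left_mem_Icc.mpr hcb))
      have h3 : 0 ≤ (F' b)⁻¹ := by positivity
      rw [one_div]; linarith
    have key := norm_integral_osc_le_of_deriv hcb (fun x hx => hF x (hsub hx))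
      (fun x hx => hF' x (hsub hx)) (hF''.mono hsub) (fun x hx => hψ x (hsub hx))
      (hψ'.mono hsub) hδ hP0 (fun x hx => (hge x hx).trans (le_abs_self _))
      (fun x hx => hP x (hsub hx)) (fun x hx => hQ x (hsub hx)) hK
    have hint : ∀ u v, a ≤ u → u ≤ v → v ≤ b →
        IntervalIntegrable (fun x => osc (F x) * (ψ x : ℂ)) volume u v := by
      intro u v hu huv hv
      apply ContinuousOn.intervalIntegrable
      rw [Set.uIcc_of_le huv]
      exact ((continuous_osc.comp_continuousOn cF).mul
        (Complex.continuous_ofReal.comp_continuousOn cψ)).mono (Set.Icc_subset_Icc hu hv)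
    rw [← intervalIntegral.integral_add_adjacent_intervals (hint a c le_rfl hac hcb)
      (hint c b hac hcb le_rfl)]
    refine (norm_add_le _ _).trans ((add_le_add (triv a c le_rfl hac hcb) key).trans ?_)
    have : Q * (b - c) / δ ≤ Q * (b - a) / δ := by gcongr
    have e : P * (c - a) = P / δ := by rw [hc]; ring
    rw [e]
    calc _ ≤ P / δ + (2 * P / δ + Q * (b - a) / δ + P * (1 / δ)) := by linarith
      _ = _ := by ring

/-- Second derivative test (van der Corput). -/
lemma norm_integral_osc_le_of_deriv2 {a b : ℝ} (hab : a ≤ b) {F F' F'' : ℝ → ℝ} {ψ ψ' : ℝ → ℝ}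
    (hF : ∀ x ∈ Set.Icc a b, HasDerivAt F (F' x) x)
    (hF' : ∀ x ∈ Set.Icc a b, HasDerivAt F' (F'' x) x) (hF'' : ContinuousOn F'' (Set.Icc a b))
    (hψ : ∀ x ∈ Set.Icc a b, HasDerivAt ψ (ψ' x) x) (hψ' : ContinuousOn ψ' (Set.Icc a b))
    {δ P Q : ℝ} (hδ : 0 < δ) (hFδ : ∀ x ∈ Set.Icc a b, δ ^ 2 ≤ F'' x)
    (hP : ∀ x ∈ Set.Icc a b, |ψ x| ≤ P) (hQ : ∀ x ∈ Set.Icc a b, |ψ' x| ≤ Q) :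
    ‖∫ x in a..b, osc (F x) * (ψ x : ℂ)‖ ≤ 2 * ((4 * P + Q * (b - a)) / δ) := by
  have hP0 : 0 ≤ P := (abs_nonneg _).trans (hP a (Set.left_mem_Icc.mpr hab))
  have hQ0 : 0 ≤ Q := (abs_nonneg _).trans (hQ a (Set.left_mem_Icc.mpr hab))
  have cF : ContinuousOn F (Set.Icc a b) := fun x hx => (hF x hx).continuousAt.continuousWithinAt
  have cF' : ContinuousOn F' (Set.Icc a b) := fun x hx =>
    (hF' x hx).continuousAt.continuousWithinAt
  have cψ : ContinuousOn ψ (Set.Icc a b) := fun x hx =>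
    (hψ x hx).continuousAt.continuousWithinAt
  have right : ∀ c ∈ Set.Icc a b, 0 ≤ F' c →
      ‖∫ x in c..b, osc (F x) * (ψ x : ℂ)‖ ≤ (4 * P + Q * (b - a)) / δ := by
    intro c hc h0
    have hsub : Set.Icc c b ⊆ Set.Icc a b := Set.Icc_subset_Icc_left hc.1
    refine (norm_integral_osc_le_of_deriv2_right hc.2 (fun x hx => hF x (hsub hx))
      (fun x hx => hF' x (hsub hx)) (hF''.mono hsub) (fun x hx => hψ x (hsub hx))
      (hψ'.mono hsub) hδ h0 (fun x hx => hFδ x (hsub hx))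
      (fun x hx => hP x (hsub hx)) (fun x hx => hQ x (hsub hx))).trans ?_
    have := hc.1
    gcongr
  have left : ∀ c ∈ Set.Icc a b, F' c ≤ 0 →
      ‖∫ x in a..c, osc (F x) * (ψ x : ℂ)‖ ≤ (4 * P + Q * (b - a)) / δ := by
    intro c hc h0
    have hneg : ∀ x ∈ Set.Icc (-c) (-a), -x ∈ Set.Icc a b := fun x hx =>
      ⟨by linarith [hx.2], by linarith [hx.1, hc.2]⟩
    have hmaps : Set.MapsTo (fun x : ℝ => -x) (Set.Icc (-c) (-a)) (Set.Icc a b) := hneg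
    have dneg : ∀ x : ℝ, HasDerivAt (fun y : ℝ => -y) (-1) x := fun x => (hasDerivAt_id x).neg
    -- The reflection `x ↦ -x` keeps the second derivative and flips the sign of the first, so that
    -- it becomes nonnegative at the new left end `-c`.
    have := norm_integral_osc_le_of_deriv2_right (a := -c) (b := -a) (by linarith [hc.1])
      (F := fun x => F (-x)) (F' := fun x => -F' (-x)) (F'' := fun x => F'' (-x))
      (ψ := fun x => ψ (-x)) (ψ' := fun x => -ψ' (-x)) (δ := δ) (P := P) (Q := Q)
      (fun x hx => by
        exact ((hF (-x) (hneg x hx)).comp x (dneg x)).congr_deriv (by ring))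
      (fun x hx => by
        exact ((hF' (-x) (hneg x hx)).comp x (dneg x)).neg.congr_deriv (by ring))
      (hF''.comp continuous_neg.continuousOn hmaps)
      (fun x hx => by
        exact ((hψ (-x) (hneg x hx)).comp x (dneg x)).congr_deriv (by ring))
      ((hψ'.comp continuous_neg.continuousOn hmaps).neg) hδ
      (by simpa using h0) (fun x hx => hFδ _ (hneg x hx)) (fun x hx => hP _ (hneg x hx))
      (fun x hx => by rw [abs_neg]; exact hQ _ (hneg x hx))
    rw [intervalIntegral.integral_comp_neg (fun x => osc (F x) * (ψ x : ℂ)), neg_neg, neg_neg]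
      at this
    refine this.trans ?_
    have h1 : -a - -c ≤ b - a := by linarith [hc.2]
    gcongr
  have hB : 0 ≤ (4 * P + Q * (b - a)) / δ := by
    have : 0 ≤ b - a := by linarith
    positivity
  by_cases ha : 0 ≤ F' a
  · linarith [right a (Set.left_mem_Icc.mpr hab) ha]
  by_cases hb : F' b ≤ 0
  · linarith [left b (Set.right_mem_Icc.mpr hab) hb]
  push Not at ha hb
  -- The remaining case is a sign change of `F'`; cut at the stationary point and use one one-sided
  -- bound on each side.
  obtain ⟨c, hc, hc0⟩ := intermediate_value_Icc hab cF' ⟨ha.le, hb.le⟩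
  have hint : ∀ u v, a ≤ u → u ≤ v → v ≤ b →
      IntervalIntegrable (fun x => osc (F x) * (ψ x : ℂ)) volume u v := by
    intro u v hu huv hv
    apply ContinuousOn.intervalIntegrable
    rw [Set.uIcc_of_le huv]
    exact ((continuous_osc.comp_continuousOn cF).mul
      (Complex.continuous_ofReal.comp_continuousOn cψ)).mono (Set.Icc_subset_Icc hu hv)
  rw [← intervalIntegral.integral_add_adjacent_intervals (hint a c le_rfl hc.1 hc.2)
      (hint c b hc.1 hc.2 le_rfl)]
  refine (norm_add_le _ _).trans ?_
  linarith [left c hc hc0.le, right c hc hc0.ge]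

/-! ### Real interpolation -/

section Interpolation

variable {Y : Type*} [MeasurableSpace Y] {μ : Measure Y}

/-- Inner integral of Marcinkiewicz' argument after Tonelli: a point where `|f| = v` belongs to the
large part of `f` for the levels `l < v / c`, and the power of `l` is integrable at `0` because `q <
p`. -/
lemma lintegral_Ioi_rpow_lt {p q c v : ℝ} (hqp : q < p) (hc : 0 < c) (hv : 0 ≤ v) :
    ∫⁻ l in Set.Ioi (0 : ℝ), (if c * l < v then ENNReal.ofReal (v ^ q) else 0) *
      ENNReal.ofReal (l ^ (p - 1 - q)) ≤ ENNReal.ofReal (c ^ (q - p) / (p - q)) *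
        ENNReal.ofReal (v ^ p) := by
  rcases hv.eq_or_lt with rfl | hv
  · refine le_of_eq_of_le ?_ zero_le
    rw [setLIntegral_congr_fun (g := fun _ => 0) measurableSet_Ioi]
    · simp
    · intro l hl
      have : ¬ c * l < 0 := not_lt.mpr (mul_nonneg hc.le (le_of_lt hl))
      simp [this]
  have hpq : 0 < p - q := by linarith
  have e1 : ∀ l ∈ Set.Ioi (0 : ℝ), (if c * l < v then ENNReal.ofReal (v ^ q) else 0) *
      ENNReal.ofReal (l ^ (p - 1 - q)) = ENNReal.ofReal (v ^ q) *
        (Set.Iio (v / c)).indicator (fun l => ENNReal.ofReal (l ^ (p - 1 - q))) l := by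
    intro l hl
    by_cases h : c * l < v
    · have : l ∈ Set.Iio (v / c) := by rw [Set.mem_Iio, lt_div_iff₀ hc]; linarith
      rw [if_pos h, Set.indicator_of_mem this]
    · have : l ∉ Set.Iio (v / c) := by
        rw [Set.mem_Iio, lt_div_iff₀ hc]; intro h'; apply h; linarith
      rw [if_neg h, Set.indicator_of_notMem this]; simp
  have hvc : 0 ≤ v / c := by positivity
  rw [setLIntegral_congr_fun measurableSet_Ioi e1, lintegral_const_mul' _ _ ENNReal.ofReal_ne_top,
    lintegral_indicator measurableSet_Iio, Measure.restrict_restrict measurableSet_Iio,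
    Set.inter_comm, Set.Ioi_inter_Iio]
  have e2 : ∫⁻ l in Set.Ioo 0 (v / c), ENNReal.ofReal (l ^ (p - 1 - q)) =
      ENNReal.ofReal ((v / c) ^ (p - q) / (p - q)) := by
    have hint : IntervalIntegrable (fun l : ℝ => l ^ (p - 1 - q)) volume 0 (v / c) :=
      intervalIntegral.intervalIntegrable_rpow' (by linarith)
    rw [Measure.restrict_congr_set Ioo_ae_eq_Ioc, ← ofReal_integral_eq_lintegral_ofReal]
    · rw [← intervalIntegral.integral_of_le hvc, integral_rpow (Or.inl (by linarith))]
      rw [show p - 1 - q + 1 = p - q by ring, Real.zero_rpow hpq.ne', sub_zero]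
    · exact (intervalIntegrable_iff_integrableOn_Ioc_of_le hvc).mp hint
    · filter_upwards [ae_restrict_mem measurableSet_Ioc] with l hl
      exact Real.rpow_nonneg hl.1.le _
  rw [e2, ← ENNReal.ofReal_mul (by positivity), ← ENNReal.ofReal_mul (by positivity)]
  apply le_of_eq
  congr 1
  rw [Real.div_rpow hv.le hc.le, show q - p = -(p - q) by ring, Real.rpow_neg hc.le,
    show v ^ p = v ^ q * v ^ (p - q) by rw [← Real.rpow_add hv]; congr 1; ring]
  field_simp

/-- Counterpart for the small part of `f`: the levels are now `l ≥ v / c`, and the power of `l` is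
integrable at infinity because `p < q`. -/
lemma lintegral_Ioi_rpow_ge {p q c v : ℝ} (hpq : p < q) (hp : 0 < p) (hc : 0 < c) (hv : 0 ≤ v) :
    ∫⁻ l in Set.Ioi (0 : ℝ), (if c * l < v then 0 else ENNReal.ofReal (v ^ q)) *
      ENNReal.ofReal (l ^ (p - 1 - q)) ≤ ENNReal.ofReal (c ^ (q - p) / (q - p)) *
        ENNReal.ofReal (v ^ p) := by
  have hqp : 0 < q - p := by linarith
  rcases hv.eq_or_lt with rfl | hv
  · simp [Real.zero_rpow (hp.trans hpq).ne']
  have hvc : 0 < v / c := by positivity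
  have e1 : ∀ l ∈ Set.Ioi (0 : ℝ), (if c * l < v then 0 else ENNReal.ofReal (v ^ q)) *
      ENNReal.ofReal (l ^ (p - 1 - q)) = ENNReal.ofReal (v ^ q) *
        (Set.Ici (v / c)).indicator (fun l => ENNReal.ofReal (l ^ (p - 1 - q))) l := by
    intro l hl
    by_cases h : c * l < v
    · have : l ∉ Set.Ici (v / c) := by rw [Set.mem_Ici, div_le_iff₀ hc]; linarith
      rw [if_pos h, Set.indicator_of_notMem this]; simp
    · have : l ∈ Set.Ici (v / c) := by
        rw [Set.mem_Ici, div_le_iff₀ hc]; linarith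
      rw [if_neg h, Set.indicator_of_mem this]
  rw [setLIntegral_congr_fun measurableSet_Ioi e1, lintegral_const_mul' _ _ ENNReal.ofReal_ne_top,
    lintegral_indicator measurableSet_Ici, Measure.restrict_restrict measurableSet_Ici,
    Set.inter_eq_left.mpr (Set.Ici_subset_Ioi.mpr hvc), Measure.restrict_congr_set
    Ioi_ae_eq_Ici.symm]
  have e2 : ∫⁻ l in Set.Ioi (v / c), ENNReal.ofReal (l ^ (p - 1 - q)) =
      ENNReal.ofReal ((v / c) ^ (p - q) / (q - p)) := by
    rw [← ofReal_integral_eq_lintegral_ofReal]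
    · rw [integral_Ioi_rpow_of_lt (by linarith) hvc]
      rw [show p - 1 - q + 1 = p - q by ring, ← neg_div_neg_eq, neg_neg, neg_sub]
    · exact integrableOn_Ioi_rpow_of_lt (by linarith) hvc
    · filter_upwards [ae_restrict_mem measurableSet_Ioi] with l hl
      exact Real.rpow_nonneg (hvc.trans hl).le _
  rw [e2, ← ENNReal.ofReal_mul (by positivity), ← ENNReal.ofReal_mul (by positivity)]
  apply le_of_eq
  congr 1
  rw [Real.div_rpow hv.le hc.le, show q - p = -(p - q) by ring, Real.rpow_neg hc.le,
    show v ^ p = v ^ q * v ^ (p - q) by rw [← Real.rpow_add hv]; congr 1; ring]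
  field_simp

lemma lintegral_indicator_lt_rpow [SFinite μ] {v : Y → ℝ} (hvm : Measurable v) (hv : ∀ y, 0 ≤ v y)
    {p q c : ℝ} (hqp : q < p) (hc : 0 < c) :
    ∫⁻ l in Set.Ioi (0 : ℝ), (∫⁻ y, if c * l < v y then ENNReal.ofReal (v y ^ q) else 0 ∂μ) *
      ENNReal.ofReal (l ^ (p - 1 - q)) ≤ ENNReal.ofReal (c ^ (q - p) / (p - q)) *
        ∫⁻ y, ENNReal.ofReal (v y ^ p) ∂μ := by
  have hm : Measurable (fun z : ℝ × Y => (if c * z.1 < v z.2 then ENNReal.ofReal (v z.2 ^ q) else 0)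
      * ENNReal.ofReal (z.1 ^ (p - 1 - q))) := by
    refine Measurable.mul (Measurable.ite ?_ (by fun_prop) measurable_const) (by fun_prop)
    exact measurableSet_lt (by fun_prop) (by fun_prop)
  calc _ = ∫⁻ l in Set.Ioi (0 : ℝ), ∫⁻ y, (if c * l < v y then ENNReal.ofReal (v y ^ q) else 0) *
      ENNReal.ofReal (l ^ (p - 1 - q)) ∂μ := by
        congr 1; ext l; rw [lintegral_mul_const' _ _ ENNReal.ofReal_ne_top]
    _ = ∫⁻ y, (∫⁻ l in Set.Ioi (0 : ℝ), (if c * l < v y then ENNReal.ofReal (v y ^ q) else 0) *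
      ENNReal.ofReal (l ^ (p - 1 - q))) ∂μ := lintegral_lintegral_swap hm.aemeasurable
    _ ≤ ∫⁻ y, ENNReal.ofReal (c ^ (q - p) / (p - q)) * ENNReal.ofReal (v y ^ p) ∂μ :=
        lintegral_mono fun y => lintegral_Ioi_rpow_lt hqp hc (hv y)
    _ = _ := lintegral_const_mul' _ _ ENNReal.ofReal_ne_top

lemma lintegral_indicator_ge_rpow [SFinite μ] {v : Y → ℝ} (hvm : Measurable v) (hv : ∀ y, 0 ≤ v y)
    {p q c : ℝ} (hpq : p < q) (hp : 0 < p) (hc : 0 < c) :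
    ∫⁻ l in Set.Ioi (0 : ℝ), (∫⁻ y, if c * l < v y then 0 else ENNReal.ofReal (v y ^ q) ∂μ) *
      ENNReal.ofReal (l ^ (p - 1 - q)) ≤ ENNReal.ofReal (c ^ (q - p) / (q - p)) *
        ∫⁻ y, ENNReal.ofReal (v y ^ p) ∂μ := by
  have hm : Measurable (fun z : ℝ × Y => (if c * z.1 < v z.2 then 0 else ENNReal.ofReal (v z.2 ^ q))
      * ENNReal.ofReal (z.1 ^ (p - 1 - q))) := by
    refine Measurable.mul (Measurable.ite ?_ measurable_const (by fun_prop)) (by fun_prop)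
    exact measurableSet_lt (by fun_prop) (by fun_prop)
  calc _ = ∫⁻ l in Set.Ioi (0 : ℝ), ∫⁻ y, (if c * l < v y then 0 else ENNReal.ofReal (v y ^ q)) *
      ENNReal.ofReal (l ^ (p - 1 - q)) ∂μ := by
        congr 1; ext l; rw [lintegral_mul_const' _ _ ENNReal.ofReal_ne_top]
    _ = ∫⁻ y, (∫⁻ l in Set.Ioi (0 : ℝ), (if c * l < v y then 0 else ENNReal.ofReal (v y ^ q)) *
      ENNReal.ofReal (l ^ (p - 1 - q))) ∂μ := lintegral_lintegral_swap hm.aemeasurable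
    _ ≤ ∫⁻ y, ENNReal.ofReal (c ^ (q - p) / (q - p)) * ENNReal.ofReal (v y ^ p) ∂μ :=
        lintegral_mono fun y => lintegral_Ioi_rpow_ge hpq hp hc (hv y)
    _ = _ := lintegral_const_mul' _ _ ENNReal.ofReal_ne_top

lemma measure_le_norm_le_lintegral {g : Y → ℂ} (hg : AEStronglyMeasurable g μ) {s q : ℝ}
    (hs : 0 < s) (hq : 0 < q) :
    μ {y | s ≤ ‖g y‖} ≤ ENNReal.ofReal (s ^ (-q)) * ∫⁻ y, ENNReal.ofReal (‖g y‖ ^ q) ∂μ := by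
  rw [← lintegral_const_mul' _ _ ENNReal.ofReal_ne_top]
  have hm : AEMeasurable (fun y => ‖g y‖) μ := hg.norm.aemeasurable
  refine meas_le_lintegral₀ (by fun_prop) fun y hy => ?_
  rw [← ENNReal.ofReal_mul (by positivity), ENNReal.one_le_ofReal, Real.rpow_neg hs.le]
  have : s ^ q ≤ ‖g y‖ ^ q := Real.rpow_le_rpow hs.le hy hq.le
  have h0 : 0 < s ^ q := by positivity
  rw [inv_mul_eq_div, one_le_div h0]
  exact this

/-- Measurable, bounded and integrable functions. -/
structure IsTestFunction (μ : Measure Y) (f : Y → ℂ) : Prop where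
  measurable : Measurable f
  integrable : Integrable f μ
  bounded : ∃ M : ℝ, ∀ y, ‖f y‖ ≤ M

/-- Interpolation cuts a function at a height. This closure property is the reason for working with
test functions rather than Schwartz functions. -/
lemma IsTestFunction.indicator {f : Y → ℂ} (hf : IsTestFunction μ f) {s : Set Y}
    (hs : MeasurableSet s) : IsTestFunction μ (s.indicator f) where
  measurable := hf.measurable.indicator hs
  integrable := hf.integrable.indicator hs
  bounded := by
    obtain ⟨M, hM⟩ := hf.bounded
    exact ⟨M, fun y => (norm_indicator_le_norm_self f y).trans (hM y)⟩

/-- An additive operator on test functions, bounded by `A` on `L¹` and `L^∞`, by `B` on `L²`. -/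
structure IsInterpolable (μ : Measure Y) (T : (Y → ℂ) → Y → ℂ) (A B : ℝ) : Prop where
  map_add : ∀ f g, IsTestFunction μ f → IsTestFunction μ g → T (f + g) = T f + T g
  aestronglyMeasurable : ∀ f, IsTestFunction μ f → AEStronglyMeasurable (T f) μ
  bound_one : ∀ f, IsTestFunction μ f → ∫⁻ y, ENNReal.ofReal (‖T f y‖ ^ (1 : ℝ)) ∂μ ≤
    ENNReal.ofReal A * ∫⁻ y, ENNReal.ofReal (‖f y‖ ^ (1 : ℝ)) ∂μ
  bound_two : ∀ f, IsTestFunction μ f → ∫⁻ y, ENNReal.ofReal (‖T f y‖ ^ (2 : ℝ)) ∂μ ≤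
    ENNReal.ofReal (B ^ 2) * ∫⁻ y, ENNReal.ofReal (‖f y‖ ^ (2 : ℝ)) ∂μ
  bound_top : ∀ f, IsTestFunction μ f → ∀ M, (∀ y, ‖f y‖ ≤ M) → ∀ y, ‖T f y‖ ≤ A * M

lemma ofReal_norm_indicator_lt {Z : Type*} {f : Z → ℂ} {q : ℝ} (hq : q ≠ 0) (s : ℝ) (y : Z) :
    ENNReal.ofReal (‖Set.indicator {y | s < ‖f y‖} f y‖ ^ q) =
      if s < ‖f y‖ then ENNReal.ofReal (‖f y‖ ^ q) else 0 := by
  by_cases h : s < ‖f y‖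
  · rw [if_pos h, Set.indicator_of_mem (by exact h)]
  · rw [if_neg h, Set.indicator_of_notMem (by exact h)]; simp [Real.zero_rpow hq]

lemma ofReal_norm_indicator_ge {Z : Type*} {f : Z → ℂ} {q : ℝ} (hq : q ≠ 0) (s : ℝ) (y : Z) :
    ENNReal.ofReal (‖Set.indicator {y | s < ‖f y‖}ᶜ f y‖ ^ q) =
      if s < ‖f y‖ then 0 else ENNReal.ofReal (‖f y‖ ^ q) := by
  by_cases h : s < ‖f y‖
  · rw [if_pos h, Set.indicator_of_notMem (by simpa using h)]; simp [Real.zero_rpow hq]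
  · rw [if_neg h, Set.indicator_of_mem (by exact h)]

lemma measure_lt_norm_add_le {g h : Y → ℂ} (s : ℝ) :
    μ {y | s < ‖(g + h) y‖} ≤ μ {y | s / 2 ≤ ‖g y‖} + μ {y | s / 2 ≤ ‖h y‖} := by
  refine (measure_mono ?_).trans (measure_union_le _ _)
  intro y hy
  by_contra hcon
  simp only [Set.mem_union, Set.mem_ofPred_eq, not_or, not_le] at hcon hy
  have := norm_add_le (g y) (h y)
  simp only [Pi.add_apply] at hy
  linarith

variable {T : (Y → ℂ) → Y → ℂ} {A B : ℝ}

/-- Cut `f` at height `c l` and apply Chebyshev's inequality, with the `L¹` bound on the large part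
and the `L²` bound on the small part. The constant `c` stays free, to be optimised later. -/
lemma measure_lt_norm_le_of_lt_two (hT : IsInterpolable μ T A B) {f : Y → ℂ}
    (hf : IsTestFunction μ f) (c : ℝ) {l : ℝ} (hl : 0 < l) :
    μ {y | l < ‖T f y‖} ≤
      ENNReal.ofReal ((l / 2) ^ (-(1 : ℝ))) * (ENNReal.ofReal A *
        ∫⁻ y, if c * l < ‖f y‖ then ENNReal.ofReal (‖f y‖ ^ (1 : ℝ)) else 0 ∂μ) +
      ENNReal.ofReal ((l / 2) ^ (-(2 : ℝ))) * (ENNReal.ofReal (B ^ 2) *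
        ∫⁻ y, if c * l < ‖f y‖ then 0 else ENNReal.ofReal (‖f y‖ ^ (2 : ℝ)) ∂μ) := by
  have hs : MeasurableSet {y | c * l < ‖f y‖} :=
    measurableSet_lt measurable_const hf.measurable.norm
  have h1 := hf.indicator hs
  have h2 := hf.indicator hs.compl
  have hsplit : T f = T (Set.indicator {y | c * l < ‖f y‖} f) +
      T (Set.indicator {y | c * l < ‖f y‖}ᶜ f) := by
    rw [← hT.map_add _ _ h1 h2, Set.indicator_self_add_compl]
  rw [hsplit]
  refine (measure_lt_norm_add_le l).trans (add_le_add ?_ ?_)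
  · refine (measure_le_norm_le_lintegral (hT.aestronglyMeasurable _ h1) (half_pos hl)
      one_pos).trans ?_
    gcongr
    refine (hT.bound_one _ h1).trans_eq ?_
    simp_rw [ofReal_norm_indicator_lt one_ne_zero]
  · refine (measure_le_norm_le_lintegral (hT.aestronglyMeasurable _ h2) (half_pos hl)
      two_pos).trans ?_
    gcongr
    refine (hT.bound_two _ h2).trans_eq ?_
    simp_rw [ofReal_norm_indicator_ge two_ne_zero]

/-- With cutting height `l / (4A)` the image of the bounded part never exceeds `l / 4`, so only the
large part can contribute to the level set, and it is handled by the `L²` bound. -/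
lemma measure_lt_norm_le_of_two_lt (hT : IsInterpolable μ T A B) (hA : 0 < A) {f : Y → ℂ}
    (hf : IsTestFunction μ f) {l : ℝ} (hl : 0 < l) :
    μ {y | l < ‖T f y‖} ≤
      ENNReal.ofReal ((l / 2) ^ (-(2 : ℝ))) * (ENNReal.ofReal (B ^ 2) *
        ∫⁻ y, if 1 / (4 * A) * l < ‖f y‖ then ENNReal.ofReal (‖f y‖ ^ (2 : ℝ)) else 0 ∂μ) := by
  set c := 1 / (4 * A) with hc
  have hs : MeasurableSet {y | c * l < ‖f y‖} :=
    measurableSet_lt measurable_const hf.measurable.norm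
  have h1 := hf.indicator hs
  have h2 := hf.indicator hs.compl
  have hsplit : T f = T (Set.indicator {y | c * l < ‖f y‖} f) +
      T (Set.indicator {y | c * l < ‖f y‖}ᶜ f) := by
    rw [← hT.map_add _ _ h1 h2, Set.indicator_self_add_compl]
  have hcl : 0 ≤ c * l := by positivity
  have h3 : ∀ y, ‖T (Set.indicator {y | c * l < ‖f y‖}ᶜ f) y‖ ≤ A * (c * l) := by
    refine hT.bound_top _ h2 _ fun y => ?_
    by_cases h : y ∈ {y | c * l < ‖f y‖}ᶜ
    · rw [Set.indicator_of_mem h]; exact not_lt.mp h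
    · rw [Set.indicator_of_notMem h]; simpa using hcl
  have h4 : {y | l / 2 ≤ ‖T (Set.indicator {y | c * l < ‖f y‖}ᶜ f) y‖} = ∅ := by
    apply Set.eq_empty_of_forall_notMem
    intro y hy
    have h5 := (hy : l / 2 ≤ _).trans (h3 y)
    have : A * (c * l) = l / 4 := by rw [hc]; field_simp
    linarith
  rw [hsplit]
  refine (measure_lt_norm_add_le l).trans ?_
  rw [h4, measure_empty, add_zero]
  refine (measure_le_norm_le_lintegral (hT.aestronglyMeasurable _ h1) (half_pos hl)
    two_pos).trans ?_
  gcongr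
  refine (hT.bound_two _ h1).trans_eq ?_
  simp_rw [ofReal_norm_indicator_lt two_ne_zero]

lemma ofReal_half_rpow_mul {l p q : ℝ} (hl : 0 < l) (D N : ℝ≥0∞) :
    ENNReal.ofReal ((l / 2) ^ (-q)) * (D * N) * ENNReal.ofReal (l ^ (p - 1)) =
      ENNReal.ofReal (2 ^ q) * D * (N * ENNReal.ofReal (l ^ (p - 1 - q))) := by
  have : ENNReal.ofReal ((l / 2) ^ (-q)) * ENNReal.ofReal (l ^ (p - 1)) =
      ENNReal.ofReal (2 ^ q) * ENNReal.ofReal (l ^ (p - 1 - q)) := by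
    rw [← ENNReal.ofReal_mul (by positivity), ← ENNReal.ofReal_mul (by positivity)]
    congr 1
    rw [Real.div_rpow hl.le two_pos.le, Real.rpow_neg two_pos.le, sub_eq_add_neg (p - 1) q,
      Real.rpow_add hl]
    field_simp
  calc _ = (ENNReal.ofReal ((l / 2) ^ (-q)) * ENNReal.ofReal (l ^ (p - 1))) * D * N := by ring
    _ = _ := by rw [this]; ring

/-- Marcinkiewicz interpolation between `L¹` and `L²`. -/
theorem IsInterpolable.lintegral_rpow_le_of_lt_two [SFinite μ] (hT : IsInterpolable μ T A B) (hA : 0 < A)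
    (hB : 0 < B) {p : ℝ} (hp1 : 1 < p) (hp2 : p < 2) {f : Y → ℂ} (hf : IsTestFunction μ f) :
    ∫⁻ y, ENNReal.ofReal (‖T f y‖ ^ p) ∂μ ≤
      ENNReal.ofReal (p * (2 / (p - 1) + 4 / (2 - p)) * (A ^ (2 - p) * B ^ (2 * (p - 1)))) *
        ∫⁻ y, ENNReal.ofReal (‖f y‖ ^ p) ∂μ := by
  -- This `c` equalises the two contributions `A c^{1-p}` and `B² c^{2-p}`, and so produces the
  -- geometric mean of the endpoint norms.
  set c := A / B ^ 2 with hc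
  have hc0 : 0 < c := by positivity
  have hp0 : 0 < p := by linarith
  have hvm : Measurable fun y => ‖f y‖ := hf.measurable.norm
  have hfm := hf.measurable
  set N1 : ℝ → ℝ≥0∞ := fun l => ∫⁻ y, if c * l < ‖f y‖ then ENNReal.ofReal (‖f y‖ ^ (1 : ℝ)) else 0 ∂μ
  set N2 : ℝ → ℝ≥0∞ := fun l => ∫⁻ y, if c * l < ‖f y‖ then 0 else ENNReal.ofReal (‖f y‖ ^ (2 : ℝ)) ∂μ
  have hN1m : Measurable N1 := by
    apply Measurable.lintegral_prod_right'
      (f := fun z : ℝ × Y => if c * z.1 < ‖f z.2‖ then ENNReal.ofReal (‖f z.2‖ ^ (1 : ℝ)) else 0)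
    refine Measurable.ite (measurableSet_lt (by fun_prop) (by fun_prop)) (by fun_prop)
      measurable_const
  set I := ∫⁻ y, ENNReal.ofReal (‖f y‖ ^ p) ∂μ with hI
  rw [lintegral_rpow_eq_lintegral_meas_lt_mul μ (ae_of_all _ fun y => norm_nonneg _)
    (hT.aestronglyMeasurable f hf).norm.aemeasurable hp0]
  calc ENNReal.ofReal p * ∫⁻ l in Set.Ioi 0, μ {y | l < ‖T f y‖} * ENNReal.ofReal (l ^ (p - 1))
      ≤ ENNReal.ofReal p * ∫⁻ l in Set.Ioi 0,
        (ENNReal.ofReal (2 ^ (1 : ℝ)) * ENNReal.ofReal A *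
            (N1 l * ENNReal.ofReal (l ^ (p - 1 - 1))) +
          ENNReal.ofReal (2 ^ (2 : ℝ)) * ENNReal.ofReal (B ^ 2) *
            (N2 l * ENNReal.ofReal (l ^ (p - 1 - 2)))) := by
        gcongr ENNReal.ofReal p * ?_
        refine setLIntegral_mono' measurableSet_Ioi fun l hl => ?_
        rw [← ofReal_half_rpow_mul hl, ← ofReal_half_rpow_mul hl, ← add_mul]
        gcongr
        exact measure_lt_norm_le_of_lt_two hT hf c hl
    _ ≤ ENNReal.ofReal p * (ENNReal.ofReal (2 ^ (1 : ℝ)) * ENNReal.ofReal A *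
            (ENNReal.ofReal (c ^ (1 - p) / (p - 1)) * I) +
          ENNReal.ofReal (2 ^ (2 : ℝ)) * ENNReal.ofReal (B ^ 2) *
            (ENNReal.ofReal (c ^ (2 - p) / (2 - p)) * I)) := by
        rw [lintegral_add_left (by fun_prop), lintegral_const_mul' _ _ (by finiteness),
          lintegral_const_mul' _ _ (by finiteness)]
        gcongr
        · exact lintegral_indicator_lt_rpow hvm (fun y => norm_nonneg _) hp1 hc0
        · exact lintegral_indicator_ge_rpow hvm (fun y => norm_nonneg _) hp2 hp0 hc0
    _ = ENNReal.ofReal (p * (2 ^ (1 : ℝ) * A * (c ^ (1 - p) / (p - 1)) +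
          2 ^ (2 : ℝ) * B ^ 2 * (c ^ (2 - p) / (2 - p)))) * I := by
        have h1 : 0 ≤ c ^ (1 - p) / (p - 1) := div_nonneg (by positivity) (by linarith)
        have h2 : 0 ≤ c ^ (2 - p) / (2 - p) := div_nonneg (by positivity) (by linarith)
        rw [ENNReal.ofReal_mul hp0.le, ENNReal.ofReal_add (by positivity) (by positivity),
          ENNReal.ofReal_mul (by positivity), ENNReal.ofReal_mul (by positivity),
          ENNReal.ofReal_mul (by positivity), ENNReal.ofReal_mul (by positivity)]
        ring
    _ = _ := by
        congr 2
        have hA2 : A = A ^ (2 - p) * A ^ (p - 1) := by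
          rw [← Real.rpow_add hA]; ring_nf; simp
        have e1 : A * c ^ (1 - p) = A ^ (2 - p) * B ^ (2 * (p - 1)) := by
          rw [hc, Real.div_rpow hA.le (by positivity), ← Real.rpow_natCast, ← Real.rpow_mul hB.le,
            show ((2 : ℕ) : ℝ) * (1 - p) = -(2 * (p - 1)) by push_cast; ring, Real.rpow_neg hB.le,
            show (1 - p) = -(p - 1) by ring, Real.rpow_neg hA.le]
          nth_rewrite 1 [hA2]
          field_simp
        have e2 : B ^ 2 * c ^ (2 - p) = A ^ (2 - p) * B ^ (2 * (p - 1)) := by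
          have hB2 : B ^ 2 = B ^ (2 * (2 - p)) * B ^ (2 * (p - 1)) := by
            rw [← Real.rpow_add hB, ← Real.rpow_natCast]; congr 1; push_cast; ring
          rw [hc, Real.div_rpow hA.le (by positivity), ← Real.rpow_natCast B, ← Real.rpow_mul hB.le,
            show ((2 : ℕ) : ℝ) * (2 - p) = (2 * (2 - p)) by push_cast; ring, Real.rpow_natCast]
          nth_rewrite 1 [hB2]
          field_simp
        calc _ = p * (2 / (p - 1) * (A * c ^ (1 - p)) + 4 / (2 - p) * (B ^ 2 * c ^ (2 - p))) := by
              rw [Real.rpow_one, Real.rpow_two]; ring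
          _ = _ := by rw [e1, e2]; ring

/-- Marcinkiewicz interpolation between `L²` and `L^∞`. -/
theorem IsInterpolable.lintegral_rpow_le_of_two_lt [SFinite μ] (hT : IsInterpolable μ T A B) (hA : 0 < A)
    (hB : 0 < B) {p : ℝ} (hp2 : 2 < p) {f : Y → ℂ} (hf : IsTestFunction μ f) :
    ∫⁻ y, ENNReal.ofReal (‖T f y‖ ^ p) ∂μ ≤
      ENNReal.ofReal (p * (4 / (p - 2)) * 4 ^ (p - 2) * (A ^ (p - 2) * B ^ (2 : ℝ))) *
        ∫⁻ y, ENNReal.ofReal (‖f y‖ ^ p) ∂μ := by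
  set c := 1 / (4 * A) with hc
  have hc0 : 0 < c := by positivity
  have hp0 : 0 < p := by linarith
  have hvm : Measurable fun y => ‖f y‖ := hf.measurable.norm
  set N1 : ℝ → ℝ≥0∞ := fun l => ∫⁻ y, if c * l < ‖f y‖ then ENNReal.ofReal (‖f y‖ ^ (2 : ℝ)) else 0 ∂μ
  set I := ∫⁻ y, ENNReal.ofReal (‖f y‖ ^ p) ∂μ with hI
  rw [lintegral_rpow_eq_lintegral_meas_lt_mul μ (ae_of_all _ fun y => norm_nonneg _)
    (hT.aestronglyMeasurable f hf).norm.aemeasurable hp0]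
  calc ENNReal.ofReal p * ∫⁻ l in Set.Ioi 0, μ {y | l < ‖T f y‖} * ENNReal.ofReal (l ^ (p - 1))
      ≤ ENNReal.ofReal p * ∫⁻ l in Set.Ioi 0,
        ENNReal.ofReal (2 ^ (2 : ℝ)) * ENNReal.ofReal (B ^ 2) *
            (N1 l * ENNReal.ofReal (l ^ (p - 1 - 2))) := by
        gcongr ENNReal.ofReal p * ?_
        refine setLIntegral_mono' measurableSet_Ioi fun l hl => ?_
        rw [← ofReal_half_rpow_mul hl]
        gcongr
        exact measure_lt_norm_le_of_two_lt hT hA hf hl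
    _ ≤ ENNReal.ofReal p * (ENNReal.ofReal (2 ^ (2 : ℝ)) * ENNReal.ofReal (B ^ 2) *
            (ENNReal.ofReal (c ^ (2 - p) / (p - 2)) * I)) := by
        rw [lintegral_const_mul' _ _ (by finiteness)]
        gcongr
        exact lintegral_indicator_lt_rpow hvm (fun y => norm_nonneg _) hp2 hc0
    _ = ENNReal.ofReal (p * (2 ^ (2 : ℝ) * B ^ 2 * (c ^ (2 - p) / (p - 2)))) * I := by
        have h2 : 0 ≤ c ^ (2 - p) / (p - 2) := div_nonneg (by positivity) (by linarith)
        rw [ENNReal.ofReal_mul hp0.le, 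
          ENNReal.ofReal_mul (by positivity), ENNReal.ofReal_mul (by positivity)]
        ring
    _ = _ := by
        congr 2
        have e2 : c ^ (2 - p) = 4 ^ (p - 2) * A ^ (p - 2) := by
          rw [hc, Real.div_rpow one_pos.le (by positivity), Real.one_rpow, one_div,
            ← Real.rpow_neg (by positivity), Real.mul_rpow (by norm_num) hA.le, neg_sub]
        rw [e2, Real.rpow_two, Real.rpow_two]
        ring

end Interpolation

/-! ### Averages of translates -/

section Translates

set_option linter.unusedSectionVars false

open FourierTransform

variable {X : Type*} [MeasurableSpace X] {ν : Measure X}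
  {V : Type*} [NormedAddCommGroup V] [InnerProductSpace ℝ V] [FiniteDimensional ℝ V]
  [MeasurableSpace V] [BorelSpace V]

/-- The operator `f ↦ ∫ f(· - γ(t)) k(t) dν(t)`. -/
def translOp (ν : Measure X) (γ : X → V) (k : X → ℂ) (f : V → ℂ) (x : V) : ℂ :=
  ∫ t, f (x - γ t) * k t ∂ν

variable {γ : X → V} {k : X → ℂ} {f g : V → ℂ}

lemma measurable_comp_sub (hγ : Measurable γ) (hf : Measurable f) :
    Measurable fun z : V × X => f (z.1 - γ z.2) :=
  hf.comp (measurable_fst.sub (hγ.comp measurable_snd))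

lemma aestronglyMeasurable_translate_mul [SFinite ν] (hγ : Measurable γ) (hf : Measurable f)
    (hk : Integrable k ν) :
    AEStronglyMeasurable (fun z : V × X => f (z.1 - γ z.2) * k z.2) (volume.prod ν) :=
  (measurable_comp_sub hγ hf).aestronglyMeasurable.mul hk.aestronglyMeasurable.comp_snd

lemma integrable_translate_mul (hγ : Measurable γ) (hk : Integrable k ν) (hf : Measurable f)
    {M : ℝ} (hM : ∀ y, ‖f y‖ ≤ M) (x : V) : Integrable (fun t => f (x - γ t) * k t) ν :=
  hk.bdd_mul (hf.comp (measurable_const.sub hγ)).aestronglyMeasurable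
    (ae_of_all _ fun t => hM (x - γ t))

lemma translOp_add (hγ : Measurable γ) (hk : Integrable k ν)
    (hf : IsTestFunction volume f) (hg : IsTestFunction volume g) :
    translOp ν γ k (f + g) = translOp ν γ k f + translOp ν γ k g := by
  obtain ⟨M, hM⟩ := hf.bounded
  obtain ⟨N, hN⟩ := hg.bounded
  ext x
  simp only [translOp, Pi.add_apply, add_mul]
  exact integral_add (integrable_translate_mul hγ hk hf.measurable hM x)
    (integrable_translate_mul hγ hk hg.measurable hN x)

lemma aestronglyMeasurable_translOp [SFinite ν] (hγ : Measurable γ) (hk : Integrable k ν)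
    (hf : Measurable f) : AEStronglyMeasurable (translOp ν γ k f) volume :=
  (aestronglyMeasurable_translate_mul hγ hf hk).integral_prod_right'

lemma norm_translOp_le {A : ℝ} (hk : Integrable k ν) (hA : ∫ t, ‖k t‖ ∂ν ≤ A) {M : ℝ}
    (hM : ∀ y, ‖f y‖ ≤ M) (x : V) : ‖translOp ν γ k f x‖ ≤ A * M := by
  have hM0 : 0 ≤ M := (norm_nonneg _).trans (hM 0)
  calc _ ≤ ∫ t, M * ‖k t‖ ∂ν :=
        norm_integral_le_of_norm_le (hk.norm.const_mul M) (ae_of_all _ fun t => by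
          rw [norm_mul]; exact mul_le_mul_of_nonneg_right (hM _) (norm_nonneg _))
    _ = M * ∫ t, ‖k t‖ ∂ν := integral_const_mul _ _
    _ ≤ _ := by rw [mul_comm]; gcongr

lemma lintegral_enorm_le_ofReal {A : ℝ} (hk : Integrable k ν) (hA : ∫ t, ‖k t‖ ∂ν ≤ A) :
    ∫⁻ t, ‖k t‖ₑ ∂ν ≤ ENNReal.ofReal A := by
  rw [← ofReal_integral_norm_eq_lintegral_enorm hk]
  exact ENNReal.ofReal_le_ofReal hA

lemma lintegral_lintegral_translate [SFinite ν] (hγ : Measurable γ) {u : V → ℝ≥0∞}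
    (hu : Measurable u) {w : X → ℝ≥0∞} (hw : AEMeasurable w ν) :
    ∫⁻ x, ∫⁻ t, u (x - γ t) * w t ∂ν = (∫⁻ t, w t ∂ν) * ∫⁻ x, u x := by
  rw [lintegral_lintegral_swap]
  · have : ∀ t, ∫⁻ x, u (x - γ t) * w t = w t * ∫⁻ x, u x := by
      intro t
      rw [lintegral_mul_const _ (by fun_prop), lintegral_sub_right_eq_self u, mul_comm]
    simp_rw [this]
    rw [lintegral_mul_const'' _ hw]
  · exact (hu.comp (measurable_fst.sub (hγ.comp measurable_snd))).aemeasurable.mul hw.comp_snd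

lemma lintegral_enorm_translOp_le [SFinite ν] (hγ : Measurable γ) (hk : Integrable k ν)
    (hf : Measurable f) :
    ∫⁻ x, ‖translOp ν γ k f x‖ₑ ≤ (∫⁻ t, ‖k t‖ₑ ∂ν) * ∫⁻ x, ‖f x‖ₑ := by
  rw [← lintegral_lintegral_translate hγ hf.enorm hk.aestronglyMeasurable.enorm]
  refine lintegral_mono fun x => (enorm_integral_le_lintegral_enorm _).trans_eq ?_
  simp_rw [enorm_mul]

/-- Cauchy–Schwarz with `|k| = |k|^{1/2} |k|^{1/2}`, then Tonelli and translation invariance. This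
crude bound ignores oscillation; it serves only for membership in `L²` and for approximation errors.
-/
lemma lintegral_enorm_sq_translOp_le [SFinite ν] (hγ : Measurable γ) (hk : Integrable k ν)
    (hf : Measurable f) :
    ∫⁻ x, ‖translOp ν γ k f x‖ₑ ^ (2 : ℝ) ≤
      (∫⁻ t, ‖k t‖ₑ ∂ν) ^ (2 : ℝ) * ∫⁻ x, ‖f x‖ₑ ^ (2 : ℝ) := by
  have hkm : AEMeasurable (fun t => ‖k t‖ₑ) ν := hk.aestronglyMeasurable.enorm
  have pt : ∀ x, ‖translOp ν γ k f x‖ₑ ^ (2 : ℝ) ≤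
      (∫⁻ t, ‖k t‖ₑ ∂ν) * ∫⁻ t, ‖f (x - γ t)‖ₑ ^ (2 : ℝ) * ‖k t‖ₑ ∂ν := by
    intro x
    have hfx : Measurable fun t => ‖f (x - γ t)‖ₑ :=
      (hf.comp (measurable_const.sub hγ)).enorm
    have h1 := ENNReal.lintegral_mul_le_Lp_mul_Lq ν Real.HolderConjugate.two_two
      (f := fun t => ‖k t‖ₑ ^ (1 / 2 : ℝ)) (g := fun t => ‖f (x - γ t)‖ₑ * ‖k t‖ₑ ^ (1 / 2 : ℝ))
      (by fun_prop) (by fun_prop)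
    have hsq : ∀ a : ℝ≥0∞, (a ^ (1 / 2 : ℝ)) ^ (2 : ℝ) = a := fun a => by
      rw [← ENNReal.rpow_mul]; norm_num
    have h2 : ‖translOp ν γ k f x‖ₑ ≤
        (∫⁻ t, ‖k t‖ₑ ∂ν) ^ (1 / 2 : ℝ) *
          (∫⁻ t, ‖f (x - γ t)‖ₑ ^ (2 : ℝ) * ‖k t‖ₑ ∂ν) ^ (1 / 2 : ℝ) := by
      refine (enorm_integral_le_lintegral_enorm _).trans ?_
      have e1 : ∀ t, ‖f (x - γ t) * k t‖ₑ = ((fun t => ‖k t‖ₑ ^ (1 / 2 : ℝ)) *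
          fun t => ‖f (x - γ t)‖ₑ * ‖k t‖ₑ ^ (1 / 2 : ℝ)) t := fun t => by
        rw [Pi.mul_apply, enorm_mul, mul_left_comm,
          ← ENNReal.rpow_add_of_nonneg _ _ (by norm_num) (by norm_num)]
        norm_num
      have e2 : ∀ t, (‖f (x - γ t)‖ₑ * ‖k t‖ₑ ^ (1 / 2 : ℝ)) ^ (2 : ℝ) =
          ‖f (x - γ t)‖ₑ ^ (2 : ℝ) * ‖k t‖ₑ := fun t => by
        rw [ENNReal.mul_rpow_of_nonneg _ _ (by norm_num : (0 : ℝ) ≤ 2), hsq]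
      simp_rw [hsq, e2] at h1
      simp_rw [e1]
      exact h1
    calc _ ≤ ((∫⁻ t, ‖k t‖ₑ ∂ν) ^ (1 / 2 : ℝ) *
          (∫⁻ t, ‖f (x - γ t)‖ₑ ^ (2 : ℝ) * ‖k t‖ₑ ∂ν) ^ (1 / 2 : ℝ)) ^ (2 : ℝ) := by gcongr
      _ = _ := by rw [ENNReal.mul_rpow_of_nonneg _ _ (by norm_num : (0 : ℝ) ≤ 2), hsq, hsq]
  calc _ ≤ ∫⁻ x, (∫⁻ t, ‖k t‖ₑ ∂ν) * ∫⁻ t, ‖f (x - γ t)‖ₑ ^ (2 : ℝ) * ‖k t‖ₑ ∂ν :=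
        lintegral_mono pt
    _ = _ := by
        have hkfin : ∫⁻ t, ‖k t‖ₑ ∂ν ≠ ∞ := hk.hasFiniteIntegral.ne
        rw [lintegral_const_mul' _ _ hkfin,
          lintegral_lintegral_translate hγ (u := fun y => ‖f y‖ₑ ^ (2 : ℝ)) (by fun_prop) hkm,
          ENNReal.rpow_two, sq, mul_assoc]

lemma isTestFunction_schwartz (f : 𝓢(V, ℂ)) : IsTestFunction volume f where
  measurable := f.continuous.measurable
  integrable := f.integrable
  bounded := ⟨‖f.toBoundedContinuousFunction‖, fun y =>
    f.toBoundedContinuousFunction.norm_coe_le_norm y⟩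

lemma schwartz_eq_integral_osc (f : 𝓢(V, ℂ)) (y : V) :
    f y = ∫ ζ, osc (-inner ℝ ζ y) * (𝓕 f : 𝓢(V, ℂ)) ζ := by
  have h : 𝓕⁻ (𝓕 f : 𝓢(V, ℂ)) = f := FourierTransform.fourierInv_fourier_eq f
  have h2 : f y = 𝓕⁻ (⇑(𝓕 f : 𝓢(V, ℂ))) y := by
    rw [← SchwartzMap.fourierInv_coe, h]
  rw [h2, Real.fourierInv_eq']
  congr 1; ext ζ
  rw [smul_eq_mul, osc]
  congr 2
  push_cast; ring

lemma schwartz_fourierInv_eq_integral_osc (f : 𝓢(V, ℂ)) (y : V) :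
    (𝓕⁻ f) y = ∫ ζ, osc (-inner ℝ ζ y) * f ζ := by
  rw [SchwartzMap.fourierInv_coe, Real.fourierInv_eq']
  congr 1; ext ζ
  rw [smul_eq_mul, osc]
  congr 2
  push_cast; ring

/-- Parseval's identity for a bilinear pairing: expand `f` by Fourier inversion and exchange the
integrals. Since `g` is not conjugated, its inverse transform appears. -/
lemma integral_translate_mul_schwartz (f g : 𝓢(V, ℂ)) (y : V) :
    ∫ x, f (x - y) * g x = ∫ ζ, osc (inner ℝ y ζ) * ((𝓕 f) ζ * (𝓕⁻ g) ζ) := by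
  have e1 : ∀ x, f (x - y) * g x =
      ∫ ζ, osc (inner ℝ y ζ) * (𝓕 f) ζ * (osc (-inner ℝ x ζ) * g x) := by
    intro x
    rw [schwartz_eq_integral_osc, ← integral_mul_const]
    congr 1; ext ζ
    rw [show -inner ℝ ζ (x - y) = inner ℝ y ζ + -inner ℝ x ζ by
      rw [inner_sub_right, real_inner_comm, real_inner_comm y ζ]; ring, osc_add]
    ring
  simp_rw [e1]
  rw [integral_integral_swap]
  · congr 1; ext ζ
    rw [integral_const_mul, schwartz_fourierInv_eq_integral_osc, mul_assoc]
  · have h : Integrable (fun z : V × V => g z.1 * (𝓕 f) z.2) (volume.prod volume) :=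
      g.integrable.mul_prod (𝓕 f).integrable
    have hc : Continuous fun z : V × V => osc (inner ℝ y z.2) * osc (-inner ℝ z.1 z.2) :=
      (continuous_osc.comp (by fun_prop)).mul (continuous_osc.comp (by fun_prop))
    have := h.bdd_mul (c := 1) hc.aestronglyMeasurable
      (ae_of_all _ fun z => by simp [norm_osc])
    refine this.congr (ae_of_all _ fun z => ?_)
    simp only [Function.uncurry]
    ring

/-- Integrating Parseval's identity for `y = γ t` against `k` collects the phases into the
multiplier of the operator. -/
lemma integral_translOp_mul_schwartz [SFinite ν] (hγ : Measurable γ) (hk : Integrable k ν)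
    (f g : 𝓢(V, ℂ)) :
    ∫ x, translOp ν γ k f x * g x =
      ∫ ζ, (∫ t, osc (inner ℝ (γ t) ζ) * k t ∂ν) * ((𝓕 f) ζ * (𝓕⁻ g) ζ) := by
  obtain ⟨M, hM⟩ := (isTestFunction_schwartz f).bounded
  have hfm : Measurable f := f.continuous.measurable
  calc _ = ∫ x, ∫ t, f (x - γ t) * (g x * k t) ∂ν := by
        congr 1; ext x
        rw [translOp, ← integral_mul_const]
        congr 1; ext t; ring
    _ = ∫ t, (∫ x, f (x - γ t) * (g x * k t)) ∂ν := by
        apply integral_integral_swap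
        exact (g.integrable.mul_prod hk).bdd_mul (c := M)
          (measurable_comp_sub hγ hfm).aestronglyMeasurable (ae_of_all _ fun z => hM _)
    _ = ∫ t, (∫ ζ, osc (inner ℝ (γ t) ζ) * (((𝓕 f) ζ * (𝓕⁻ g) ζ) * k t)) ∂ν := by
        congr 1; ext t
        simp_rw [← mul_assoc _ _ (k t)]
        rw [integral_mul_const, integral_mul_const, integral_translate_mul_schwartz]
    _ = ∫ ζ, ∫ t, osc (inner ℝ (γ t) ζ) * (((𝓕 f) ζ * (𝓕⁻ g) ζ) * k t) ∂ν := by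
        apply integral_integral_swap
        have hfg : Integrable (fun ζ => (𝓕 f) ζ * (𝓕⁻ g) ζ) volume := by
          obtain ⟨N, hN⟩ := (isTestFunction_schwartz (𝓕 f)).bounded
          exact (𝓕⁻ g).integrable.bdd_mul (𝓕 f).continuous.aestronglyMeasurable
            (ae_of_all _ hN)
        have h : Integrable (fun z : X × V => ((𝓕 f) z.2 * (𝓕⁻ g) z.2) * k z.1)
            (ν.prod volume) := by
          refine (hk.mul_prod hfg).congr (ae_of_all _ fun z => ?_)
          simp only
          ring
        refine h.bdd_mul (c := 1) (f := fun z : X × V => osc (inner ℝ (γ z.1) z.2)) ?_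
          (ae_of_all _ fun z => by simp [norm_osc])
        exact (continuous_osc.measurable.comp
          ((hγ.comp measurable_fst).inner measurable_snd)).aestronglyMeasurable
    _ = _ := by
        congr 1; ext ζ
        rw [← integral_mul_const]
        congr 1; ext t; ring

lemma norm_toLp_fourierInv (g : 𝓢(V, ℂ)) : ‖(𝓕⁻ g).toLp 2 volume‖ = ‖g.toLp 2 volume‖ := by
  rw [← SchwartzMap.norm_fourier_toL2_eq (𝓕⁻ g), FourierTransform.fourier_fourierInv_eq]

lemma integral_norm_mul_schwartz_le (f g : 𝓢(V, ℂ)) :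
    ∫ ζ, ‖f ζ‖ * ‖g ζ‖ ≤ ‖f.toLp 2 volume‖ * ‖g.toLp 2 volume‖ := by
  have h := integral_mul_le_Lp_mul_Lq_of_nonneg (μ := (volume : Measure V))
    Real.HolderConjugate.two_two
    (f := fun ζ => ‖f ζ‖) (g := fun ζ => ‖g ζ‖) (ae_of_all _ fun _ => norm_nonneg _)
    (ae_of_all _ fun _ => norm_nonneg _)
    (by simpa using (f.memLp 2 volume).norm) (by simpa using (g.memLp 2 volume).norm)
  refine h.trans_eq ?_
  have key : ∀ u : 𝓢(V, ℂ), (∫ ζ, ‖u ζ‖ ^ (2 : ℝ)) ^ (1 / (2 : ℝ)) = ‖u.toLp 2 volume‖ := by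
    intro u
    rw [SchwartzMap.norm_toLp, (u.memLp 2 volume).eLpNorm_eq_integral_rpow_norm (by norm_num)
      (by norm_num), ENNReal.toReal_ofReal (by positivity)]
    norm_num
  rw [key, key]

lemma memLp_two_translOp [SFinite ν] (hγ : Measurable γ) (hk : Integrable k ν)
    (hf : Measurable f) (hf2 : MemLp f 2 volume) : MemLp (translOp ν γ k f) 2 volume := by
  refine ⟨aestronglyMeasurable_translOp hγ hk hf, ?_⟩
  rw [eLpNorm_lt_top_iff_lintegral_rpow_enorm_lt_top (by norm_num) (by norm_num)]
  have h2 := hf2.2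
  rw [eLpNorm_lt_top_iff_lintegral_rpow_enorm_lt_top (by norm_num) (by norm_num)] at h2
  simp only [ENNReal.toReal_ofNat] at h2 ⊢
  refine (lintegral_enorm_sq_translOp_le hγ hk hf).trans_lt (ENNReal.mul_lt_top ?_ h2)
  exact ENNReal.rpow_lt_top_of_nonneg (by norm_num) hk.hasFiniteIntegral.ne

/-- A multiplier bound gives an `L²` bound on Schwartz functions. -/
lemma eLpNorm_translOp_schwartz_le [SFinite ν] (hγ : Measurable γ) (hk : Integrable k ν) {B : ℝ}
    (hB : ∀ ζ, ‖∫ t, osc (inner ℝ (γ t) ζ) * k t ∂ν‖ ≤ B) (f : 𝓢(V, ℂ)) :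
    eLpNorm (translOp ν γ k f) 2 volume ≤ ENNReal.ofReal B * eLpNorm f 2 volume := by
  have hB0 : 0 ≤ B := (norm_nonneg _).trans (hB 0)
  have hmem := memLp_two_translOp hγ hk f.continuous.measurable (f.memLp 2 volume)
  -- The inner product conjugates its first argument, so the conjugate of the image is needed to
  -- recover the bilinear pairing.
  have hmem' : MemLp (fun x => starRingEnd ℂ (translOp ν γ k f x)) 2 volume :=
    (memLp_congr_norm (Complex.continuous_conj.comp_aestronglyMeasurable hmem.1) hmem.1
      (ae_of_all _ fun x => by simp)).mpr hmem
  set F : Lp ℂ 2 (volume : Measure V) := hmem'.toLp _ with hF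
  have hpair : ∀ g : 𝓢(V, ℂ), ‖inner ℂ F (g.toLp 2 volume)‖ ≤
      B * ‖f.toLp 2 volume‖ * ‖g.toLp 2 volume‖ := by
    intro g
    have e1 : inner ℂ F (g.toLp 2 volume) = ∫ x, translOp ν γ k f x * g x := by
      rw [L2.inner_def]
      apply integral_congr_ae
      filter_upwards [hmem'.coeFn_toLp, g.coeFn_toLp 2 volume] with x h1 h2
      rw [hF, h1, h2]
      simp [mul_comm]
    rw [e1, integral_translOp_mul_schwartz hγ hk]
    obtain ⟨N, hN⟩ := (isTestFunction_schwartz (𝓕 f)).bounded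
    have hint : Integrable (fun ζ => ‖(𝓕 f) ζ‖ * ‖(𝓕⁻ g) ζ‖) volume :=
      (𝓕⁻ g).integrable.norm.bdd_mul (c := N) (𝓕 f).continuous.norm.aestronglyMeasurable
        (ae_of_all _ fun ζ => by simpa using hN ζ)
    calc _ ≤ ∫ ζ, B * (‖(𝓕 f) ζ‖ * ‖(𝓕⁻ g) ζ‖) := by
          refine norm_integral_le_of_norm_le (hint.const_mul B) (ae_of_all _ fun ζ => ?_)
          rw [norm_mul, norm_mul]
          exact mul_le_mul_of_nonneg_right (hB ζ) (by positivity)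
      _ = B * ∫ ζ, ‖(𝓕 f) ζ‖ * ‖(𝓕⁻ g) ζ‖ := integral_const_mul _ _
      _ ≤ B * (‖(𝓕 f).toLp 2 volume‖ * ‖(𝓕⁻ g).toLp 2 volume‖) := by
          gcongr
          exact integral_norm_mul_schwartz_le _ _
      _ = _ := by rw [SchwartzMap.norm_fourier_toL2_eq, norm_toLp_fourierInv, mul_assoc]
  have hall : ∀ G : Lp ℂ 2 (volume : Measure V),
      ‖inner ℂ F G‖ ≤ B * ‖f.toLp 2 volume‖ * ‖G‖ := by
    have hd := SchwartzMap.denseRange_toLpCLM (E := V) (F := ℂ) (p := 2) (μ := volume) (by norm_num)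
    intro G
    refine hd.induction_on G ?_ ?_
    · exact isClosed_le (by fun_prop) (by fun_prop)
    · intro g
      exact hpair g
  -- Duality: testing against `F` itself gives `‖F‖² ≤ B ‖f‖ ‖F‖`.
  have hFF := hall F
  rw [inner_self_eq_norm_sq_to_K, norm_pow, RCLike.norm_ofReal, abs_norm] at hFF
  have hle : ‖F‖ ≤ B * ‖f.toLp 2 volume‖ := by
    rcases (norm_nonneg F).eq_or_lt with h0 | h0
    · rw [← h0]; positivity
    · rw [sq] at hFF; exact le_of_mul_le_mul_right hFF h0
  have e2 : eLpNorm (translOp ν γ k f) 2 volume = ENNReal.ofReal ‖F‖ := by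
    rw [hF, Lp.norm_toLp, ENNReal.ofReal_toReal hmem'.2.ne]
    exact eLpNorm_congr_norm_ae (ae_of_all _ fun x => by simp)
  rw [e2, ← ENNReal.ofReal_toReal (f.memLp 2 volume).2.ne, ← SchwartzMap.norm_toLp,
    ← ENNReal.ofReal_mul hB0]
  exact ENNReal.ofReal_le_ofReal hle

lemma IsTestFunction.memLp_two {f : V → ℂ} (hf : IsTestFunction volume f) :
    MemLp f 2 volume := by
  obtain ⟨M, hM⟩ := hf.bounded
  have h1 : MemLp f 1 volume := memLp_one_iff_integrable.mpr hf.integrable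
  have h2 : MemLp f ∞ volume := memLp_top_of_bound hf.measurable.aestronglyMeasurable M
    (ae_of_all _ hM)
  refine ⟨hf.measurable.aestronglyMeasurable, ?_⟩
  rw [eLpNorm_lt_top_iff_lintegral_rpow_enorm_lt_top (by norm_num) (by norm_num)]
  have h3 : ∫⁻ x, ‖f x‖ₑ ^ (2 : ℝ≥0∞).toReal ≤ ∫⁻ x, ENNReal.ofReal M * ‖f x‖ₑ := by
    refine lintegral_mono fun x => ?_
    simp only [ENNReal.toReal_ofNat, ENNReal.rpow_two, sq]
    gcongr
    rw [← ofReal_norm]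
    exact ENNReal.ofReal_le_ofReal (hM x)
  refine h3.trans_lt ?_
  rw [lintegral_const_mul' _ _ ENNReal.ofReal_ne_top]
  exact ENNReal.mul_lt_top ENNReal.ofReal_lt_top hf.integrable.hasFiniteIntegral

lemma IsTestFunction.sub {f g : V → ℂ} (hf : IsTestFunction volume f)
    (hg : IsTestFunction volume g) : IsTestFunction volume (f - g) where
  measurable := hf.measurable.sub hg.measurable
  integrable := hf.integrable.sub hg.integrable
  bounded := by
    obtain ⟨M, hM⟩ := hf.bounded
    obtain ⟨N, hN⟩ := hg.bounded
    exact ⟨M + N, fun y => (norm_sub_le _ _).trans (add_le_add (hM y) (hN y))⟩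

lemma eLpNorm_two_eq (f : V → ℂ) :
    eLpNorm f 2 volume = (∫⁻ x, ‖f x‖ₑ ^ (2 : ℝ)) ^ (1 / 2 : ℝ) := by
  rw [eLpNorm_eq_lintegral_rpow_enorm_toReal (by norm_num) (by norm_num)]
  norm_num

/-- Approximate `f` in `L²` by a Schwartz function within `ε`. The remainder is controlled by the
crude bound with the `L¹` norm of `k`, which disappears as `ε → 0` and leaves the constant `B`. -/
lemma eLpNorm_translOp_le [SFinite ν] (hγ : Measurable γ) (hk : Integrable k ν) {B : ℝ}
    (hB : ∀ ζ, ‖∫ t, osc (inner ℝ (γ t) ζ) * k t ∂ν‖ ≤ B) (hf : IsTestFunction volume f) :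
    eLpNorm (translOp ν γ k f) 2 volume ≤ ENNReal.ofReal B * eLpNorm f 2 volume := by
  set A := ∫⁻ t, ‖k t‖ₑ ∂ν with hAdef
  have hA : A ≠ ∞ := hk.hasFiniteIntegral.ne
  have hcrude : ∀ h : V → ℂ, Measurable h →
      eLpNorm (translOp ν γ k h) 2 volume ≤ A * eLpNorm h 2 volume := by
    intro h hh
    rw [eLpNorm_two_eq, eLpNorm_two_eq]
    calc _ ≤ (A ^ (2 : ℝ) * ∫⁻ x, ‖h x‖ₑ ^ (2 : ℝ)) ^ (1 / 2 : ℝ) := by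
          gcongr
          exact lintegral_enorm_sq_translOp_le hγ hk hh
      _ = _ := by
          rw [ENNReal.mul_rpow_of_nonneg _ _ (by norm_num : (0 : ℝ) ≤ 1 / 2), ← ENNReal.rpow_mul]
          norm_num
  have hmain : ∀ ε : ℝ, 0 < ε → eLpNorm (translOp ν γ k f) 2 volume ≤
      ENNReal.ofReal B * eLpNorm f 2 volume + (A + ENNReal.ofReal B) * ENNReal.ofReal ε := by
    intro ε hε
    have hd := SchwartzMap.denseRange_toLpCLM (E := V) (F := ℂ) (p := 2) (μ := volume) (by norm_num)
    obtain ⟨g, hg⟩ := hd.exists_dist_lt (hf.memLp_two.toLp f) hε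
    have hgt := isTestFunction_schwartz g
    have hfg := hf.sub hgt
    have hdist : eLpNorm (f - ⇑g) 2 volume ≤ ENNReal.ofReal ε := by
      have : dist (hf.memLp_two.toLp f) (g.toLp 2 volume) < ε := hg
      rw [dist_eq_norm, SchwartzMap.toLp, ← MemLp.toLp_sub, Lp.norm_toLp] at this
      rw [← ENNReal.ofReal_toReal hfg.memLp_two.2.ne]
      exact ENNReal.ofReal_le_ofReal this.le
    have hsplit : translOp ν γ k f = translOp ν γ k (f - ⇑g) + translOp ν γ k g := by
      rw [← translOp_add hγ hk hfg hgt, sub_add_cancel]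
    have hgf : eLpNorm g 2 volume ≤ eLpNorm f 2 volume + ENNReal.ofReal ε := by
      have e : ⇑g = f - (f - ⇑g) := by simp
      rw [e]
      refine (eLpNorm_sub_le hf.measurable.aestronglyMeasurable
        hfg.measurable.aestronglyMeasurable (by norm_num)).trans ?_
      gcongr
    rw [hsplit]
    calc _ ≤ eLpNorm (translOp ν γ k (f - ⇑g)) 2 volume + eLpNorm (translOp ν γ k g) 2 volume :=
          eLpNorm_add_le (aestronglyMeasurable_translOp hγ hk hfg.measurable)
            (aestronglyMeasurable_translOp hγ hk hgt.measurable) (by norm_num)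
      _ ≤ A * ENNReal.ofReal ε + ENNReal.ofReal B * (eLpNorm f 2 volume + ENNReal.ofReal ε) := by
          gcongr
          · exact (hcrude _ hfg.measurable).trans (by gcongr)
          · exact (eLpNorm_translOp_schwartz_le hγ hk hB g).trans (by gcongr)
      _ = _ := by ring
  have hlim : Tendsto (fun ε : ℝ => ENNReal.ofReal B * eLpNorm f 2 volume +
      (A + ENNReal.ofReal B) * ENNReal.ofReal ε) (𝓝[>] 0)
      (𝓝 (ENNReal.ofReal B * eLpNorm f 2 volume + (A + ENNReal.ofReal B) * ENNReal.ofReal 0)) := by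
    refine tendsto_const_nhds.add (ENNReal.Tendsto.const_mul ?_ (Or.inr (by finiteness)))
    exact (ENNReal.continuous_ofReal.tendsto 0).mono_left nhdsWithin_le_nhds
  have := ge_of_tendsto hlim (eventually_mem_nhdsWithin.mono fun ε hε => hmain ε hε)
  simpa using this

/-- `L¹` norm bound on the kernel and `L^∞` bound on the multiplier make the operator ready for
interpolation. -/
theorem isInterpolable_translOp [SFinite ν] (hγ : Measurable γ) (hk : Integrable k ν) {A B : ℝ}
    (hA : ∫ t, ‖k t‖ ∂ν ≤ A) (hB : ∀ ζ, ‖∫ t, osc (inner ℝ (γ t) ζ) * k t ∂ν‖ ≤ B) :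
    IsInterpolable volume (translOp ν γ k) A B where
  map_add _ _ hf hg := translOp_add hγ hk hf hg
  aestronglyMeasurable _ hf := aestronglyMeasurable_translOp hγ hk hf.measurable
  bound_one f hf := by
    simp only [Real.rpow_one, ofReal_norm]
    refine (lintegral_enorm_translOp_le hγ hk hf.measurable).trans ?_
    gcongr
    exact lintegral_enorm_le_ofReal hk hA
  bound_two f hf := by
    have hB0 : 0 ≤ B := (norm_nonneg _).trans (hB 0)
    have e : ∀ u : V → ℂ, ∀ x, ENNReal.ofReal (‖u x‖ ^ (2 : ℝ)) = ‖u x‖ₑ ^ (2 : ℝ) := fun u x => by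
      rw [← ENNReal.ofReal_rpow_of_nonneg (norm_nonneg _) (by norm_num), ofReal_norm]
    simp_rw [e]
    have h := eLpNorm_translOp_le hγ hk hB hf
    rw [eLpNorm_two_eq, eLpNorm_two_eq] at h
    have h2 := ENNReal.rpow_le_rpow h (by norm_num : (0 : ℝ) ≤ 2)
    rw [ENNReal.mul_rpow_of_nonneg _ _ (by norm_num : (0 : ℝ) ≤ 2), ← ENNReal.rpow_mul,
      ← ENNReal.rpow_mul] at h2
    norm_num at h2
    rw [ENNReal.ofReal_pow hB0]
    simpa using h2
  bound_top f hf M hM x := norm_translOp_le hk hA hM x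

end Translates

/-! ### Polar coordinates -/

section Polar

variable {n : ℕ}

/-- Surface measure on the unit sphere of `ℝⁿ`. -/
abbrev sphereMeasure (n : ℕ) : Measure (Metric.sphere (0 : EuclideanSpace ℝ (Fin n)) 1) :=
  (volume : Measure (EuclideanSpace ℝ (Fin n))).toSphere

/-- The measure `r^{n-1} dr` on `(0, ∞)`. -/
def radialMeasure (n : ℕ) : Measure ℝ :=
  (volume.restrict (Set.Ioi 0)).withDensity fun r => ENNReal.ofReal (r ^ (n - 1))

instance (n : ℕ) : SFinite (radialMeasure n) := by
  unfold radialMeasure; infer_instance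

lemma measurePreserving_val_volumeIoiPow (n : ℕ) :
    MeasurePreserving (Subtype.val : Set.Ioi (0 : ℝ) → ℝ) (Measure.volumeIoiPow (n - 1))
      (radialMeasure n) := by
  refine ⟨measurable_subtype_coe, ?_⟩
  ext s hs
  rw [Measure.map_apply measurable_subtype_coe hs, Measure.volumeIoiPow, radialMeasure,
    withDensity_apply _ (measurable_subtype_coe hs), withDensity_apply _ hs,
    setLIntegral_subtype measurableSet_Ioi _ fun a : ℝ => ENNReal.ofReal (a ^ (n - 1)),
    Subtype.image_preimage_coe, Measure.restrict_restrict hs, Set.inter_comm]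

lemma measurable_polar : Measurable
    fun z : Metric.sphere (0 : EuclideanSpace ℝ (Fin n)) 1 × ℝ =>
      z.2 • (z.1 : EuclideanSpace ℝ (Fin n)) :=
  (by fun_prop : Continuous _).measurable

/-- `homeomorphUnitSphereProd` gives polar coordinates between subtypes. Composing with the
coercions removes these, the origin being a null set. -/
lemma measurePreserving_polar (hn : 0 < n) :
    MeasurePreserving (fun z : Metric.sphere (0 : EuclideanSpace ℝ (Fin n)) 1 × ℝ =>
      z.2 • (z.1 : EuclideanSpace ℝ (Fin n))) ((sphereMeasure n).prod (radialMeasure n)) volume := by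
  have : Nonempty (Fin n) := ⟨⟨0, hn⟩⟩
  have h1 := (volume : Measure (EuclideanSpace ℝ (Fin n))).measurePreserving_homeomorphUnitSphereProd
  rw [finrank_euclideanSpace_fin] at h1
  have h2 : MeasurePreserving (homeomorphUnitSphereProd (EuclideanSpace ℝ (Fin n))).symm
      ((sphereMeasure n).prod (Measure.volumeIoiPow (n - 1)))
      ((volume : Measure (EuclideanSpace ℝ (Fin n))).comap Subtype.val) :=
    MeasurePreserving.symm (homeomorphUnitSphereProd (EuclideanSpace ℝ (Fin n))).toMeasurableEquiv h1
  have h3 := (measurePreserving_subtype_coe (μa := (volume : Measure (EuclideanSpace ℝ (Fin n))))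
    (measurableSet_singleton 0).compl).comp h2
  rw [restrict_compl_singleton] at h3
  have h4 := (MeasurePreserving.id (sphereMeasure n)).prod (measurePreserving_val_volumeIoiPow n)
  refine ⟨measurable_polar, ?_⟩
  rw [← h4.map_eq, Measure.map_map measurable_polar h4.measurable, ← h3.map_eq]
  congr 1

lemma lintegral_polar (hn : 0 < n) {g : EuclideanSpace ℝ (Fin n) → ℝ≥0∞} (hg : Measurable g) :
    ∫⁻ t, g t = ∫⁻ θ, (∫⁻ r in Set.Ioi (0 : ℝ), ENNReal.ofReal (r ^ (n - 1)) *
      g (r • (θ : EuclideanSpace ℝ (Fin n)))) ∂(sphereMeasure n) := by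
  rw [← (measurePreserving_polar hn).lintegral_comp hg, lintegral_prod]
  · congr 1; ext θ
    have hm : Measurable fun r : ℝ => r • (θ : EuclideanSpace ℝ (Fin n)) :=
      (by fun_prop : Continuous _).measurable
    exact lintegral_withDensity_eq_lintegral_mul _
      (by fun_prop : Measurable fun r : ℝ => ENNReal.ofReal (r ^ (n - 1))) (hg.comp hm)
  · exact (hg.comp measurable_polar).aemeasurable

lemma integral_polar (hn : 0 < n) {F : EuclideanSpace ℝ (Fin n) → ℂ} (hF : Integrable F) :
    ∫ t, F t = ∫ θ, (∫ r in Set.Ioi (0 : ℝ), (r ^ (n - 1)) •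
      F (r • (θ : EuclideanSpace ℝ (Fin n)))) ∂(sphereMeasure n) := by
  have hmp := measurePreserving_polar hn
  have hint := (hmp.integrable_comp hF.aestronglyMeasurable).mpr hF
  have e1 : ∫ t, F t = ∫ z : Metric.sphere (0 : EuclideanSpace ℝ (Fin n)) 1 × ℝ,
      F (z.2 • (z.1 : EuclideanSpace ℝ (Fin n))) ∂((sphereMeasure n).prod (radialMeasure n)) := by
    rw [← hmp.map_eq, integral_map hmp.measurable.aemeasurable]
    rw [hmp.map_eq]; exact hF.aestronglyMeasurable
  rw [e1]
  refine (integral_prod _ hint).trans ?_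
  congr 1; ext θ
  rw [radialMeasure, integral_withDensity_eq_integral_toReal_smul (by fun_prop) (by simp)]
  refine setIntegral_congr_fun measurableSet_Ioi fun r hr => ?_
  rw [ENNReal.toReal_ofReal (pow_nonneg (le_of_lt hr) _)]
  rfl

/-- Allows a property that holds for almost every radius to be used at one actual radius. -/
lemma radialMeasure_ne_zero (n : ℕ) : radialMeasure n ≠ 0 := by
  intro h
  have h1 := congrArg (fun m : Measure ℝ => m (Set.Ioi 0)) h
  simp only [radialMeasure, Measure.coe_zero, Pi.zero_apply] at h1
  rw [withDensity_apply_eq_zero' (by fun_prop), Measure.restrict_apply'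
    measurableSet_Ioi] at h1
  have : ({x : ℝ | ENNReal.ofReal (x ^ (n - 1)) ≠ 0} ∩ Set.Ioi 0) ∩ Set.Ioi 0 = Set.Ioi 0 := by
    ext x
    simp only [Set.mem_inter_iff, Set.mem_ofPred_eq, Set.mem_Ioi, ne_eq, ENNReal.ofReal_eq_zero,
      not_le]
    exact ⟨fun h => h.2, fun h => ⟨⟨pow_pos h _, h⟩, h⟩⟩
  rw [this] at h1
  simp at h1

/-- A function on `ℝⁿ` that is constant along rays restricts measurably to the sphere. -/
lemma aestronglyMeasurable_sphere_of_homogeneous (hn : 0 < n) {Ω : EuclideanSpace ℝ (Fin n) → ℂ}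
    (hm : AEStronglyMeasurable Ω volume)
    (hhom : ∀ (r : ℝ) (t : EuclideanSpace ℝ (Fin n)), 0 < r → t ≠ 0 → Ω (r • t) = Ω t) :
    AEStronglyMeasurable (fun θ : Metric.sphere (0 : EuclideanSpace ℝ (Fin n)) 1 => Ω θ)
      (sphereMeasure n) := by
  have h1 := hm.comp_measurePreserving (measurePreserving_polar hn)
  -- By Fubini, the restriction to almost every sphere is measurable; by constancy along rays one
  -- good radius gives the unit sphere.
  have h2 := h1.prod_swap.prodMk_left
  have h3 : ∀ᵐ r ∂(radialMeasure n), r ∈ Set.Ioi (0 : ℝ) :=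
    (withDensity_absolutelyContinuous _ _).ae_le (ae_restrict_mem measurableSet_Ioi)
  have : (ae (radialMeasure n)).NeBot := ae_neBot.mpr (radialMeasure_ne_zero n)
  obtain ⟨r, hr, hr0⟩ := (h2.and h3).exists
  refine hr.congr (ae_of_all _ fun θ => ?_)
  simp only [Prod.swap, Function.comp]
  refine hhom r θ hr0 fun h => ?_
  have := norm_eq_of_mem_sphere θ
  rw [h] at this
  simp at this

/-! ### Energy of the sphere -/

/-- Extend `g` to be constant along rays; the factor `n` compensates `∫₀¹ r^{n-1} dr = 1/n`. This
transfers invariance and estimates from Lebesgue measure to surface measure. -/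
lemma lintegral_sphere_eq_ball (hn : 0 < n) {g : EuclideanSpace ℝ (Fin n) → ℝ≥0∞}
    (hg : Measurable g) :
    ∫⁻ θ, g (θ : EuclideanSpace ℝ (Fin n)) ∂(sphereMeasure n) =
      n * ∫⁻ t in Metric.ball (0 : EuclideanSpace ℝ (Fin n)) 1, g (‖t‖⁻¹ • t) := by
  have hm : Measurable fun t : EuclideanSpace ℝ (Fin n) => g (‖t‖⁻¹ • t) :=
    hg.comp (measurable_norm.inv.smul measurable_id)
  rw [← lintegral_indicator measurableSet_ball,
    lintegral_polar hn (hm.indicator measurableSet_ball)]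
  have hin : ∀ θ : Metric.sphere (0 : EuclideanSpace ℝ (Fin n)) 1,
      ∫⁻ r in Set.Ioi (0 : ℝ), ENNReal.ofReal (r ^ (n - 1)) *
        (Metric.ball (0 : EuclideanSpace ℝ (Fin n)) 1).indicator (fun t => g (‖t‖⁻¹ • t))
          (r • (θ : EuclideanSpace ℝ (Fin n))) =
      ENNReal.ofReal (1 / n) * g θ := by
    intro θ
    have hθ := norm_eq_of_mem_sphere θ
    have e1 : ∀ r ∈ Set.Ioi (0 : ℝ), ENNReal.ofReal (r ^ (n - 1)) *
        (Metric.ball (0 : EuclideanSpace ℝ (Fin n)) 1).indicator (fun t => g (‖t‖⁻¹ • t))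
          (r • (θ : EuclideanSpace ℝ (Fin n))) =
        (Set.Iio (1 : ℝ)).indicator (fun r => ENNReal.ofReal (r ^ (n - 1)) * g θ) r := by
      intro r hr
      have hr0 : 0 < r := hr
      have hnorm : ‖r • (θ : EuclideanSpace ℝ (Fin n))‖ = r := by
        rw [norm_smul, hθ, Real.norm_eq_abs, abs_of_pos hr0, mul_one]
      by_cases h : r < 1
      · rw [Set.indicator_of_mem (by rw [mem_ball_zero_iff, hnorm]; exact h),
          Set.indicator_of_mem (by exact h), hnorm, smul_smul, inv_mul_cancel₀ hr0.ne', one_smul]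
      · rw [Set.indicator_of_notMem (by rw [mem_ball_zero_iff, hnorm]; exact h),
          Set.indicator_of_notMem (by exact h), mul_zero]
    rw [setLIntegral_congr_fun measurableSet_Ioi e1, lintegral_indicator measurableSet_Iio,
      Measure.restrict_restrict measurableSet_Iio, Set.inter_comm, Set.Ioi_inter_Iio,
      lintegral_mul_const _ (by fun_prop), Measure.restrict_congr_set Ioo_ae_eq_Ioc,
      ← ofReal_integral_eq_lintegral_ofReal]
    · rw [← intervalIntegral.integral_of_le zero_le_one, integral_pow]
      congr 2
      have : n - 1 + 1 = n := Nat.sub_add_cancel hn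
      rw [this, one_pow, zero_pow hn.ne', sub_zero]
      congr 1
      exact_mod_cast this
    · exact (intervalIntegrable_iff_integrableOn_Ioc_of_le zero_le_one).mp
        (intervalIntegral.intervalIntegrable_pow _)
    · filter_upwards [ae_restrict_mem measurableSet_Ioc] with r hr
      exact pow_nonneg hr.1.le _
  simp_rw [hin]
  rw [lintegral_const_mul' _ _ ENNReal.ofReal_ne_top, ← mul_assoc]
  have : (n : ℝ≥0∞) * ENNReal.ofReal (1 / n) = 1 := by
    rw [← ENNReal.ofReal_natCast, ← ENNReal.ofReal_mul (by positivity)]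
    rw [mul_one_div_cancel (by positivity)]; simp
  rw [this, one_mul]

lemma lintegral_sphere_comp_isometry (hn : 0 < n) {g : EuclideanSpace ℝ (Fin n) → ℝ≥0∞}
    (hg : Measurable g) (U : EuclideanSpace ℝ (Fin n) ≃ₗᵢ[ℝ] EuclideanSpace ℝ (Fin n)) :
    ∫⁻ θ, g (U (θ : EuclideanSpace ℝ (Fin n))) ∂(sphereMeasure n) =
      ∫⁻ θ, g (θ : EuclideanSpace ℝ (Fin n)) ∂(sphereMeasure n) := by
  have hU : Measurable U := U.continuous.measurable
  have hm : Measurable fun t : EuclideanSpace ℝ (Fin n) => g (‖t‖⁻¹ • t) :=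
    hg.comp (measurable_norm.inv.smul measurable_id)
  have hgU : Measurable fun t => g (U t) := hg.comp hU
  rw [lintegral_sphere_eq_ball hn hg, lintegral_sphere_eq_ball hn hgU,
    ← lintegral_indicator measurableSet_ball, ← lintegral_indicator measurableSet_ball,
    ← (U.measurePreserving).lintegral_comp (hm.indicator measurableSet_ball)]
  congr 2; ext t
  by_cases h : ‖t‖ < 1
  · rw [Set.indicator_of_mem (by simpa using h), Set.indicator_of_mem (by simpa using h)]
    simp
  · rw [Set.indicator_of_notMem (by simpa using h), Set.indicator_of_notMem (by simpa using h)]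

/-- The kernel `|x|^{-κ}`, infinite at the origin. -/
def rieszKer (κ x : ℝ) : ℝ≥0∞ := (ENNReal.ofReal |x| ^ κ)⁻¹

lemma measurable_rieszKer (κ : ℝ) : Measurable (rieszKer κ) := by
  unfold rieszKer; fun_prop

lemma rieszKer_anti {κ x y : ℝ} (hκ : 0 ≤ κ) (h : |x| ≤ |y|) : rieszKer κ y ≤ rieszKer κ x := by
  unfold rieszKer; gcongr

lemma rieszKer_mul {κ x y : ℝ} (hκ : 0 ≤ κ) (hy : y ≠ 0) :
    rieszKer κ (x * y) = rieszKer κ x * rieszKer κ y := by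
  unfold rieszKer
  rw [abs_mul, ENNReal.ofReal_mul (abs_nonneg _), ENNReal.mul_rpow_of_nonneg _ _ hκ,
    ENNReal.mul_inv (Or.inr (by finiteness))]
  refine Or.inr ?_
  have : ENNReal.ofReal |y| ≠ 0 := by simpa using hy
  exact (ENNReal.rpow_pos (pos_iff_ne_zero.mpr this) (by finiteness)).ne'

lemma rieszKer_eq_ofReal {κ x : ℝ} (hx : x ≠ 0) :
    rieszKer κ x = ENNReal.ofReal (|x| ^ (-κ)) := by
  have hx' : 0 < |x| := abs_pos.mpr hx
  rw [rieszKer, ← ENNReal.rpow_neg, ENNReal.ofReal_rpow_of_pos hx']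

lemma lintegral_Icc_rieszKer_lt_top {κ : ℝ} (hκ1 : κ < 1) :
    ∫⁻ x in Set.Icc (-1 : ℝ) 1, rieszKer κ x < ∞ := by
  have h := (intervalIntegral.intervalIntegrable_cpow' (a := -1) (b := 1) (r := ((-κ : ℝ) : ℂ))
    (by simpa using hκ1))
  rw [intervalIntegrable_iff_integrableOn_Icc_of_le (by norm_num)] at h
  refine lt_of_le_of_lt (le_of_eq ?_) h.hasFiniteIntegral
  apply lintegral_congr_ae
  have h0 : ∀ᵐ x : ℝ ∂(volume.restrict (Set.Icc (-1) 1)), x ≠ 0 := by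
    refine ae_restrict_of_ae ?_
    simp [ae_iff]
  filter_upwards [h0] with x hx
  rw [rieszKer_eq_ofReal hx, ← ofReal_norm, Complex.norm_cpow_real, Complex.norm_real,
    Real.norm_eq_abs]

/-- Take the reflection in the hyperplane orthogonal to `e - e'`. -/
lemma exists_isometry_map {e e' : EuclideanSpace ℝ (Fin n)} (h : ‖e‖ = ‖e'‖) :
    ∃ U : EuclideanSpace ℝ (Fin n) ≃ₗᵢ[ℝ] EuclideanSpace ℝ (Fin n), U e = e' :=
  ⟨(Submodule.span ℝ {e - e'})ᗮ.reflection, Submodule.reflection_sub h⟩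

lemma measurable_rieszKer_inner (κ : ℝ) (e : EuclideanSpace ℝ (Fin n)) :
    Measurable fun t : EuclideanSpace ℝ (Fin n) => rieszKer κ (inner ℝ e t) :=
  (measurable_rieszKer κ).comp (by fun_prop)

/-- By rotation invariance `e` may be a coordinate vector. On the unit ball, replacing `t/|t|` by
`t` shrinks the coordinate and enlarges the kernel; enclosing the ball in a cube then leaves the
integral of `|x|^{-κ}` over `[-1, 1]`, finite for `κ < 1`. -/
lemma exists_lintegral_sphere_rieszKer_le (hn : 0 < n) {κ : ℝ} (hκ0 : 0 < κ) (hκ1 : κ < 1) :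
    ∃ C : ℝ≥0∞, C ≠ ∞ ∧ C ≠ 0 ∧ ∀ e : EuclideanSpace ℝ (Fin n), ‖e‖ = 1 →
      ∫⁻ θ, rieszKer κ (inner ℝ e (θ : EuclideanSpace ℝ (Fin n))) ∂(sphereMeasure n) ≤ C := by
  set i₀ : Fin n := ⟨0, hn⟩
  set e₀ : EuclideanSpace ℝ (Fin n) := EuclideanSpace.single i₀ 1 with he₀
  have hinner : ∀ t : EuclideanSpace ℝ (Fin n), inner ℝ e₀ t = t i₀ := fun t => by
    simp [he₀, EuclideanSpace.inner_single_left]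
  have hfin : ∫⁻ t in Metric.ball (0 : EuclideanSpace ℝ (Fin n)) 1, rieszKer κ (t i₀) < ∞ := by
    have hsub : ∫⁻ t in Metric.ball (0 : EuclideanSpace ℝ (Fin n)) 1, rieszKer κ (t i₀) ≤
        ∫⁻ u in Set.univ.pi (fun _ : Fin n => Set.Icc (-1 : ℝ) 1), rieszKer κ (u i₀) := by
      have hmp := PiLp.volume_preserving_ofLp (Fin n)
      have hms : MeasurableSet (Set.univ.pi (fun _ : Fin n => Set.Icc (-1 : ℝ) 1)) :=
        MeasurableSet.univ_pi fun _ => measurableSet_Icc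
      have hmu : Measurable fun u : Fin n → ℝ => rieszKer κ (u i₀) :=
        (measurable_rieszKer κ).comp (measurable_pi_apply i₀)
      rw [← lintegral_indicator measurableSet_ball, ← lintegral_indicator hms,
        ← hmp.lintegral_comp (hmu.indicator hms)]
      refine lintegral_mono fun t => ?_
      by_cases h : t ∈ Metric.ball (0 : EuclideanSpace ℝ (Fin n)) 1
      · rw [Set.indicator_of_mem h, Set.indicator_of_mem]
        · intro i _
          have : ‖t i‖ ≤ ‖t‖ := PiLp.norm_apply_le t i
          rw [mem_ball_zero_iff] at h
          exact abs_le.mp (this.trans h.le)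
      · rw [Set.indicator_of_notMem h]; exact zero_le
    refine hsub.trans_lt ?_
    rw [volume_pi, Measure.restrict_pi_pi]
    have h2 := Measure.pi_map_eval
      (fun _ : Fin n => (volume : Measure ℝ).restrict (Set.Icc (-1) 1)) i₀
    have h3 := lintegral_map (μ := Measure.pi fun _ : Fin n =>
      (volume : Measure ℝ).restrict (Set.Icc (-1) 1)) (f := rieszKer κ)
      (g := fun u : Fin n → ℝ => u i₀) (measurable_rieszKer κ) (measurable_pi_apply i₀)
    rw [← h3]
    refine lt_of_eq_of_lt (congrArg (fun m : Measure ℝ => ∫⁻ x, rieszKer κ x ∂m) h2) ?_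
    rw [lintegral_smul_measure]
    refine ENNReal.mul_lt_top ?_ (lintegral_Icc_rieszKer_lt_top hκ1)
    refine ENNReal.prod_lt_top fun j _ => ?_
    simp
  have hbase : ∫⁻ θ, rieszKer κ (inner ℝ e₀ (θ : EuclideanSpace ℝ (Fin n))) ∂(sphereMeasure n) ≤
      n * ∫⁻ t in Metric.ball (0 : EuclideanSpace ℝ (Fin n)) 1, rieszKer κ (t i₀) := by
    rw [lintegral_sphere_eq_ball hn (measurable_rieszKer_inner κ e₀)]
    gcongr _ * ?_
    refine setLIntegral_mono' measurableSet_ball fun t ht => ?_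
    rw [inner_smul_right, hinner]
    refine rieszKer_anti hκ0.le ?_
    rw [abs_mul, abs_of_nonneg (by positivity : (0 : ℝ) ≤ ‖t‖⁻¹)]
    rw [mem_ball_zero_iff] at ht
    rcases (norm_nonneg t).eq_or_lt with h0 | h0
    · have : t = 0 := norm_eq_zero.mp h0.symm
      simp [this]
    · exact le_mul_of_one_le_left (abs_nonneg _) ((one_le_inv₀ h0).mpr ht.le)
  -- The added `1` makes the constant nonzero, so that `C * ∞ = ∞` when the kernel is evaluated at
  -- the origin.
  refine ⟨n * (∫⁻ t in Metric.ball (0 : EuclideanSpace ℝ (Fin n)) 1, rieszKer κ (t i₀)) + 1,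
    by finiteness, by simp, fun e he => ?_⟩
  obtain ⟨U, hU⟩ := exists_isometry_map (e := e) (e' := e₀) (by rw [he, he₀]; simp)
  have : ∀ θ : Metric.sphere (0 : EuclideanSpace ℝ (Fin n)) 1,
      rieszKer κ (inner ℝ e (θ : EuclideanSpace ℝ (Fin n))) =
        rieszKer κ (inner ℝ e₀ (U (θ : EuclideanSpace ℝ (Fin n)))) := fun θ => by
    rw [← hU, U.inner_map_map]
  simp_rw [this]
  rw [lintegral_sphere_comp_isometry hn (measurable_rieszKer_inner κ e₀) U]
  exact hbase.trans le_self_add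

lemma exists_unit_orthogonal (hn : 2 ≤ n) (e : EuclideanSpace ℝ (Fin n)) :
    ∃ e' : EuclideanSpace ℝ (Fin n), ‖e'‖ = 1 ∧ inner ℝ e' e = 0 := by
  have hne : (Submodule.span ℝ {e})ᗮ ≠ ⊥ := by
    intro h
    rw [Submodule.orthogonal_eq_bot_iff] at h
    have h1 := finrank_span_le_card (R := ℝ) ({e} : Set (EuclideanSpace ℝ (Fin n)))
    rw [h, finrank_top, finrank_euclideanSpace_fin] at h1
    simp at h1
    omega
  obtain ⟨v, hv, hv0⟩ := Submodule.exists_mem_ne_zero_of_ne_bot hne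
  refine ⟨‖v‖⁻¹ • v, norm_smul_inv_norm hv0, ?_⟩
  rw [inner_smul_left, real_inner_comm, Submodule.mem_orthogonal_singleton_iff_inner_right.mp hv,
    mul_zero]

/-- The one-dimensional projections of the sphere have finite `κ`-energy for every `κ < 1`. -/
theorem exists_sphere_energy_le (hn : 2 ≤ n) {κ : ℝ} (hκ0 : 0 < κ) (hκ1 : κ < 1) :
    ∃ C : ℝ≥0∞, C ≠ ∞ ∧ ∀ e : EuclideanSpace ℝ (Fin n), ‖e‖ = 1 →
      ∫⁻ θ, (∫⁻ θ', rieszKer κ (inner ℝ e ((θ : EuclideanSpace ℝ (Fin n)) - θ'))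
        ∂(sphereMeasure n)) ∂(sphereMeasure n) ≤ C := by
  have hn0 : 0 < n := by omega
  have : Nonempty (Fin n) := ⟨⟨0, hn0⟩⟩
  obtain ⟨C, hC, hC0, hbound⟩ := exists_lintegral_sphere_rieszKer_le hn0 hκ0 hκ1
  refine ⟨C * C, by finiteness, fun e he => ?_⟩
  set J : EuclideanSpace ℝ (Fin n) → ℝ≥0∞ := fun e =>
    ∫⁻ θ, (∫⁻ θ', rieszKer κ (inner ℝ e ((θ : EuclideanSpace ℝ (Fin n)) - θ'))
        ∂(sphereMeasure n)) ∂(sphereMeasure n) with hJ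
  have hmeas : Measurable fun z : EuclideanSpace ℝ (Fin n) × EuclideanSpace ℝ (Fin n) ×
      EuclideanSpace ℝ (Fin n) => rieszKer κ (inner ℝ z.1 (z.2.1 - z.2.2)) :=
    (measurable_rieszKer κ).comp (by fun_prop)
  -- By rotation invariance the energy does not depend on the direction, so it suffices to bound its
  -- average over all directions.
  have hconst : ∀ e', ‖e'‖ = 1 → J e' = J e := by
    intro e' he'
    obtain ⟨U, hU⟩ := exists_isometry_map (e := e) (e' := e') (by rw [he, he'])
    have h1 : ∀ x y : EuclideanSpace ℝ (Fin n), rieszKer κ (inner ℝ e (x - y)) =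
        rieszKer κ (inner ℝ e' (U x - U y)) := fun x y => by
      rw [← map_sub, ← hU, U.inner_map_map]
    have hm1 : ∀ x : EuclideanSpace ℝ (Fin n),
        Measurable fun y : EuclideanSpace ℝ (Fin n) => rieszKer κ (inner ℝ e' (x - y)) := fun x =>
      (measurable_rieszKer κ).comp (by fun_prop)
    have hm2 : Measurable fun x : EuclideanSpace ℝ (Fin n) => ∫⁻ θ',
        rieszKer κ (inner ℝ e' (x - (θ' : Metric.sphere (0 : EuclideanSpace ℝ (Fin n)) 1)))
          ∂(sphereMeasure n) := by
      apply Measurable.lintegral_prod_right' (f := fun z : EuclideanSpace ℝ (Fin n) ×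
        Metric.sphere (0 : EuclideanSpace ℝ (Fin n)) 1 =>
          rieszKer κ (inner ℝ e' (z.1 - (z.2 : EuclideanSpace ℝ (Fin n)))))
      exact (measurable_rieszKer κ).comp (by fun_prop)
    symm
    simp only [hJ]
    simp_rw [h1]
    have h2 : ∀ θ : Metric.sphere (0 : EuclideanSpace ℝ (Fin n)) 1,
        ∫⁻ θ', rieszKer κ (inner ℝ e' (U (θ : EuclideanSpace ℝ (Fin n)) -
          U ((θ' : Metric.sphere (0 : EuclideanSpace ℝ (Fin n)) 1) : EuclideanSpace ℝ (Fin n))))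
          ∂(sphereMeasure n) =
        ∫⁻ θ', rieszKer κ (inner ℝ e' (U (θ : EuclideanSpace ℝ (Fin n)) -
          ((θ' : Metric.sphere (0 : EuclideanSpace ℝ (Fin n)) 1) : EuclideanSpace ℝ (Fin n))))
          ∂(sphereMeasure n) := fun θ =>
      lintegral_sphere_comp_isometry hn0 (hm1 (U (θ : EuclideanSpace ℝ (Fin n)))) U
    simp_rw [h2]
    exact lintegral_sphere_comp_isometry hn0 hm2 U
  -- Averaging over the direction first turns the singularity on a hyperplane into one at the single
  -- point `v = 0`.
  have hdir : ∀ v : EuclideanSpace ℝ (Fin n), ∫⁻ e', rieszKer κ (inner ℝ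
      (e' : Metric.sphere (0 : EuclideanSpace ℝ (Fin n)) 1).1 v) ∂(sphereMeasure n) ≤
        C * rieszKer κ ‖v‖ := by
    intro v
    rcases eq_or_ne v 0 with rfl | hv
    · have : rieszKer κ ‖(0 : EuclideanSpace ℝ (Fin n))‖ = ∞ := by
        simp [rieszKer, ENNReal.zero_rpow_of_pos hκ0]
      rw [this, ENNReal.mul_top hC0]; exact le_top
    have hv' : ‖v‖ ≠ 0 := norm_ne_zero_iff.mpr hv
    have h1 : ∀ e' : Metric.sphere (0 : EuclideanSpace ℝ (Fin n)) 1,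
        rieszKer κ (inner ℝ e'.1 v) = rieszKer κ (inner ℝ (‖v‖⁻¹ • v) e'.1) * rieszKer κ ‖v‖ := by
      intro e'
      rw [← rieszKer_mul hκ0.le hv', inner_smul_left, real_inner_comm]
      congr 1
      simp only [conj_trivial]
      field_simp
    simp_rw [h1]
    have hvt : rieszKer κ ‖v‖ ≠ ∞ := by
      rw [rieszKer_eq_ofReal hv']; finiteness
    rw [lintegral_mul_const' _ _ hvt]
    gcongr
    exact hbound _ (norm_smul_inv_norm hv)
  -- For a unit vector `e'` orthogonal to `θ`, which exists as `n ≥ 2`, one has `|θ - θ'| ≥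
  -- |e'·θ'|`, and the one-direction bound applies again.
  have hdist : ∀ θ : Metric.sphere (0 : EuclideanSpace ℝ (Fin n)) 1,
      ∫⁻ θ', rieszKer κ ‖(θ : EuclideanSpace ℝ (Fin n)) - θ'‖ ∂(sphereMeasure n) ≤ C := by
    intro θ
    obtain ⟨e', he', horth⟩ := exists_unit_orthogonal hn (θ : EuclideanSpace ℝ (Fin n))
    refine (lintegral_mono fun θ' => rieszKer_anti hκ0.le ?_).trans (hbound e' he')
    have h1 : inner ℝ e' ((θ : EuclideanSpace ℝ (Fin n)) - θ') = -inner ℝ e' (θ' : EuclideanSpace ℝ (Fin n)) := by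
      rw [inner_sub_right, horth, zero_sub]
    have h2 := abs_real_inner_le_norm e' ((θ : EuclideanSpace ℝ (Fin n)) - θ')
    rw [h1, abs_neg, he', one_mul] at h2
    rwa [abs_norm]
  have htotal : ∫⁻ e', J (e' : Metric.sphere (0 : EuclideanSpace ℝ (Fin n)) 1).1 ∂(sphereMeasure n) ≤
      C * C * (sphereMeasure n) Set.univ := by
    have hm3 : Measurable fun z : (Metric.sphere (0 : EuclideanSpace ℝ (Fin n)) 1 ×
        Metric.sphere (0 : EuclideanSpace ℝ (Fin n)) 1) ×
        Metric.sphere (0 : EuclideanSpace ℝ (Fin n)) 1 =>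
        rieszKer κ (inner ℝ (z.1.1 : EuclideanSpace ℝ (Fin n))
          ((z.1.2 : EuclideanSpace ℝ (Fin n)) - z.2)) :=
      (measurable_rieszKer κ).comp (by fun_prop)
    have hm4 : Measurable fun z : (Metric.sphere (0 : EuclideanSpace ℝ (Fin n)) 1) ×
        Metric.sphere (0 : EuclideanSpace ℝ (Fin n)) 1 => ∫⁻ θ',
        rieszKer κ (inner ℝ (z.1 : EuclideanSpace ℝ (Fin n))
          ((z.2 : EuclideanSpace ℝ (Fin n)) - (θ' : Metric.sphere (0 : EuclideanSpace ℝ (Fin n)) 1)))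
            ∂(sphereMeasure n) := hm3.lintegral_prod_right'
    simp only [hJ]
    rw [lintegral_lintegral_swap hm4.aemeasurable]
    have h1 : ∀ θ : Metric.sphere (0 : EuclideanSpace ℝ (Fin n)) 1,
        ∫⁻ e', (∫⁻ θ', rieszKer κ (inner ℝ
          ((e' : Metric.sphere (0 : EuclideanSpace ℝ (Fin n)) 1) : EuclideanSpace ℝ (Fin n))
          ((θ : EuclideanSpace ℝ (Fin n)) - (θ' : Metric.sphere (0 : EuclideanSpace ℝ (Fin n)) 1)))
          ∂(sphereMeasure n)) ∂(sphereMeasure n) ≤ C * C := by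
      intro θ
      rw [lintegral_lintegral_swap]
      · refine (lintegral_mono fun θ' => hdir _).trans ?_
        rw [lintegral_const_mul' _ _ hC]
        gcongr
        exact hdist θ
      · exact ((measurable_rieszKer κ).comp (by fun_prop)).aemeasurable
    refine (lintegral_mono h1).trans_eq ?_
    rw [lintegral_const]
  have hJe : ∀ e' : Metric.sphere (0 : EuclideanSpace ℝ (Fin n)) 1, J e'.1 = J e := fun e' =>
    hconst _ (norm_eq_of_mem_sphere e')
  simp_rw [hJe] at htotal
  rw [lintegral_const] at htotal
  have hpos : (sphereMeasure n) Set.univ ≠ 0 := by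
    rw [ne_eq, Measure.measure_univ_eq_zero]
    exact Measure.toSphere_ne_zero _
  exact (ENNReal.mul_le_mul_iff_left hpos (measure_ne_top _ _)).mp htotal

end Polar

/-! ### Averaged decay of Fourier transforms of densities on the sphere -/

section SphereDecay

variable {n : ℕ}

lemma conj_osc (x : ℝ) : starRingEnd ℂ (osc x) = osc (-x) := by
  rw [osc, osc, ← Complex.exp_conj]
  congr 1
  have h2 : starRingEnd ℂ 2 = 2 := Complex.conj_ofNat 2
  simp [h2]

lemma integral_gaussian_mul_osc {a : ℝ} (ha : 0 < a) (x : ℝ) :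
    ∫ r : ℝ, ((Real.exp (-Real.pi * (r / a) ^ 2) : ℝ) : ℂ) * osc (r * x) =
      ((a * Real.exp (-Real.pi * (a * x) ^ 2) : ℝ) : ℂ) := by
  have hb : 0 < ((1 / a ^ 2 : ℝ) : ℂ).re := by
    rw [Complex.ofReal_re]; positivity
  have h := congrFun (fourier_gaussian_pi hb) x
  rw [Real.fourier_eq'] at h
  have hhalf : ((1 / a ^ 2 : ℝ) : ℂ) ^ (1 / 2 : ℂ) = ((1 / a : ℝ) : ℂ) := by
    rw [show (1 / 2 : ℂ) = ((1 / 2 : ℝ) : ℂ) by push_cast; rfl,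
      ← Complex.ofReal_cpow (by positivity), ← Real.sqrt_eq_rpow,
      show (1 / a ^ 2 : ℝ) = (1 / a) ^ 2 by ring, Real.sqrt_sq (by positivity)]
  rw [hhalf] at h
  calc _ = ∫ v : ℝ, Complex.exp (((-2 * Real.pi * inner ℝ v x : ℝ) : ℂ) * Complex.I) •
        Complex.exp (-(Real.pi : ℂ) * ((1 / a ^ 2 : ℝ) : ℂ) * (v : ℂ) ^ 2) := by
        congr 1; ext r
        rw [smul_eq_mul, mul_comm, osc, Complex.ofReal_exp]
        congr 2
        · simp; ring
        · push_cast; ring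
    _ = _ := h
    _ = _ := by
        push_cast
        rw [one_div_one_div]
        congr 2
        field_simp

/-- For `|y| ≤ 1` the number `1` separates the two sides; for `|y| ≥ 1` the Gaussian is below
`|y|^{-1}`. The Riesz kernel, unlike the Gaussian, is homogeneous, so the scale can be factored out
of it. -/
lemma ofReal_exp_neg_pi_sq_le_rieszKer {κ : ℝ} (hκ0 : 0 < κ) (hκ1 : κ < 1) (y : ℝ) :
    ENNReal.ofReal (Real.exp (-Real.pi * y ^ 2)) ≤ rieszKer κ y := by
  rcases eq_or_ne y 0 with rfl | hy
  · simp [rieszKer, ENNReal.zero_rpow_of_pos hκ0]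
  rw [rieszKer_eq_ofReal hy]
  apply ENNReal.ofReal_le_ofReal
  have hy' : 0 < |y| := abs_pos.mpr hy
  rcases le_total |y| 1 with h | h
  · calc Real.exp (-Real.pi * y ^ 2) ≤ 1 := by
          rw [Real.exp_le_one_iff]; nlinarith [Real.pi_pos, sq_nonneg y]
      _ ≤ _ := Real.one_le_rpow_of_pos_of_le_one_of_nonpos hy' h (by linarith)
  · have h1 : |y| ≤ Real.exp (Real.pi * y ^ 2) := by
      have := Real.add_one_le_exp (Real.pi * y ^ 2)
      have h2 : |y| ≤ y ^ 2 := by rw [← sq_abs]; nlinarith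
      nlinarith [Real.pi_gt_three, sq_nonneg y]
    calc Real.exp (-Real.pi * y ^ 2) = (Real.exp (Real.pi * y ^ 2))⁻¹ := by
          rw [← Real.exp_neg]; ring_nf
      _ ≤ |y|⁻¹ := inv_anti₀ hy' h1
      _ = |y| ^ (-1 : ℝ) := (Real.rpow_neg_one _).symm
      _ ≤ _ := Real.rpow_le_rpow_of_exponent_le h (by linarith)

/-- The Fourier transform of the density `Ω` on the sphere, along the ray through `ξ`. -/
def sphereFourier (Ω : EuclideanSpace ℝ (Fin n) → ℂ) (ξ : EuclideanSpace ℝ (Fin n)) (r : ℝ) : ℂ :=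
  ∫ θ, Ω (θ : EuclideanSpace ℝ (Fin n)) * osc (r * inner ℝ (θ : EuclideanSpace ℝ (Fin n)) ξ)
    ∂(sphereMeasure n)

variable {Ω : EuclideanSpace ℝ (Fin n) → ℂ} {M : ℝ}

lemma aestronglyMeasurable_mul_osc
    (hΩm : AEStronglyMeasurable (fun θ : Metric.sphere (0 : EuclideanSpace ℝ (Fin n)) 1 => Ω θ)
      (sphereMeasure n)) (μ : Measure ℝ) [SFinite μ] (ξ : EuclideanSpace ℝ (Fin n)) :
    AEStronglyMeasurable (fun z : ℝ × Metric.sphere (0 : EuclideanSpace ℝ (Fin n)) 1 =>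
      Ω z.2 * osc (z.1 * inner ℝ (z.2 : EuclideanSpace ℝ (Fin n)) ξ))
      (μ.prod (sphereMeasure n)) :=
  hΩm.comp_snd.mul (continuous_osc.comp (by fun_prop)).aestronglyMeasurable

lemma aestronglyMeasurable_sphereFourier
    (hΩm : AEStronglyMeasurable (fun θ : Metric.sphere (0 : EuclideanSpace ℝ (Fin n)) 1 => Ω θ)
      (sphereMeasure n)) (μ : Measure ℝ) [SFinite μ] (ξ : EuclideanSpace ℝ (Fin n)) :
    AEStronglyMeasurable (sphereFourier Ω ξ) μ :=
  (aestronglyMeasurable_mul_osc hΩm μ ξ).integral_prod_right'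

lemma norm_sphereFourier_le
    (hΩM : ∀ θ : Metric.sphere (0 : EuclideanSpace ℝ (Fin n)) 1, ‖Ω θ‖ ≤ M)
    (ξ : EuclideanSpace ℝ (Fin n)) (r : ℝ) :
    ‖sphereFourier Ω ξ r‖ ≤ M * (sphereMeasure n).real Set.univ :=
  norm_integral_le_of_norm_le_const (ae_of_all _ fun θ => by
    rw [norm_mul, norm_osc, mul_one]; exact hΩM θ)

lemma ofReal_norm_sq_sphereFourier (ξ : EuclideanSpace ℝ (Fin n)) (r : ℝ) :
    ((‖sphereFourier Ω ξ r‖ ^ 2 : ℝ) : ℂ) =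
      ∫ z : Metric.sphere (0 : EuclideanSpace ℝ (Fin n)) 1 ×
        Metric.sphere (0 : EuclideanSpace ℝ (Fin n)) 1,
        (Ω z.1 * starRingEnd ℂ (Ω z.2)) *
          osc (r * inner ℝ ξ ((z.1 : EuclideanSpace ℝ (Fin n)) - z.2))
        ∂((sphereMeasure n).prod (sphereMeasure n)) := by
  have h1 : starRingEnd ℂ (sphereFourier Ω ξ r) = ∫ θ,
      starRingEnd ℂ (Ω (θ : EuclideanSpace ℝ (Fin n))) *
        osc (-(r * inner ℝ (θ : EuclideanSpace ℝ (Fin n)) ξ)) ∂(sphereMeasure n) := by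
    rw [sphereFourier, ← integral_conj]
    simp_rw [map_mul, conj_osc]
  have h2 := Complex.mul_conj (sphereFourier Ω ξ r)
  rw [Complex.normSq_eq_norm_sq] at h2
  rw [← h2, h1, sphereFourier, ← integral_prod_mul]
  congr 1; ext z
  have h3 : r * inner ℝ ξ ((z.1 : EuclideanSpace ℝ (Fin n)) - z.2) =
      r * inner ℝ (z.1 : EuclideanSpace ℝ (Fin n)) ξ +
        -(r * inner ℝ (z.2 : EuclideanSpace ℝ (Fin n)) ξ) := by
    rw [inner_sub_right, real_inner_comm, real_inner_comm (z.2 : EuclideanSpace ℝ (Fin n)) ξ]; ring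
  rw [h3, osc_add]
  ring

/-- Expand the square over pairs `(θ, θ')` and integrate in `r` first. The Fourier transform of a
Gaussian is positive, so taking absolute values afterwards costs only `|Ω(θ) Ω(θ')| ≤ M²` and no
cancellation is lost. -/
lemma integral_gaussian_mul_norm_sq_sphereFourier_le
    (hΩm : AEStronglyMeasurable (fun θ : Metric.sphere (0 : EuclideanSpace ℝ (Fin n)) 1 => Ω θ)
      (sphereMeasure n))
    (hΩM : ∀ θ : Metric.sphere (0 : EuclideanSpace ℝ (Fin n)) 1, ‖Ω θ‖ ≤ M) {a : ℝ} (ha : 0 < a)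
    (ξ : EuclideanSpace ℝ (Fin n)) :
    ∫ r : ℝ, Real.exp (-Real.pi * (r / a) ^ 2) * ‖sphereFourier Ω ξ r‖ ^ 2 ≤
      M ^ 2 * a * ∫ z : Metric.sphere (0 : EuclideanSpace ℝ (Fin n)) 1 ×
        Metric.sphere (0 : EuclideanSpace ℝ (Fin n)) 1,
          Real.exp (-Real.pi * (a * inner ℝ ξ ((z.1 : EuclideanSpace ℝ (Fin n)) - z.2)) ^ 2)
            ∂((sphereMeasure n).prod (sphereMeasure n)) := by
  set σσ := (sphereMeasure n).prod (sphereMeasure n)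
  have hG : Integrable fun r : ℝ => ((Real.exp (-Real.pi * (r / a) ^ 2) : ℝ) : ℂ) := by
    have := integrable_exp_neg_mul_sq (b := Real.pi / a ^ 2) (by positivity)
    refine Integrable.ofReal (this.congr (ae_of_all _ fun r => ?_))
    simp only; congr 1; field_simp
  have hcm : AEStronglyMeasurable (fun z : Metric.sphere (0 : EuclideanSpace ℝ (Fin n)) 1 ×
        Metric.sphere (0 : EuclideanSpace ℝ (Fin n)) 1 => Ω z.1 * starRingEnd ℂ (Ω z.2)) σσ :=
    hΩm.comp_fst.mul (Complex.continuous_conj.comp_aestronglyMeasurable hΩm).comp_snd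
  have hcb : ∀ z : Metric.sphere (0 : EuclideanSpace ℝ (Fin n)) 1 ×
        Metric.sphere (0 : EuclideanSpace ℝ (Fin n)) 1,
        ‖Ω z.1 * starRingEnd ℂ (Ω z.2)‖ ≤ M ^ 2 := fun z => by
    rw [norm_mul, RCLike.norm_conj, sq]
    exact mul_le_mul (hΩM _) (hΩM _) (norm_nonneg _) ((norm_nonneg _).trans (hΩM z.1))
  have e1 : ((∫ r : ℝ, Real.exp (-Real.pi * (r / a) ^ 2) * ‖sphereFourier Ω ξ r‖ ^ 2 : ℝ) : ℂ) =
      ∫ z, (Ω z.1 * starRingEnd ℂ (Ω z.2)) * ((a * Real.exp (-Real.pi * (a *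
        inner ℝ ξ ((z.1 : EuclideanSpace ℝ (Fin n)) - z.2)) ^ 2) : ℝ) : ℂ) ∂σσ := by
    rw [← integral_complex_ofReal]
    calc _ = ∫ r : ℝ, ∫ z, ((Real.exp (-Real.pi * (r / a) ^ 2) : ℝ) : ℂ) *
          ((Ω z.1 * starRingEnd ℂ (Ω z.2)) *
            osc (r * inner ℝ ξ ((z.1 : EuclideanSpace ℝ (Fin n)) - z.2))) ∂σσ := by
          congr 1; ext r
          rw [Complex.ofReal_mul, ofReal_norm_sq_sphereFourier, integral_const_mul]
      _ = ∫ z, (∫ r : ℝ, ((Real.exp (-Real.pi * (r / a) ^ 2) : ℝ) : ℂ) *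
          ((Ω z.1 * starRingEnd ℂ (Ω z.2)) *
            osc (r * inner ℝ ξ ((z.1 : EuclideanSpace ℝ (Fin n)) - z.2)))) ∂σσ := by
          apply integral_integral_swap
          have hi : Integrable (fun z : ℝ × (Metric.sphere (0 : EuclideanSpace ℝ (Fin n)) 1 ×
              Metric.sphere (0 : EuclideanSpace ℝ (Fin n)) 1) =>
              ((Real.exp (-Real.pi * (z.1 / a) ^ 2) : ℝ) : ℂ) *
                (Ω z.2.1 * starRingEnd ℂ (Ω z.2.2))) (volume.prod σσ) :=
            hG.mul_prod (Integrable.of_bound hcm (M ^ 2) (ae_of_all _ hcb))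
          have := hi.bdd_mul (c := 1) (f := fun z : ℝ ×
              (Metric.sphere (0 : EuclideanSpace ℝ (Fin n)) 1 ×
              Metric.sphere (0 : EuclideanSpace ℝ (Fin n)) 1) =>
              osc (z.1 * inner ℝ ξ ((z.2.1 : EuclideanSpace ℝ (Fin n)) - z.2.2)))
            (continuous_osc.comp (by fun_prop)).aestronglyMeasurable
            (ae_of_all _ fun z => (norm_osc _).le)
          refine this.congr (ae_of_all _ fun z => ?_)
          simp only [Function.uncurry]
          ring
      _ = _ := by
          congr 1; ext z
          rw [← integral_gaussian_mul_osc ha, ← integral_const_mul]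
          congr 1; ext r; ring
  have hpos : 0 ≤ ∫ r : ℝ, Real.exp (-Real.pi * (r / a) ^ 2) * ‖sphereFourier Ω ξ r‖ ^ 2 :=
    integral_nonneg fun r => by positivity
  have hexp : Integrable (fun z : Metric.sphere (0 : EuclideanSpace ℝ (Fin n)) 1 ×
        Metric.sphere (0 : EuclideanSpace ℝ (Fin n)) 1 => Real.exp (-Real.pi * (a *
        inner ℝ ξ ((z.1 : EuclideanSpace ℝ (Fin n)) - z.2)) ^ 2)) σσ :=
    Integrable.of_bound (by fun_prop : Continuous _).aestronglyMeasurable 1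
      (ae_of_all _ fun z => by
        rw [Real.norm_eq_abs, abs_of_pos (Real.exp_pos _), Real.exp_le_one_iff]
        have := Real.pi_pos
        nlinarith [sq_nonneg (a * inner ℝ ξ ((z.1 : EuclideanSpace ℝ (Fin n)) - z.2))])
  rw [← abs_of_nonneg hpos, ← Real.norm_eq_abs, ← Complex.norm_real, e1]
  calc _ ≤ ∫ z, M ^ 2 * a * Real.exp (-Real.pi * (a *
        inner ℝ ξ ((z.1 : EuclideanSpace ℝ (Fin n)) - z.2)) ^ 2) ∂σσ := by
        refine norm_integral_le_of_norm_le (hexp.const_mul _) (ae_of_all _ fun z => ?_)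
        rw [norm_mul, Complex.norm_real, Real.norm_eq_abs, abs_of_nonneg (by positivity), mul_assoc]
        exact mul_le_mul_of_nonneg_right (hcb z) (by positivity)
    _ = _ := integral_const_mul _ _

/-- Dominate the Gaussian by the Riesz kernel. By homogeneity `(a|ξ|)^{-κ}` factors out, and the
energy of the sphere in the direction `ξ/|ξ|` remains. -/
lemma exists_integral_gaussian_sphere_le (hn : 2 ≤ n) {κ : ℝ} (hκ0 : 0 < κ) (hκ1 : κ < 1) :
    ∃ C : ℝ, 0 ≤ C ∧ ∀ (a : ℝ) (ξ : EuclideanSpace ℝ (Fin n)), 0 < a → ξ ≠ 0 →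
      ∫ z : Metric.sphere (0 : EuclideanSpace ℝ (Fin n)) 1 ×
        Metric.sphere (0 : EuclideanSpace ℝ (Fin n)) 1,
          Real.exp (-Real.pi * (a * inner ℝ ξ ((z.1 : EuclideanSpace ℝ (Fin n)) - z.2)) ^ 2)
            ∂((sphereMeasure n).prod (sphereMeasure n)) ≤ C * (a * ‖ξ‖) ^ (-κ) := by
  obtain ⟨C, hC, hE⟩ := exists_sphere_energy_le hn hκ0 hκ1
  refine ⟨C.toReal, ENNReal.toReal_nonneg, fun a ξ ha hξ => ?_⟩
  have hξ' : 0 < ‖ξ‖ := norm_pos_iff.mpr hξ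
  have haξ : a * ‖ξ‖ ≠ 0 := by positivity
  have hcont : Continuous fun z : Metric.sphere (0 : EuclideanSpace ℝ (Fin n)) 1 ×
        Metric.sphere (0 : EuclideanSpace ℝ (Fin n)) 1 => Real.exp (-Real.pi * (a *
        inner ℝ ξ ((z.1 : EuclideanSpace ℝ (Fin n)) - z.2)) ^ 2) := by fun_prop
  rw [integral_eq_lintegral_of_nonneg_ae (ae_of_all _ fun z => (Real.exp_pos _).le)
    hcont.aestronglyMeasurable]
  apply ENNReal.toReal_le_of_le_ofReal (by positivity)
  rw [ENNReal.ofReal_mul ENNReal.toReal_nonneg, ENNReal.ofReal_toReal hC]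
  have hm : Measurable fun z : Metric.sphere (0 : EuclideanSpace ℝ (Fin n)) 1 ×
        Metric.sphere (0 : EuclideanSpace ℝ (Fin n)) 1 => rieszKer κ (inner ℝ (‖ξ‖⁻¹ • ξ)
          ((z.1 : EuclideanSpace ℝ (Fin n)) - z.2)) :=
    (measurable_rieszKer κ).comp (by fun_prop)
  have hr : rieszKer κ (a * ‖ξ‖) = ENNReal.ofReal ((a * ‖ξ‖) ^ (-κ)) := by
    rw [rieszKer_eq_ofReal haξ, abs_of_pos (by positivity)]
  calc _ ≤ ∫⁻ z, rieszKer κ (inner ℝ (‖ξ‖⁻¹ • ξ) ((z.1 : EuclideanSpace ℝ (Fin n)) -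
          (z.2 : Metric.sphere (0 : EuclideanSpace ℝ (Fin n)) 1))) *
        rieszKer κ (a * ‖ξ‖) ∂((sphereMeasure n).prod (sphereMeasure n)) := by
        refine lintegral_mono fun z => ?_
        refine (ofReal_exp_neg_pi_sq_le_rieszKer hκ0 hκ1 _).trans_eq ?_
        rw [← rieszKer_mul hκ0.le haξ, inner_smul_left]
        congr 1
        simp only [conj_trivial]
        field_simp
    _ = (∫⁻ z, rieszKer κ (inner ℝ (‖ξ‖⁻¹ • ξ) ((z.1 : EuclideanSpace ℝ (Fin n)) -
          (z.2 : Metric.sphere (0 : EuclideanSpace ℝ (Fin n)) 1)))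
          ∂((sphereMeasure n).prod (sphereMeasure n))) * rieszKer κ (a * ‖ξ‖) :=
        lintegral_mul_const _ hm
    _ ≤ _ := by
        rw [hr]
        gcongr
        rw [lintegral_prod _ hm.aemeasurable]
        exact hE _ (norm_smul_inv_norm hξ)

/-- The Gaussian bound controls the mean square of the transform over `(a, 2a]`; passing from mean
square to mean halves the exponent `κ`. -/
lemma exists_integral_norm_sphereFourier_le (hn : 2 ≤ n)
    (hΩm : AEStronglyMeasurable (fun θ : Metric.sphere (0 : EuclideanSpace ℝ (Fin n)) 1 => Ω θ)
      (sphereMeasure n)) (hM0 : 0 < M)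
    (hΩM : ∀ θ : Metric.sphere (0 : EuclideanSpace ℝ (Fin n)) 1, ‖Ω θ‖ ≤ M)
    {κ : ℝ} (hκ0 : 0 < κ) (hκ1 : κ < 1) :
    ∃ C : ℝ, 0 ≤ C ∧ ∀ (a : ℝ) (ξ : EuclideanSpace ℝ (Fin n)), 0 < a → ξ ≠ 0 →
      ∫ r in Set.Ioc a (2 * a), ‖sphereFourier Ω ξ r‖ ≤ C * a * (a * ‖ξ‖) ^ (-(κ / 2)) := by
  obtain ⟨C₀, hC₀, hE⟩ := exists_integral_gaussian_sphere_le hn hκ0 hκ1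
  set L := Real.exp (4 * Real.pi) * M ^ 2 * C₀ with hL
  have hL0 : 0 ≤ L := by positivity
  refine ⟨(1 + L) / 2, by positivity, fun a ξ ha hξ => ?_⟩
  have hξ' : 0 < ‖ξ‖ := norm_pos_iff.mpr hξ
  -- The expected root mean square size. Cauchy–Schwarz is used below in the form `S ≤ c/2 +
  -- S²/(2c)`.
  set c := (a * ‖ξ‖) ^ (-(κ / 2)) with hc
  have hc0 : 0 < c := by positivity
  have hcc : (a * ‖ξ‖) ^ (-κ) = c * c := by
    rw [hc, ← Real.rpow_add (by positivity)]; ring_nf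
  set B := M * (sphereMeasure n).real Set.univ
  have hB := norm_sphereFourier_le hΩM ξ
  have hSm := aestronglyMeasurable_sphereFourier hΩm volume ξ
  have hG : Integrable fun r : ℝ => Real.exp (-Real.pi * (r / a) ^ 2) := by
    have := integrable_exp_neg_mul_sq (b := Real.pi / a ^ 2) (by positivity)
    refine this.congr (ae_of_all _ fun r => ?_)
    simp only; congr 1; field_simp
  have hGS : Integrable fun r : ℝ =>
      Real.exp (-Real.pi * (r / a) ^ 2) * ‖sphereFourier Ω ξ r‖ ^ 2 :=
    hG.mul_bdd (c := B ^ 2) (hSm.norm.pow 2) (ae_of_all _ fun r => by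
      rw [norm_pow, norm_norm]; gcongr; exact hB r)
  have hfin : IsFiniteMeasure (volume.restrict (Set.Ioc a (2 * a))) := inferInstance
  have hS1 : IntegrableOn (fun r => ‖sphereFourier Ω ξ r‖) (Set.Ioc a (2 * a)) :=
    Integrable.of_bound hSm.restrict.norm B (ae_of_all _ fun r => by
      rw [norm_norm]; exact hB r)
  have hS2 : IntegrableOn (fun r => ‖sphereFourier Ω ξ r‖ ^ 2) (Set.Ioc a (2 * a)) :=
    Integrable.of_bound (hSm.restrict.norm.pow 2) (B ^ 2) (ae_of_all _ fun r => by
      rw [norm_pow, norm_norm]; gcongr; exact hB r)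
  have hsq : ∫ r in Set.Ioc a (2 * a), ‖sphereFourier Ω ξ r‖ ^ 2 ≤ L * a * (c * c) := by
    -- For `r ≤ 2a` the Gaussian weight is at least `e^{-4π}`.
    calc _ ≤ ∫ r in Set.Ioc a (2 * a), Real.exp (4 * Real.pi) *
          (Real.exp (-Real.pi * (r / a) ^ 2) * ‖sphereFourier Ω ξ r‖ ^ 2) := by
          refine setIntegral_mono_on hS2 (hGS.const_mul _).integrableOn measurableSet_Ioc ?_
          intro r hr
          rw [← mul_assoc, ← Real.exp_add]
          refine le_mul_of_one_le_left (by positivity) (Real.one_le_exp ?_)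
          have h1 : r / a ≤ 2 := by rw [div_le_iff₀ ha]; exact hr.2
          have h2 : 0 ≤ r / a := div_nonneg (ha.trans hr.1).le ha.le
          have h3 : (r / a) ^ 2 ≤ 4 := by nlinarith
          nlinarith [Real.pi_pos]
      _ ≤ ∫ r, Real.exp (4 * Real.pi) *
          (Real.exp (-Real.pi * (r / a) ^ 2) * ‖sphereFourier Ω ξ r‖ ^ 2) :=
          setIntegral_le_integral (hGS.const_mul _) (ae_of_all _ fun r => by positivity)
      _ = Real.exp (4 * Real.pi) * ∫ r,
          (Real.exp (-Real.pi * (r / a) ^ 2) * ‖sphereFourier Ω ξ r‖ ^ 2) :=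
          integral_const_mul _ _
      _ ≤ Real.exp (4 * Real.pi) * (M ^ 2 * a * (C₀ * (a * ‖ξ‖) ^ (-κ))) := by
          gcongr
          refine (integral_gaussian_mul_norm_sq_sphereFourier_le hΩm hΩM ha ξ).trans ?_
          gcongr
          exact hE a ξ ha hξ
      _ = _ := by rw [hcc, hL]; ring
  calc _ ≤ ∫ r in Set.Ioc a (2 * a), (c / 2 + ‖sphereFourier Ω ξ r‖ ^ 2 * (1 / (2 * c))) := by
        refine setIntegral_mono hS1 ((integrable_const _).add (hS2.mul_const _)) fun r => ?_
        simp only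
        have := sq_nonneg (‖sphereFourier Ω ξ r‖ - c)
        rw [← sub_nonneg]
        have e : c / 2 + ‖sphereFourier Ω ξ r‖ ^ 2 * (1 / (2 * c)) - ‖sphereFourier Ω ξ r‖ =
          (‖sphereFourier Ω ξ r‖ - c) ^ 2 / (2 * c) := by field_simp; ring
        rw [e]; positivity
    _ = a * (c / 2) + (∫ r in Set.Ioc a (2 * a), ‖sphereFourier Ω ξ r‖ ^ 2) * (1 / (2 * c)) := by
        rw [integral_add (integrable_const _) (hS2.mul_const _), integral_mul_const,
          setIntegral_const, smul_eq_mul, Real.volume_real_Ioc_of_le (by linarith)]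
        ring_nf
    _ ≤ a * (c / 2) + (L * a * (c * c)) * (1 / (2 * c)) := by gcongr
    _ = _ := by field_simp

end SphereDecay

/-! ### The profile and the radial oscillatory integral -/

section Profile

variable {φ : ℝ → ℝ} {k₁ k₂ k₃ : ℝ}

lemma IsAdmissibleProfile.hasDerivAt (hφ : IsAdmissibleProfile φ k₁ k₂ k₃) {r : ℝ} (hr : 0 < r) :
    HasDerivAt φ (deriv φ r) r :=
  ((hφ.contDiffOn.contDiffAt (Ioi_mem_nhds hr)).differentiableAt (by norm_num)).hasDerivAt

lemma IsAdmissibleProfile.contDiffOn_deriv (hφ : IsAdmissibleProfile φ k₁ k₂ k₃) :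
    ContDiffOn ℝ 2 (deriv φ) (Set.Ioi 0) :=
  ((contDiffOn_succ_iff_deriv_of_isOpen (n := 2) isOpen_Ioi).mp hφ.contDiffOn).2.2

lemma IsAdmissibleProfile.hasDerivAt_deriv (hφ : IsAdmissibleProfile φ k₁ k₂ k₃) {r : ℝ}
    (hr : 0 < r) : HasDerivAt (deriv φ) (iteratedDeriv 2 φ r) r := by
  have h := ((hφ.contDiffOn_deriv.contDiffAt (Ioi_mem_nhds hr)).differentiableAt
    (by norm_num)).hasDerivAt
  rwa [iteratedDeriv_succ, iteratedDeriv_one]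

lemma IsAdmissibleProfile.continuousOn_iteratedDeriv_two (hφ : IsAdmissibleProfile φ k₁ k₂ k₃) :
    ContinuousOn (iteratedDeriv 2 φ) (Set.Ioi 0) := by
  have h := ((contDiffOn_succ_iff_deriv_of_isOpen (n := 1) isOpen_Ioi).mp
    hφ.contDiffOn_deriv).2.2.continuousOn
  rwa [iteratedDeriv_succ, iteratedDeriv_one]

lemma IsAdmissibleProfile.continuousOn (hφ : IsAdmissibleProfile φ k₁ k₂ k₃) :
    ContinuousOn φ (Set.Ioi 0) := hφ.contDiffOn.continuousOn

lemma IsAdmissibleProfile.continuousOn_deriv (hφ : IsAdmissibleProfile φ k₁ k₂ k₃) :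
    ContinuousOn (deriv φ) (Set.Ioi 0) := hφ.contDiffOn_deriv.continuousOn

lemma IsAdmissibleProfile.deriv_ne_zero (hφ : IsAdmissibleProfile φ k₁ k₂ k₃) {r : ℝ}
    (hr : 0 < r) : deriv φ r ≠ 0 := fun h => by
  have := hφ.deriv_mul_pos r hr
  rw [h, zero_mul] at this
  exact lt_irrefl _ this

/-- A continuous function without zeros on an interval has constant sign. This yields the dichotomy
for the sign of `η φ'` in the radial integral. -/
lemma IsAdmissibleProfile.deriv_pos_or_neg (hφ : IsAdmissibleProfile φ k₁ k₂ k₃) :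
    (∀ r, 0 < r → 0 < deriv φ r) ∨ ∀ r, 0 < r → deriv φ r < 0 := by
  by_contra! hcon
  obtain ⟨⟨r, hr, h1⟩, s, hs, h2⟩ := hcon
  have := (isPreconnected_Ioi (a := (0 : ℝ))).intermediate_value (Set.mem_Ioi.mpr hr)
    (Set.mem_Ioi.mpr hs) hφ.continuousOn_deriv
  obtain ⟨x, hx, hx0⟩ := this (show (0 : ℝ) ∈ Set.Icc _ _ from ⟨h1, h2⟩)
  exact hφ.deriv_ne_zero hx hx0

lemma IsAdmissibleProfile.abs_iteratedDeriv_two_le (hφ : IsAdmissibleProfile φ k₁ k₂ k₃) {r : ℝ}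
    (hr : 0 < r) : |iteratedDeriv 2 φ r| ≤ k₂ / r * |deriv φ r| := by
  have h0 := hφ.deriv_ne_zero hr
  have h1 := hφ.ratio_le r hr
  have h2 := (hφ.k₁_pos.trans_le (hφ.le_ratio r hr))
  rw [← abs_of_pos h2, abs_div, abs_mul, abs_of_pos hr, div_le_iff₀ (abs_pos.mpr h0)] at h1
  rw [div_mul_eq_mul_div, le_div_iff₀ hr]
  linarith

/-- `φ' φ'' > 0` says that `(φ')²` is increasing. In particular `φ'` is bounded near the origin
although `φ` is not assumed differentiable there. -/
lemma IsAdmissibleProfile.abs_deriv_mono (hφ : IsAdmissibleProfile φ k₁ k₂ k₃) {r s : ℝ}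
    (hr : 0 < r) (hrs : r ≤ s) : |deriv φ r| ≤ |deriv φ s| := by
  have hd : ∀ x ∈ Set.Ioi (0 : ℝ), HasDerivAt (fun y => deriv φ y ^ 2)
      (2 * (deriv φ x * iteratedDeriv 2 φ x)) x := fun x hx =>
    ((hφ.hasDerivAt_deriv hx).pow 2).congr_deriv (by ring)
  have hmono : MonotoneOn (fun y => deriv φ y ^ 2) (Set.Ioi 0) := by
    apply monotoneOn_of_deriv_nonneg (convex_Ioi 0)
    · exact fun x hx => (hd x hx).continuousAt.continuousWithinAt
    · exact fun x hx => (hd x (interior_subset hx)).differentiableAt.differentiableWithinAt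
    · intro x hx
      rw [(hd x (interior_subset hx)).deriv]
      have := hφ.deriv_mul_pos x (interior_subset hx)
      linarith
  exact sq_le_sq.mp (hmono (Set.mem_Ioi.mpr hr) (Set.mem_Ioi.mpr (hr.trans_le hrs)) hrs)

lemma IsAdmissibleProfile.measurable_comp_norm (hφ : IsAdmissibleProfile φ k₁ k₂ k₃) {n : ℕ} :
    Measurable fun t : EuclideanSpace ℝ (Fin n) => φ ‖t‖ := by
  have h1 : Measurable (Set.indicator (Set.Ioi 0) φ) := by
    rw [← Set.piecewise_eq_indicator]
    exact ContinuousOn.measurable_piecewise hφ.continuousOn continuousOn_const measurableSet_Ioi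
  have h2 : (fun t : EuclideanSpace ℝ (Fin n) => φ ‖t‖) =
      fun t => Set.indicator (Set.Ioi 0) φ ‖t‖ := by
    ext t
    rcases (norm_nonneg t).eq_or_lt with h | h
    · rw [← h, hφ.zero]; simp
    · rw [Set.indicator_of_mem (Set.mem_Ioi.mpr h)]
  rw [h2]
  exact h1.comp measurable_norm

variable {α β : ℝ}

lemma rpow_div_const_mul_rpow {a c s q : ℝ} (ha : 0 < a) (hc : 0 < c) :
    a ^ q / (c * (2 * a) ^ (-s)) = 2 ^ s / c * a ^ (q + s) := by
  rw [Real.mul_rpow two_pos.le ha.le, Real.rpow_neg two_pos.le, Real.rpow_neg ha.le,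
    Real.rpow_add ha]
  field_simp

/-- Decay of the radial integral when the linear part of the phase is dominated by the derivative
of the singular phase. -/
lemma exists_norm_integral_radial_le (hφ : IsAdmissibleProfile φ k₁ k₂ k₃) (hα : 0 < α)
    (hβ : 0 < β) :
    ∃ C : ℝ, 0 ≤ C ∧ ∀ a u η : ℝ, 0 < a → a ≤ 1 → |u| ≤ β / 2 * (2 * a) ^ (-(β + 1)) →
      ‖∫ r in a..2 * a, osc (r * u + η * φ r + r ^ (-β)) * ((r ^ (-1 - α) : ℝ) : ℂ)‖ ≤
        C * a ^ (-α + β / 2) := by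
  have hk₂ : 0 < k₂ := hφ.k₁_pos.trans_le hφ.k₁_le_k₂
  set C₁ := 2 * (5 + α) * (2 ^ (β / 2 + 1) / √(β * (β + 1)))
  set C₂ := (3 + α + 2 * (k₂ + β + 1)) * (2 ^ (β + 1) / (β / 2))
  have hC₁ : 0 ≤ C₁ := by positivity
  have hC₂ : 0 ≤ C₂ := by positivity
  refine ⟨C₁ + C₂, by positivity, fun a u η ha ha1 hu => ?_⟩
  have hab : a ≤ 2 * a := by linarith
  have hpos : ∀ r ∈ Set.Icc a (2 * a), 0 < r := fun r hr => ha.trans_le hr.1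
  set F : ℝ → ℝ := fun r => r * u + η * φ r + r ^ (-β) with hFdef
  set F' : ℝ → ℝ := fun r => u + η * deriv φ r + -β * r ^ (-β - 1) with hF'def
  set F'' : ℝ → ℝ := fun r => η * iteratedDeriv 2 φ r + β * (β + 1) * r ^ (-β - 2) with hF''def
  have hF : ∀ r ∈ Set.Icc a (2 * a), HasDerivAt F (F' r) r := by
    intro r hr
    have h0 := hpos r hr
    exact ((((hasDerivAt_id r).mul_const u).add ((hφ.hasDerivAt h0).const_mul η)).add
      (Real.hasDerivAt_rpow_const (Or.inl h0.ne'))).congr_deriv (by simp [hF'def])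
  have hF' : ∀ r ∈ Set.Icc a (2 * a), HasDerivAt F' (F'' r) r := by
    intro r hr
    have h0 := hpos r hr
    exact ((((hφ.hasDerivAt_deriv h0).const_mul η).const_add u).add
      ((Real.hasDerivAt_rpow_const (p := -β - 1) (Or.inl h0.ne')).const_mul (-β))).congr_deriv (by
        simp only [hF''def]
        rw [show -β - 1 - 1 = -β - 2 by ring]; ring)
  have hF'' : ContinuousOn F'' (Set.Icc a (2 * a)) := by
    refine ContinuousOn.add (continuousOn_const.mul
      (hφ.continuousOn_iteratedDeriv_two.mono fun r hr => hpos r hr)) (continuousOn_const.mul ?_)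
    exact continuousOn_id.rpow_const fun r hr => Or.inl (hpos r hr).ne'
  have hψ : ∀ r ∈ Set.Icc a (2 * a), HasDerivAt (fun r : ℝ => r ^ (-1 - α))
      ((-1 - α) * r ^ (-1 - α - 1)) r := fun r hr =>
    Real.hasDerivAt_rpow_const (Or.inl (hpos r hr).ne')
  have hψ' : ContinuousOn (fun r : ℝ => (-1 - α) * r ^ (-1 - α - 1)) (Set.Icc a (2 * a)) :=
    continuousOn_const.mul
      (continuousOn_id.rpow_const fun r hr => Or.inl (hpos r hr).ne')
  have hP : ∀ r ∈ Set.Icc a (2 * a), |r ^ (-1 - α)| ≤ a ^ (-1 - α) := fun r hr => by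
    rw [abs_of_nonneg (Real.rpow_nonneg (hpos r hr).le _)]
    exact Real.rpow_le_rpow_of_nonpos ha hr.1 (by linarith)
  have hQ : ∀ r ∈ Set.Icc a (2 * a), |(-1 - α) * r ^ (-1 - α - 1)| ≤
      (1 + α) * a ^ (-1 - α - 1) := fun r hr => by
    rw [abs_mul, abs_of_nonneg (Real.rpow_nonneg (hpos r hr).le _),
      show |(-1 - α)| = 1 + α by rw [abs_of_neg (by linarith)]; ring]
    gcongr ?_ * ?_
    exact Real.rpow_le_rpow_of_nonpos ha hr.1 (by linarith)
  have hQP : (1 + α) * a ^ (-1 - α - 1) * (2 * a - a) = (1 + α) * a ^ (-1 - α) := by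
    rw [Real.rpow_sub_one ha.ne']; field_simp; ring
  have hP0 : 0 < a ^ (-1 - α) := by positivity
  have hcase : (∀ r, 0 < r → 0 ≤ η * deriv φ r) ∨ ∀ r, 0 < r → η * deriv φ r ≤ 0 := by
    rcases hφ.deriv_pos_or_neg with h | h <;> rcases le_total 0 η with hη | hη
    · exact Or.inl fun r hr => mul_nonneg hη (h r hr).le
    · exact Or.inr fun r hr => mul_nonpos_of_nonpos_of_nonneg hη (h r hr).le
    · exact Or.inr fun r hr => mul_nonpos_of_nonneg_of_nonpos hη (h r hr).le
    · exact Or.inl fun r hr => mul_nonneg_of_nonpos_of_nonpos hη (h r hr).le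
  rcases hcase with hA | hB
  -- Here `η φ'`, hence also `η φ''`, is nonnegative, so `F''` is at least the second derivative of
  -- `r^{-β}`; `δ²` is the value of the latter at `2a`.
  · set δ := √(β * (β + 1)) * (2 * a) ^ (-(β / 2 + 1)) with hδdef
    have hs : 0 < √(β * (β + 1)) := Real.sqrt_pos.mpr (by positivity)
    have hδ : 0 < δ := by positivity
    have hδ2 : δ ^ 2 = β * (β + 1) * (2 * a) ^ (-β - 2) := by
      rw [hδdef, mul_pow, Real.sq_sqrt (by positivity), ← Real.rpow_natCast,
        ← Real.rpow_mul (by positivity)]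
      congr 2; push_cast; ring
    have hFδ : ∀ r ∈ Set.Icc a (2 * a), δ ^ 2 ≤ F'' r := by
      intro r hr
      have h0 := hpos r hr
      have h1 : 0 ≤ η * iteratedDeriv 2 φ r := by
        have h2 := hφ.deriv_mul_pos r h0
        have h3 := hA r h0
        by_contra hneg
        push Not at hneg
        have h4 := mul_nonneg h3 h2.le
        have h5 : η * deriv φ r * (deriv φ r * iteratedDeriv 2 φ r) =
          (η * iteratedDeriv 2 φ r) * (deriv φ r) ^ 2 := by ring
        rw [h5] at h4
        have h6 : 0 < deriv φ r ^ 2 := by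
          have := hφ.deriv_ne_zero h0
          positivity
        nlinarith
      have h2 : (2 * a) ^ (-β - 2) ≤ r ^ (-β - 2) :=
        Real.rpow_le_rpow_of_nonpos h0 hr.2 (by linarith)
      rw [hδ2]
      have : β * (β + 1) * (2 * a) ^ (-β - 2) ≤ β * (β + 1) * r ^ (-β - 2) := by gcongr
      simp only [hF''def]
      linarith
    refine (norm_integral_osc_le_of_deriv2 hab hF hF' hF'' hψ hψ' hδ hFδ hP hQ).trans ?_
    rw [hQP]
    calc _ = 2 * (5 + α) * (a ^ (-1 - α) / δ) := by ring
      _ = C₁ * a ^ (-α + β / 2) := by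
          rw [hδdef, rpow_div_const_mul_rpow ha hs,
            show -1 - α + (β / 2 + 1) = -α + β / 2 by ring]
          ring
      _ ≤ _ := by gcongr; linarith
  -- Here `η φ'` and `-β r^{-β-1}` are both nonpositive, and `|u| ≤ δ` absorbs at most half of the
  -- second. Hence `F'` stays away from zero, however large `η` is.
  · set δ := β / 2 * (2 * a) ^ (-(β + 1)) with hδdef
    have hδ : 0 < δ := by positivity
    have hβr : ∀ r ∈ Set.Icc a (2 * a), 2 * δ ≤ β * r ^ (-β - 1) := by
      intro r hr
      have h2 : (2 * a) ^ (-β - 1) ≤ r ^ (-β - 1) :=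
        Real.rpow_le_rpow_of_nonpos (hpos r hr) hr.2 (by linarith)
      rw [hδdef, show -(β + 1) = -β - 1 by ring]
      have : β * (2 * a) ^ (-β - 1) ≤ β * r ^ (-β - 1) := by gcongr
      linarith
    have hD : ∀ r ∈ Set.Icc a (2 * a),
        (β * r ^ (-β - 1) + |η * deriv φ r|) / 2 ≤ |F' r| := by
      intro r hr
      have h1 := hβr r hr
      have h2 := hB r (hpos r hr)
      have h3 := (abs_le.mp hu).2
      have h4 : F' r ≤ -((β * r ^ (-β - 1) + |η * deriv φ r|) / 2) := by
        rw [abs_of_nonpos h2]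
        simp only [hF'def]
        linarith
      have h6 := neg_le_abs (F' r)
      linarith
    have hFδ : ∀ r ∈ Set.Icc a (2 * a), δ ≤ |F' r| := fun r hr => by
      have h1 := hβr r hr
      have h2 := hD r hr
      have := abs_nonneg (η * deriv φ r)
      linarith
    -- `F'` need not be monotone, so nothing telescopes. Instead `r |F''|` is compared with `D = β
    -- r^{-β-1} + |η φ'|`, using the upper bound `k₂` on `r φ'' / φ'`; as `|F'| ≥ D/2`, the
    -- integrand is `O(1/(aδ))` on an interval of length `a`.
    have hK : ∫ r in a..2 * a, |F'' r| / F' r ^ 2 ≤ 2 * (k₂ + β + 1) / δ := by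
      have hpt : ∀ r ∈ Set.Icc a (2 * a), |F'' r| / F' r ^ 2 ≤ 2 * (k₂ + β + 1) / (a * δ) := by
        intro r hr
        have h0 := hpos r hr
        set D := β * r ^ (-β - 1) + |η * deriv φ r| with hDdef
        have h1 := hβr r hr
        have h2 : D / 2 ≤ |F' r| := hD r hr
        have hDδ : 2 * δ ≤ D := by
          have := abs_nonneg (η * deriv φ r); linarith
        have hD0 : 0 < D := by linarith
        have h3 : |F'' r| ≤ (k₂ + β + 1) / r * D := by
          have h4 : |η * iteratedDeriv 2 φ r| ≤ k₂ / r * |η * deriv φ r| := by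
            rw [abs_mul, abs_mul]
            have := mul_le_mul_of_nonneg_left (hφ.abs_iteratedDeriv_two_le h0) (abs_nonneg η)
            linarith
          have h5 : β * (β + 1) * r ^ (-β - 2) = (β + 1) / r * (β * r ^ (-β - 1)) := by
            rw [show -β - 2 = -β - 1 - 1 by ring, Real.rpow_sub_one h0.ne']; ring
          have h6 : 0 ≤ β * r ^ (-β - 1) := by positivity
          calc |F'' r| ≤ |η * iteratedDeriv 2 φ r| + |β * (β + 1) * r ^ (-β - 2)| := abs_add_le _ _
            _ ≤ k₂ / r * |η * deriv φ r| + (β + 1) / r * (β * r ^ (-β - 1)) := by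
                rw [h5, abs_of_nonneg (by positivity : 0 ≤ (β + 1) / r * (β * r ^ (-β - 1)))]
                gcongr
            _ ≤ (k₂ + β + 1) / r * |η * deriv φ r| + (k₂ + β + 1) / r * (β * r ^ (-β - 1)) := by
                gcongr <;> linarith
            _ = _ := by rw [hDdef]; ring
        have h7 : D ^ 2 / 4 ≤ F' r ^ 2 := by
          rw [← sq_abs (F' r)]
          nlinarith
        calc |F'' r| / F' r ^ 2 ≤ ((k₂ + β + 1) / r * D) / (D ^ 2 / 4) :=
              div_le_div₀ (by positivity) h3 (by positivity) h7
          _ = 4 * (k₂ + β + 1) / (r * D) := by field_simp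
          _ ≤ 4 * (k₂ + β + 1) / (a * (2 * δ)) := by
              gcongr
              exact hr.1
          _ = _ := by field_simp; ring
      have hne : ∀ r ∈ Set.Icc a (2 * a), F' r ≠ 0 := fun r hr h0 => by
        have := hFδ r hr; rw [h0, abs_zero] at this; linarith
      have cF' : ContinuousOn F' (Set.Icc a (2 * a)) := fun r hr =>
        (hF' r hr).continuousAt.continuousWithinAt
      calc _ ≤ ∫ _ in a..2 * a, 2 * (k₂ + β + 1) / (a * δ) := by
            refine intervalIntegral.integral_mono_on hab ?_ intervalIntegrable_const hpt
            apply ContinuousOn.intervalIntegrable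
            rw [Set.uIcc_of_le hab]
            exact hF''.abs.div (cF'.pow 2) fun r hr => pow_ne_zero _ (hne r hr)
        _ = _ := by
            rw [intervalIntegral.integral_const, smul_eq_mul]; field_simp; ring
    refine (norm_integral_osc_le_of_deriv hab hF hF' hF'' hψ hψ' hδ hP0.le hFδ hP hQ hK).trans ?_
    rw [hQP]
    calc _ = (3 + α + 2 * (k₂ + β + 1)) * (a ^ (-1 - α) / δ) := by ring
      _ = C₂ * a ^ (-α + β) := by
          rw [hδdef, rpow_div_const_mul_rpow ha (by positivity),
            show -1 - α + (β + 1) = -α + β by ring]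
          ring
      -- The nonstationary case gains `a^β`, more than needed; `a ≤ 1` weakens it to the common
      -- exponent.
      _ ≤ C₂ * a ^ (-α + β / 2) := by
          gcongr ?_ * ?_
          exact Real.rpow_le_rpow_of_exponent_ge ha ha1 (by linarith)
      _ ≤ _ := by gcongr; linarith

end Profile

/-! ### The kernel in polar coordinates and the multiplier bound -/

section Multiplier

variable {n : ℕ} {φ : ℝ → ℝ} {k₁ k₂ k₃ : ℝ} {Ω : EuclideanSpace ℝ (Fin n) → ℂ} {α β : ℝ}

lemma IsAdmissibleAngular.apply_smul (hΩ : IsAdmissibleAngular Ω) {r : ℝ}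
    {t : EuclideanSpace ℝ (Fin n)} (hr : 0 < r) (ht : t ≠ 0) : Ω (r • t) = Ω t := by
  have h := hΩ.homogeneous r t hr ht
  have ht' : (‖t‖ : ℂ) ≠ 0 := by exact_mod_cast norm_ne_zero_iff.mpr ht
  have hr' : (r : ℂ) ≠ 0 := by exact_mod_cast hr.ne'
  rw [norm_smul, Real.norm_eq_abs, abs_of_pos hr, mul_pow, zpow_neg, zpow_natCast] at h
  push_cast at h
  field_simp at h
  exact h

lemma sphere_ne_zero (θ : Metric.sphere (0 : EuclideanSpace ℝ (Fin n)) 1) :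
    (θ : EuclideanSpace ℝ (Fin n)) ≠ 0 := ne_zero_of_mem_unit_sphere θ

lemma norm_smul_sphere (θ : Metric.sphere (0 : EuclideanSpace ℝ (Fin n)) 1) {r : ℝ} (hr : 0 < r) :
    ‖r • (θ : EuclideanSpace ℝ (Fin n))‖ = r := by
  rw [norm_smul, norm_eq_of_mem_sphere θ, Real.norm_eq_abs, abs_of_pos hr, mul_one]

lemma IsAdmissibleAngular.exists_bound (hΩ : IsAdmissibleAngular Ω) :
    ∃ M : ℝ, 0 < M ∧ ∀ t, t ≠ 0 → ‖Ω t‖ ≤ M := by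
  obtain ⟨M, hM⟩ := hΩ.bounded_sphere
  refine ⟨max M 1, lt_of_lt_of_le one_pos (le_max_right _ _), fun t ht => ?_⟩
  have h0 : 0 < ‖t‖⁻¹ := inv_pos.mpr (norm_pos_iff.mpr ht)
  rw [← hΩ.apply_smul h0 ht]
  refine (hM _ ?_).trans (le_max_left _ _)
  rw [mem_sphere_zero_iff_norm]
  exact norm_smul_inv_norm ht

lemma IsAdmissibleAngular.aestronglyMeasurable_sphere (hΩ : IsAdmissibleAngular Ω) (hn : 0 < n) :
    AEStronglyMeasurable (fun θ : Metric.sphere (0 : EuclideanSpace ℝ (Fin n)) 1 => Ω θ)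
      (sphereMeasure n) :=
  aestronglyMeasurable_sphere_of_homogeneous hn hΩ.aestronglyMeasurable
    fun _ _ hr ht => hΩ.apply_smul hr ht

lemma kernel_eq (t : EuclideanSpace ℝ (Fin n)) :
    kernel Ω α β t = osc (‖t‖ ^ (-β)) * Ω t / ((‖t‖ ^ (α + n) : ℝ) : ℂ) := rfl

lemma aestronglyMeasurable_kernel (hΩ : IsAdmissibleAngular Ω) :
    AEStronglyMeasurable (kernel Ω α β) volume := by
  have h1 : Measurable fun t : EuclideanSpace ℝ (Fin n) => osc (‖t‖ ^ (-β)) :=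
    continuous_osc.measurable.comp (by fun_prop)
  have h2 : Measurable fun t : EuclideanSpace ℝ (Fin n) => ((‖t‖ ^ (α + n) : ℝ) : ℂ)⁻¹ := by
    fun_prop
  exact (h1.aestronglyMeasurable.mul hΩ.aestronglyMeasurable).mul h2.aestronglyMeasurable

lemma norm_kernel_le {M : ℝ} (hM : ∀ t, t ≠ 0 → ‖Ω t‖ ≤ M) {t : EuclideanSpace ℝ (Fin n)}
    (ht : t ≠ 0) : ‖kernel Ω α β t‖ ≤ M * ‖t‖ ^ (-(α + n)) := by
  rw [kernel_eq, norm_div, norm_mul, norm_osc, one_mul, Complex.norm_real, Real.norm_eq_abs,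
    abs_of_nonneg (by positivity), Real.rpow_neg (norm_nonneg t), ← div_eq_mul_inv]
  gcongr
  exact hM t ht

/-- The kernel is integrable away from the origin. -/
lemma integrableOn_kernel (hn : 0 < n) (hΩ : IsAdmissibleAngular Ω) (hα : 0 < α) {ε : ℝ}
    (hε : 0 < ε) : IntegrableOn (kernel Ω α β) {t | ε < ‖t‖} := by
  obtain ⟨M, hM0, hM⟩ := hΩ.exists_bound
  have : Nonempty (Fin n) := ⟨⟨0, hn⟩⟩
  have hs : MeasurableSet {t : EuclideanSpace ℝ (Fin n) | ε < ‖t‖} :=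
    measurableSet_lt measurable_const measurable_norm
  have h1 : Integrable (fun t : EuclideanSpace ℝ (Fin n) =>
      (Set.Ioi ε).indicator (fun r : ℝ => M * r ^ (-(α + n))) ‖t‖) := by
    rw [integrable_fun_norm_addHaar volume (f := (Set.Ioi ε).indicator
      (fun r : ℝ => M * r ^ (-(α + n)))), finrank_euclideanSpace_fin]
    have h2 : IntegrableOn ((Set.Ioi ε).indicator fun r : ℝ => M * r ^ (-1 - α)) (Set.Ioi 0) :=
      ((integrable_indicator_iff measurableSet_Ioi).mpr
        ((integrableOn_Ioi_rpow_of_lt (a := -1 - α) (by linarith) hε).const_mul M)).integrableOn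
    refine h2.congr_fun (fun r hr => ?_) measurableSet_Ioi
    have hr0 : (0 : ℝ) < r := hr
    by_cases h : r ∈ Set.Ioi ε
    · rw [Set.indicator_of_mem h, Set.indicator_of_mem h, smul_eq_mul, mul_left_comm,
        ← Real.rpow_natCast, ← Real.rpow_add hr0]
      congr 2
      rw [Nat.cast_pred hn]; ring
    · rw [Set.indicator_of_notMem h, Set.indicator_of_notMem h, smul_zero]
  rw [← integrable_indicator_iff hs]
  refine h1.mono' ((aestronglyMeasurable_kernel hΩ).indicator hs) (ae_of_all _ fun t => ?_)
  by_cases h : ε < ‖t‖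
  · rw [Set.indicator_of_mem (by exact h), Set.indicator_of_mem (by exact h)]
    exact norm_kernel_le hM (norm_pos_iff.mp (hε.trans h))
  · rw [Set.indicator_of_notMem (by exact h), Set.indicator_of_notMem (by exact h), norm_zero]

/-- The spherical shell `a < |t| ≤ b`. -/
def shell (n : ℕ) (a b : ℝ) : Set (EuclideanSpace ℝ (Fin n)) := {t | a < ‖t‖ ∧ ‖t‖ ≤ b}

lemma measurableSet_shell (a b : ℝ) : MeasurableSet (shell n a b) :=
  (measurableSet_lt measurable_const measurable_norm).inter
    (measurableSet_le measurable_norm measurable_const)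

/-- A kernel of size `a^{-α-n}` on a set of volume `O(a^n)`. -/
lemma exists_integral_norm_kernel_shell_le (hn : 0 < n) (hΩ : IsAdmissibleAngular Ω) (hα : 0 < α) :
    ∃ C : ℝ, 0 < C ∧ ∀ a : ℝ, 0 < a →
      ∫ t in shell n a (2 * a), ‖kernel Ω α β t‖ ≤ C * a ^ (-α) := by
  obtain ⟨M, hM0, hM⟩ := hΩ.exists_bound
  have : Nonempty (Fin n) := ⟨⟨0, hn⟩⟩
  set v := (volume : Measure (EuclideanSpace ℝ (Fin n))).real (Metric.closedBall 0 1) with hv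
  have hv0 : 0 < v := by
    rw [hv, measureReal_def]
    exact ENNReal.toReal_pos (Metric.measure_closedBall_pos _ _ one_pos).ne'
      measure_closedBall_lt_top.ne
  refine ⟨M * 2 ^ n * v, by positivity, fun a ha => ?_⟩
  have hsub : shell n a (2 * a) ⊆ Metric.closedBall 0 (2 * a) := fun t ht => by
    rw [mem_closedBall_zero_iff]; exact ht.2
  have hfin : volume (shell n a (2 * a)) < ∞ :=
    (measure_mono hsub).trans_lt measure_closedBall_lt_top
  have hvol : volume.real (shell n a (2 * a)) ≤ (2 * a) ^ n * v := by
    refine (measureReal_mono hsub measure_closedBall_lt_top.ne).trans_eq ?_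
    rw [Measure.addHaar_real_closedBall' _ _ (by positivity), finrank_euclideanSpace_fin]
  have h1 : ∀ t ∈ shell n a (2 * a), ‖‖kernel Ω α β t‖‖ ≤ M * a ^ (-(α + n)) := by
    intro t ht
    rw [norm_norm]
    refine (norm_kernel_le hM (norm_pos_iff.mp (ha.trans ht.1))).trans ?_
    gcongr ?_ * ?_
    exact Real.rpow_le_rpow_of_nonpos ha ht.1.le (by
      have : (0 : ℝ) ≤ n := Nat.cast_nonneg n
      linarith)
  calc _ ≤ M * a ^ (-(α + n)) * volume.real (shell n a (2 * a)) :=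
        (le_abs_self _).trans (norm_setIntegral_le_of_norm_le_const hfin h1)
    _ ≤ M * a ^ (-(α + n)) * ((2 * a) ^ n * v) := by gcongr
    _ = _ := by
        rw [mul_pow, show -(α + n) = -α + -(n : ℝ) by ring, Real.rpow_add ha, Real.rpow_neg ha.le n,
          Real.rpow_natCast]
        field_simp

/-- The Jacobian `r^{n-1}` turns `|t|^{-α-n}` into `r^{-1-α}`, and `Ω`, constant along rays, leaves
the radial integral. -/
lemma integral_shell_mul_kernel (hn : 0 < n) (hΩ : IsAdmissibleAngular Ω) {a b : ℝ} (ha : 0 < a)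
    {g : EuclideanSpace ℝ (Fin n) → ℂ}
    (hg : IntegrableOn (fun t => g t * kernel Ω α β t) (shell n a b)) :
    ∫ t in shell n a b, g t * kernel Ω α β t =
      ∫ θ, Ω (θ : EuclideanSpace ℝ (Fin n)) * (∫ r in Set.Ioc a b,
        g (r • (θ : EuclideanSpace ℝ (Fin n))) * (osc (r ^ (-β)) * ((r ^ (-1 - α) : ℝ) : ℂ)))
        ∂(sphereMeasure n) := by
  have hs := measurableSet_shell (n := n) a b
  rw [← integral_indicator hs, integral_polar hn ((integrable_indicator_iff hs).mpr hg)]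
  congr 1; ext θ
  rw [← integral_const_mul, ← integral_indicator measurableSet_Ioi,
    ← integral_indicator measurableSet_Ioc]
  congr 1; ext r
  by_cases hr : 0 < r
  · rw [Set.indicator_of_mem (Set.mem_Ioi.mpr hr)]
    have hnorm := norm_smul_sphere θ hr
    by_cases h : r ∈ Set.Ioc a b
    · have hmem : r • (θ : EuclideanSpace ℝ (Fin n)) ∈ shell n a b := by
        rw [shell, Set.mem_ofPred_eq, hnorm]; exact h
      rw [Set.indicator_of_mem h, Set.indicator_of_mem hmem, kernel_eq, hnorm,
        hΩ.apply_smul hr (sphere_ne_zero θ), Complex.real_smul]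
      have e : ((r ^ (-1 - α) : ℝ) : ℂ) = ((r ^ (n - 1) : ℝ) : ℂ) / ((r ^ (α + n) : ℝ) : ℂ) := by
        rw [← Complex.ofReal_div]
        congr 1
        rw [← Real.rpow_natCast, ← Real.rpow_sub hr, Nat.cast_pred hn]
        congr 1; ring
      rw [e]
      ring
    · have hmem : r • (θ : EuclideanSpace ℝ (Fin n)) ∉ shell n a b := by
        rw [shell, Set.mem_ofPred_eq, hnorm]; exact h
      rw [Set.indicator_of_notMem h, Set.indicator_of_notMem hmem, smul_zero]
  · rw [Set.indicator_of_notMem (by simpa using hr), Set.indicator_of_notMem]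
    exact fun h => hr (ha.trans h.1)

/-- The first `n` coordinates of a point of `ℝ^{n+1}`. -/
def horizontal (ζ : EuclideanSpace ℝ (Fin (n + 1))) : EuclideanSpace ℝ (Fin n) :=
  WithLp.toLp 2 fun i => ζ i.castSucc

lemma inner_surface (t : EuclideanSpace ℝ (Fin n)) (ζ : EuclideanSpace ℝ (Fin (n + 1))) :
    inner ℝ (surface φ t) ζ = inner ℝ t (horizontal ζ) + ζ (Fin.last n) * φ ‖t‖ := by
  simp [surface, horizontal, PiLp.inner_apply, Fin.sum_univ_castSucc]

lemma measurable_surface (hφ : IsAdmissibleProfile φ k₁ k₂ k₃) :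
    Measurable (surface φ : EuclideanSpace ℝ (Fin n) → EuclideanSpace ℝ (Fin (n + 1))) := by
  have h1 : Measurable fun t : EuclideanSpace ℝ (Fin n) =>
      (Fin.snoc (α := fun _ => ℝ) (fun i => t i) (φ ‖t‖) : Fin (n + 1) → ℝ) := by
    rw [measurable_pi_iff]
    intro i
    refine Fin.lastCases ?_ (fun j => ?_) i
    · simpa using hφ.measurable_comp_norm
    · simp only [Fin.snoc_castSucc]
      fun_prop
  exact (by fun_prop : Measurable (WithLp.toLp 2 : (Fin (n + 1) → ℝ) → _)).comp h1

lemma integrableOn_osc_mul_kernel (hn : 0 < n) (hφ : IsAdmissibleProfile φ k₁ k₂ k₃)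
    (hΩ : IsAdmissibleAngular Ω) (hα : 0 < α) {a : ℝ} (ha : 0 < a) (b : ℝ)
    (ζ : EuclideanSpace ℝ (Fin (n + 1))) :
    IntegrableOn (fun t => osc (inner ℝ (surface φ t) ζ) * kernel Ω α β t) (shell n a b) := by
  have h : IntegrableOn (kernel Ω α β) (shell n a b) :=
    (integrableOn_kernel hn hΩ hα ha).mono_set fun t ht => ht.1
  exact h.bdd_mul (c := 1) (continuous_osc.measurable.comp
    ((measurable_surface hφ).inner measurable_const)).aestronglyMeasurable
    (ae_of_all _ fun t => (norm_osc _).le)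

lemma integral_osc_surface_mul_kernel (hn : 0 < n) (hφ : IsAdmissibleProfile φ k₁ k₂ k₃)
    (hΩ : IsAdmissibleAngular Ω) (hα : 0 < α) {a : ℝ} (ha : 0 < a)
    (ζ : EuclideanSpace ℝ (Fin (n + 1))) :
    ∫ t in shell n a (2 * a), osc (inner ℝ (surface φ t) ζ) * kernel Ω α β t =
      ∫ θ, Ω (θ : EuclideanSpace ℝ (Fin n)) * (∫ r in Set.Ioc a (2 * a),
        osc (r * inner ℝ (θ : EuclideanSpace ℝ (Fin n)) (horizontal ζ) + ζ (Fin.last n) * φ r +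
          r ^ (-β)) * ((r ^ (-1 - α) : ℝ) : ℂ)) ∂(sphereMeasure n) := by
  rw [integral_shell_mul_kernel hn hΩ ha (integrableOn_osc_mul_kernel hn hφ hΩ hα ha _ ζ)]
  congr 1; ext θ
  congr 1
  refine setIntegral_congr_fun measurableSet_Ioc fun r hr => ?_
  have hr0 := ha.trans hr.1
  simp only
  rw [inner_surface, norm_smul_sphere θ hr0, inner_smul_left, conj_trivial,
    osc_add (r * inner ℝ (θ : EuclideanSpace ℝ (Fin n)) (horizontal ζ) + ζ (Fin.last n) * φ r),
    mul_assoc]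

/-- The smallness of `ξ` bounds `θ·ξ` for every `θ` at once, so the radial estimate holds uniformly
on the sphere and no angular cancellation is needed. -/
lemma exists_norm_multiplier_le_of_small (hφ : IsAdmissibleProfile φ k₁ k₂ k₃) (hn : 0 < n)
    (hΩ : IsAdmissibleAngular Ω) (hα : 0 < α) (hβ : 0 < β) :
    ∃ C : ℝ, 0 ≤ C ∧ ∀ (a : ℝ) (ζ : EuclideanSpace ℝ (Fin (n + 1))), 0 < a → a ≤ 1 →
      ‖horizontal ζ‖ ≤ β / 2 * (2 * a) ^ (-(β + 1)) →
      ‖∫ t in shell n a (2 * a), osc (inner ℝ (surface φ t) ζ) * kernel Ω α β t‖ ≤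
        C * a ^ (-α + β / 2) := by
  obtain ⟨C, hC0, hC⟩ := exists_norm_integral_radial_le hφ hα hβ
  obtain ⟨M, hM0, hM⟩ := hΩ.exists_bound
  refine ⟨M * C * (sphereMeasure n).real Set.univ, by positivity, fun a ζ ha ha1 hζ => ?_⟩
  rw [integral_osc_surface_mul_kernel hn hφ hΩ hα ha]
  refine (norm_integral_le_of_norm_le_const (C := M * (C * a ^ (-α + β / 2)))
    (ae_of_all _ fun θ => ?_)).trans_eq (by ring)
  rw [norm_mul, ← intervalIntegral.integral_of_le (by linarith)]
  gcongr
  · exact hM _ (sphere_ne_zero θ)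
  · refine hC a _ _ ha ha1 ((abs_real_inner_le_norm _ _).trans ?_)
    rw [norm_eq_of_mem_sphere θ, one_mul]
    exact hζ

/-- The phases `η φ(r)` and `r^{-β}` do not involve `θ`. After exchanging the integrals they sit in
a factor `w` of modulus `r^{-1-α} ≤ a^{-1-α}`, and only the averaged decay of the transform on the
sphere is used. -/
lemma exists_norm_multiplier_le_of_large (hφ : IsAdmissibleProfile φ k₁ k₂ k₃) (hn : 2 ≤ n)
    (hΩ : IsAdmissibleAngular Ω) (hα : 0 < α) {κ : ℝ} (hκ0 : 0 < κ) (hκ1 : κ < 1) :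
    ∃ C : ℝ, 0 ≤ C ∧ ∀ (a : ℝ) (ζ : EuclideanSpace ℝ (Fin (n + 1))), 0 < a → horizontal ζ ≠ 0 →
      ‖∫ t in shell n a (2 * a), osc (inner ℝ (surface φ t) ζ) * kernel Ω α β t‖ ≤
        C * a ^ (-α) * (a * ‖horizontal ζ‖) ^ (-(κ / 2)) := by
  have hn0 : 0 < n := by omega
  obtain ⟨M, hM0, hM⟩ := hΩ.exists_bound
  have hΩm := hΩ.aestronglyMeasurable_sphere hn0
  have hΩM : ∀ θ : Metric.sphere (0 : EuclideanSpace ℝ (Fin n)) 1, ‖Ω θ‖ ≤ M := fun θ =>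
    hM _ (sphere_ne_zero θ)
  obtain ⟨C, hC0, hC⟩ := exists_integral_norm_sphereFourier_le hn hΩm hM0 hΩM hκ0 hκ1
  refine ⟨C, hC0, fun a ζ ha hζ => ?_⟩
  rw [integral_osc_surface_mul_kernel hn0 hφ hΩ hα ha]
  set ξ := horizontal ζ
  set η := ζ (Fin.last n)
  set w : ℝ → ℂ := fun r => osc (η * φ r + r ^ (-β)) * ((r ^ (-1 - α) : ℝ) : ℂ) with hw
  have hwc : ContinuousOn w (Set.Ioc a (2 * a)) := by
    have hpos : ∀ r ∈ Set.Ioc a (2 * a), 0 < r := fun r hr => ha.trans hr.1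
    refine ContinuousOn.mul (continuous_osc.comp_continuousOn (ContinuousOn.add
      (continuousOn_const.mul (hφ.continuousOn.mono hpos)) ?_))
      (Complex.continuous_ofReal.comp_continuousOn ?_)
    · exact continuousOn_id.rpow_const fun r hr => Or.inl (hpos r hr).ne'
    · exact continuousOn_id.rpow_const fun r hr => Or.inl (hpos r hr).ne'
  have hwm : AEStronglyMeasurable w (volume.restrict (Set.Ioc a (2 * a))) :=
    hwc.aestronglyMeasurable measurableSet_Ioc
  have hwb : ∀ r ∈ Set.Ioc a (2 * a), ‖w r‖ ≤ a ^ (-1 - α) := by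
    intro r hr
    have h0 := ha.trans hr.1
    rw [hw, norm_mul, norm_osc, one_mul, Complex.norm_real, Real.norm_eq_abs,
      abs_of_nonneg (by positivity)]
    exact Real.rpow_le_rpow_of_nonpos ha hr.1.le (by linarith)
  have e1 : ∫ θ, Ω (θ : EuclideanSpace ℝ (Fin n)) * (∫ r in Set.Ioc a (2 * a),
        osc (r * inner ℝ (θ : EuclideanSpace ℝ (Fin n)) ξ + η * φ r + r ^ (-β)) *
          ((r ^ (-1 - α) : ℝ) : ℂ)) ∂(sphereMeasure n) =
      ∫ r in Set.Ioc a (2 * a), w r * sphereFourier Ω ξ r := by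
    calc _ = ∫ θ, (∫ r in Set.Ioc a (2 * a), w r * (Ω (θ : EuclideanSpace ℝ (Fin n)) *
          osc (r * inner ℝ (θ : EuclideanSpace ℝ (Fin n)) ξ))) ∂(sphereMeasure n) := by
          congr 1; ext θ
          rw [← integral_const_mul]
          congr 1; ext r
          rw [hw, add_assoc, osc_add]
          ring
      _ = ∫ r in Set.Ioc a (2 * a), (∫ θ, w r * (Ω (θ : EuclideanSpace ℝ (Fin n)) *
          osc (r * inner ℝ (θ : EuclideanSpace ℝ (Fin n)) ξ)) ∂(sphereMeasure n)) := by
          apply integral_integral_swap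
          have hm := hwm.comp_fst.mul
            (aestronglyMeasurable_mul_osc hΩm (volume.restrict (Set.Ioc a (2 * a))) ξ)
          refine Integrable.of_bound (C := a ^ (-1 - α) * M) hm.prod_swap ?_
          have hae : ∀ᵐ z : Metric.sphere (0 : EuclideanSpace ℝ (Fin n)) 1 × ℝ
              ∂((sphereMeasure n).prod (volume.restrict (Set.Ioc a (2 * a)))),
              z.2 ∈ Set.Ioc a (2 * a) :=
            Measure.quasiMeasurePreserving_snd.ae (ae_restrict_mem measurableSet_Ioc)
          filter_upwards [hae] with z hz
          simp only [Function.uncurry]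
          have h1 : ‖Ω (z.1 : EuclideanSpace ℝ (Fin n)) *
              osc (z.2 * inner ℝ (z.1 : EuclideanSpace ℝ (Fin n)) ξ)‖ ≤ M := by
            rw [norm_mul, norm_osc, mul_one]
            exact hΩM _
          exact (norm_mul_le _ _).trans (mul_le_mul (hwb _ hz) h1 (norm_nonneg _) (by positivity))
      _ = _ := by
          congr 1; ext r
          rw [integral_const_mul, sphereFourier]
  have hSint : IntegrableOn (fun r => ‖sphereFourier Ω ξ r‖) (Set.Ioc a (2 * a)) := by
    refine Integrable.of_bound
      (aestronglyMeasurable_sphereFourier hΩm (volume.restrict (Set.Ioc a (2 * a))) ξ).norm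
      (M * (sphereMeasure n).real Set.univ) (ae_of_all _ fun r => ?_)
    rw [norm_norm]
    exact norm_sphereFourier_le hΩM ξ r
  rw [e1]
  calc _ ≤ ∫ r in Set.Ioc a (2 * a), a ^ (-1 - α) * ‖sphereFourier Ω ξ r‖ := by
        refine norm_integral_le_of_norm_le (hSint.const_mul _) ?_
        filter_upwards [ae_restrict_mem measurableSet_Ioc] with r hr
        rw [norm_mul]
        exact mul_le_mul_of_nonneg_right (hwb r hr) (norm_nonneg _)
    _ = a ^ (-1 - α) * ∫ r in Set.Ioc a (2 * a), ‖sphereFourier Ω ξ r‖ := integral_const_mul _ _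
    _ ≤ a ^ (-1 - α) * (C * a * (a * ‖ξ‖) ^ (-(κ / 2))) := by
        gcongr
        exact hC a ξ ha hζ
    _ = C * (a ^ (-1 - α) * a) * (a * ‖ξ‖) ^ (-(κ / 2)) := by ring
    _ = _ := by
        rw [← Real.rpow_add_one ha.ne', show -1 - α + 1 = -α by ring]

/-- The multiplier of a dyadic piece decays like `a^{-α + βκ/2}` for every `κ < 1`. -/
theorem exists_norm_multiplier_le (hφ : IsAdmissibleProfile φ k₁ k₂ k₃) (hn : 2 ≤ n)
    (hΩ : IsAdmissibleAngular Ω) (hα : 0 < α) (hβ : 0 < β) {κ : ℝ} (hκ0 : 0 < κ) (hκ1 : κ < 1) :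
    ∃ C : ℝ, 0 < C ∧ ∀ (a : ℝ) (ζ : EuclideanSpace ℝ (Fin (n + 1))), 0 < a → a ≤ 1 →
      ‖∫ t in shell n a (2 * a), osc (inner ℝ (surface φ t) ζ) * kernel Ω α β t‖ ≤
        C * a ^ (-α + β * κ / 2) := by
  obtain ⟨C₁, hC₁, h₁⟩ := exists_norm_multiplier_le_of_small hφ (by omega) hΩ hα hβ
  obtain ⟨C₂, hC₂, h₂⟩ := exists_norm_multiplier_le_of_large (β := β) hφ hn hΩ hα hκ0 hκ1
  -- With this `c`, failure of the small frequency condition reads `a‖ξ‖ > c a^{-β}`.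
  set c := β / 2 * 2 ^ (-(β + 1)) with hc
  have hc0 : 0 < c := by positivity
  -- The added `1` makes the constant strictly positive, as interpolation requires of the `L²`
  -- bound.
  refine ⟨C₁ + C₂ * c ^ (-(κ / 2)) + 1, by positivity, fun a ζ ha ha1 => ?_⟩
  have hcp : 0 < c ^ (-(κ / 2)) := by positivity
  have hap : 0 < a ^ (-α + β * κ / 2) := by positivity
  rcases le_or_gt ‖horizontal ζ‖ (β / 2 * (2 * a) ^ (-(β + 1))) with h | h
  · calc _ ≤ C₁ * a ^ (-α + β / 2) := h₁ a ζ ha ha1 h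
      _ ≤ C₁ * a ^ (-α + β * κ / 2) := by
          gcongr ?_ * ?_
          exact Real.rpow_le_rpow_of_exponent_ge ha ha1 (by nlinarith)
      _ ≤ _ := by
          gcongr
          have : 0 ≤ C₂ * c ^ (-(κ / 2)) := by positivity
          linarith
  · have hpos : 0 < β / 2 * (2 * a) ^ (-(β + 1)) := by positivity
    have hne : horizontal ζ ≠ 0 := norm_pos_iff.mp (hpos.trans h)
    have hlow : c * a ^ (-β) ≤ a * ‖horizontal ζ‖ := by
      calc c * a ^ (-β) = a * (β / 2 * (2 * a) ^ (-(β + 1))) := by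
            rw [hc, Real.mul_rpow two_pos.le ha.le, show -β = -(β + 1) + 1 by ring,
              Real.rpow_add_one ha.ne']
            ring
        _ ≤ _ := by gcongr
    calc _ ≤ C₂ * a ^ (-α) * (a * ‖horizontal ζ‖) ^ (-(κ / 2)) := h₂ a ζ ha hne
      _ ≤ C₂ * a ^ (-α) * (c * a ^ (-β)) ^ (-(κ / 2)) := by
          gcongr ?_ * ?_
          exact Real.rpow_le_rpow_of_nonpos (by positivity) hlow (by linarith)
      _ = C₂ * c ^ (-(κ / 2)) * a ^ (-α + β * κ / 2) := by
          rw [Real.mul_rpow hc0.le (by positivity), ← Real.rpow_mul ha.le, Real.rpow_add ha,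
            show -β * -(κ / 2) = β * κ / 2 by ring]
          ring
      _ ≤ _ := by
          gcongr
          linarith

end Multiplier

/-! ### Existence of the limit of the truncated integrals -/

section Limit

variable {n : ℕ} {φ : ℝ → ℝ} {k₁ k₂ k₃ : ℝ} {Ω : EuclideanSpace ℝ (Fin n) → ℂ} {α β : ℝ}

/-- The embedding of `ℝⁿ` into `ℝ^{n+1}` as a horizontal hyperplane. -/
def horizontalEmbedding (t : EuclideanSpace ℝ (Fin n)) : EuclideanSpace ℝ (Fin (n + 1)) :=
  WithLp.toLp 2 (Fin.snoc (α := fun _ => ℝ) (fun i => t i) 0)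

/-- The last vector of the standard basis of `ℝ^{n+1}`. -/
def verticalVector (n : ℕ) : EuclideanSpace ℝ (Fin (n + 1)) :=
  WithLp.toLp 2 (Fin.snoc (α := fun _ => ℝ) (fun _ : Fin n => 0) 1)

lemma norm_horizontalEmbedding (t : EuclideanSpace ℝ (Fin n)) : ‖horizontalEmbedding t‖ = ‖t‖ := by
  simp [horizontalEmbedding, EuclideanSpace.norm_eq, Fin.sum_univ_castSucc]

lemma norm_verticalVector : ‖verticalVector n‖ = 1 := by
  simp [verticalVector, EuclideanSpace.norm_eq, Fin.sum_univ_castSucc]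

lemma surface_smul_sphere (θ : Metric.sphere (0 : EuclideanSpace ℝ (Fin n)) 1) {r : ℝ}
    (hr : 0 < r) : surface φ (r • (θ : EuclideanSpace ℝ (Fin n))) =
      r • horizontalEmbedding (θ : EuclideanSpace ℝ (Fin n)) + φ r • verticalVector n := by
  rw [surface, norm_smul_sphere θ hr]
  ext i
  refine Fin.lastCases ?_ (fun j => ?_) i <;>
    simp [horizontalEmbedding, verticalVector]

lemma exists_schwartz_bounds {E : Type*} [NormedAddCommGroup E] [NormedSpace ℝ E] (f : 𝓢(E, ℂ)) :
    ∃ K : ℝ, 0 ≤ K ∧ (∀ y, ‖f y‖ ≤ K) ∧ ∀ y, ‖fderiv ℝ f y‖ ≤ K := by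
  set g := SchwartzMap.fderivCLM ℝ E ℂ f
  refine ⟨max ‖f.toBoundedContinuousFunction‖ ‖g.toBoundedContinuousFunction‖,
    (norm_nonneg _).trans (le_max_left _ _), fun y => ?_, fun y => ?_⟩
  · exact (f.toBoundedContinuousFunction.norm_coe_le_norm y).trans (le_max_left _ _)
  · exact (g.toBoundedContinuousFunction.norm_coe_le_norm y).trans (le_max_right _ _)

/-- Write `r^{-1-α} = (r^{-β})' · (-r^{β-α}/β)` and integrate by parts. The boundary terms are
`O(δ^{β-α})`, the new amplitude has derivative `O(r^{β-α-1})`, and the curve `r ↦ Γ(rθ)` has speed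
at most `1 + |φ'(1)|` for `r ≤ 1`. -/
lemma norm_integral_ray_le (hφ : IsAdmissibleProfile φ k₁ k₂ k₃) (hβ : 0 < β) (hαβ : α < β)
    (f : 𝓢(EuclideanSpace ℝ (Fin (n + 1)), ℂ)) {K : ℝ} (hK0 : 0 ≤ K) (hK : ∀ y, ‖f y‖ ≤ K)
    (hK' : ∀ y, ‖fderiv ℝ f y‖ ≤ K) (x : EuclideanSpace ℝ (Fin (n + 1)))
    (θ : Metric.sphere (0 : EuclideanSpace ℝ (Fin n)) 1) {ε δ : ℝ} (hε : 0 < ε) (hεδ : ε ≤ δ)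
    (hδ : δ ≤ 1) :
    ‖∫ r in Set.Ioc ε δ, f (x - surface φ (r • (θ : EuclideanSpace ℝ (Fin n)))) *
      (osc (r ^ (-β)) * ((r ^ (-1 - α) : ℝ) : ℂ))‖ ≤
      (2 * K / β + K * (1 + |deriv φ 1| + (β - α)) / β / (β - α)) * δ ^ (β - α) := by
  set v := horizontalEmbedding (θ : EuclideanSpace ℝ (Fin n))
  set e := verticalVector n
  set c : ℝ → EuclideanSpace ℝ (Fin (n + 1)) := fun r => x - (r • v + φ r • e)
  have hδ0 : 0 < δ := hε.trans_le hεδ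
  have hs : 0 < β - α := by linarith
  have hpos : ∀ r ∈ Set.Icc ε δ, 0 < r := fun r hr => hε.trans_le hr.1
  set h : ℝ → ℂ := fun r => f (c r) * ((-(1 / β) * r ^ (β - α) : ℝ) : ℂ) with hh
  set h' : ℝ → ℂ := fun r => fderiv ℝ f (c r) (-(v + deriv φ r • e)) *
      ((-(1 / β) * r ^ (β - α) : ℝ) : ℂ) +
    f (c r) * ((-(1 / β) * ((β - α) * r ^ (β - α - 1)) : ℝ) : ℂ) with hh'
  have hF : ∀ r ∈ Set.Icc ε δ, HasDerivAt (fun r : ℝ => r ^ (-β)) (-β * r ^ (-β - 1)) r :=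
    fun r hr => Real.hasDerivAt_rpow_const (Or.inl (hpos r hr).ne')
  have hF' : ContinuousOn (fun r : ℝ => -β * r ^ (-β - 1)) (Set.Icc ε δ) :=
    continuousOn_const.mul (continuousOn_id.rpow_const fun r hr => Or.inl (hpos r hr).ne')
  have hc : ∀ r ∈ Set.Icc ε δ, HasDerivAt c (-(v + deriv φ r • e)) r := fun r hr =>
    ((((hasDerivAt_id r).smul_const v).add
      ((hφ.hasDerivAt (hpos r hr)).smul_const e)).const_sub x).congr_deriv (by simp)
  have hcc : ContinuousOn c (Set.Icc ε δ) := fun r hr => (hc r hr).continuousAt.continuousWithinAt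
  have hhd : ∀ r ∈ Set.Icc ε δ, HasDerivAt h (h' r) r := fun r hr =>
    ((f.hasFDerivAt (c r)).comp_hasDerivAt r (hc r hr)).mul
      (((Real.hasDerivAt_rpow_const (p := β - α) (Or.inl (hpos r hr).ne')).const_mul
        (-(1 / β))).ofReal_comp)
  have hh'c : ContinuousOn h' (Set.Icc ε δ) := by
    have h1 : ContinuousOn (fun r => fderiv ℝ f (c r)) (Set.Icc ε δ) :=
      ((f.smooth 1).continuous_fderiv one_ne_zero).comp_continuousOn hcc
    have h2 : ContinuousOn (fun r => -(v + deriv φ r • e)) (Set.Icc ε δ) :=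
      (continuousOn_const.add ((hφ.continuousOn_deriv.mono hpos).smul continuousOn_const)).neg
    have h3 : ∀ q : ℝ, ContinuousOn (fun r : ℝ => r ^ q) (Set.Icc ε δ) := fun q =>
      continuousOn_id.rpow_const fun r hr => Or.inl (hpos r hr).ne'
    refine ContinuousOn.add ((h1.clm_apply h2).mul (Complex.continuous_ofReal.comp_continuousOn
      (continuousOn_const.mul (h3 _)))) ((f.continuous.comp_continuousOn hcc).mul
        (Complex.continuous_ofReal.comp_continuousOn
          (continuousOn_const.mul (continuousOn_const.mul (h3 _)))))
  have key := norm_integral_osc_mul_deriv_le hεδ hF hF' hhd hh'c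
  have e1 : ∫ r in ε..δ, osc (r ^ (-β)) * (((-β * r ^ (-β - 1) : ℝ) : ℂ) * h r) =
      ∫ r in Set.Ioc ε δ, f (x - surface φ (r • (θ : EuclideanSpace ℝ (Fin n)))) *
      (osc (r ^ (-β)) * ((r ^ (-1 - α) : ℝ) : ℂ)) := by
    rw [intervalIntegral.integral_of_le hεδ]
    refine setIntegral_congr_fun measurableSet_Ioc fun r hr => ?_
    have h0 : 0 < r := hε.trans hr.1
    have e2 : ((r ^ (-1 - α) : ℝ) : ℂ) =
        ((-β * r ^ (-β - 1) : ℝ) : ℂ) * ((-(1 / β) * r ^ (β - α) : ℝ) : ℂ) := by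
      rw [← Complex.ofReal_mul]
      congr 1
      rw [show -1 - α = (-β - 1) + (β - α) by ring, Real.rpow_add h0]
      field_simp
    simp only [hh]
    rw [surface_smul_sphere θ h0, e2]
    ring
  rw [e1] at key
  refine key.trans ?_
  have hend : ∀ r ∈ Set.Icc ε δ, ‖h r‖ ≤ K / β * δ ^ (β - α) := by
    intro r hr
    have h0 := hpos r hr
    rw [hh, norm_mul, Complex.norm_real, Real.norm_eq_abs, abs_mul, abs_neg,
      abs_of_pos (by positivity : 0 < 1 / β), abs_of_nonneg (by positivity)]
    calc _ ≤ K * (1 / β * δ ^ (β - α)) := by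
          gcongr
          · exact hK _
          · exact hr.2
      _ = _ := by ring
  set D := K * (1 + |deriv φ 1| + (β - α)) / β with hD
  have hder : ∀ r ∈ Set.Icc ε δ, ‖h' r‖ ≤ D * r ^ (β - α - 1) := by
    intro r hr
    have h0 := hpos r hr
    have hr1 : r ≤ 1 := hr.2.trans hδ
    have hv : ‖-(v + deriv φ r • e)‖ ≤ 1 + |deriv φ 1| := by
      rw [norm_neg]
      refine (norm_add_le _ _).trans ?_
      rw [norm_horizontalEmbedding, norm_eq_of_mem_sphere θ, norm_smul, norm_verticalVector,
        mul_one, Real.norm_eq_abs]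
      exact add_le_add le_rfl (hφ.abs_deriv_mono h0 hr1)
    have hrr : r ^ (β - α) ≤ r ^ (β - α - 1) :=
      Real.rpow_le_rpow_of_exponent_ge h0 hr1 (by linarith)
    have t1 : ‖fderiv ℝ f (c r) (-(v + deriv φ r • e)) * ((-(1 / β) * r ^ (β - α) : ℝ) : ℂ)‖ ≤
        K * (1 + |deriv φ 1|) * (1 / β * r ^ (β - α - 1)) := by
      rw [norm_mul, Complex.norm_real, Real.norm_eq_abs, abs_mul, abs_neg,
        abs_of_pos (by positivity : 0 < 1 / β), abs_of_nonneg (by positivity : 0 ≤ r ^ (β - α))]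
      gcongr
      exact (ContinuousLinearMap.le_opNorm _ _).trans (by gcongr; exact hK' _)
    have t2 : ‖f (c r) * ((-(1 / β) * ((β - α) * r ^ (β - α - 1)) : ℝ) : ℂ)‖ ≤
        K * (1 / β * ((β - α) * r ^ (β - α - 1))) := by
      rw [norm_mul, Complex.norm_real, Real.norm_eq_abs, abs_mul, abs_neg,
        abs_of_pos (by positivity : 0 < 1 / β), abs_of_nonneg (by positivity)]
      gcongr
      exact hK _
    refine (norm_add_le _ _).trans ((add_le_add t1 t2).trans_eq ?_)
    rw [hD]; ring
  have hD0 : 0 ≤ D := by positivity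
  have hint : ∫ r in ε..δ, ‖h' r‖ ≤ D / (β - α) * δ ^ (β - α) := by
    have hrp : IntervalIntegrable (fun r : ℝ => r ^ (β - α - 1)) volume ε δ :=
      intervalIntegral.intervalIntegrable_rpow' (by linarith)
    calc _ ≤ ∫ r in ε..δ, D * r ^ (β - α - 1) := by
          refine intervalIntegral.integral_mono_on hεδ ?_ (hrp.const_mul D) hder
          apply ContinuousOn.intervalIntegrable
          rw [Set.uIcc_of_le hεδ]
          exact hh'c.norm
      _ = D * ((δ ^ (β - α) - ε ^ (β - α)) / (β - α)) := by
          rw [intervalIntegral.integral_const_mul, integral_rpow (Or.inl (by linarith)),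
            sub_add_cancel]
      _ ≤ D * (δ ^ (β - α) / (β - α)) := by
          gcongr
          have : 0 ≤ ε ^ (β - α) := by positivity
          linarith
      _ = _ := by ring
  have h1 := hend ε (Set.left_mem_Icc.mpr hεδ)
  have h2 := hend δ (Set.right_mem_Icc.mpr hεδ)
  calc _ ≤ K / β * δ ^ (β - α) + K / β * δ ^ (β - α) + D / (β - α) * δ ^ (β - α) := by linarith
    _ = _ := by ring

lemma integrableOn_integrand (hn : 0 < n) (hφ : IsAdmissibleProfile φ k₁ k₂ k₃)
    (hΩ : IsAdmissibleAngular Ω) (hα : 0 < α) (f : 𝓢(EuclideanSpace ℝ (Fin (n + 1)), ℂ))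
    (x : EuclideanSpace ℝ (Fin (n + 1))) {ε : ℝ} (hε : 0 < ε) :
    IntegrableOn (integrand φ Ω α β f x) {t | ε < ‖t‖} := by
  obtain ⟨K, -, hK, -⟩ := exists_schwartz_bounds f
  exact integrable_translate_mul (measurable_surface hφ) (integrableOn_kernel hn hΩ hα hε)
    f.continuous.measurable hK x

lemma setOf_lt_norm_eq_union {ε δ : ℝ} (hεδ : ε ≤ δ) :
    {t : EuclideanSpace ℝ (Fin n) | ε < ‖t‖} = shell n ε δ ∪ {t | δ < ‖t‖} := by
  ext t
  simp only [shell, Set.mem_ofPred_eq, Set.mem_union]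
  constructor
  · intro h
    rcases le_or_gt ‖t‖ δ with h' | h'
    · exact Or.inl ⟨h, h'⟩
    · exact Or.inr h'
  · rintro (h | h)
    · exact h.1
    · exact hεδ.trans_lt h

lemma truncated_eq_add (hn : 0 < n) (hφ : IsAdmissibleProfile φ k₁ k₂ k₃)
    (hΩ : IsAdmissibleAngular Ω) (hα : 0 < α) (f : 𝓢(EuclideanSpace ℝ (Fin (n + 1)), ℂ))
    (x : EuclideanSpace ℝ (Fin (n + 1))) {ε δ : ℝ} (hε : 0 < ε) (hεδ : ε ≤ δ) :
    truncated φ Ω α β ε f x =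
      (∫ t in shell n ε δ, integrand φ Ω α β f x t) + truncated φ Ω α β δ f x := by
  have hi := integrableOn_integrand (β := β) hn hφ hΩ hα f x hε
  rw [truncated, truncated, setOf_lt_norm_eq_union hεδ]
  rw [setOf_lt_norm_eq_union hεδ] at hi
  refine setIntegral_union ?_ (measurableSet_lt measurable_const measurable_norm)
    (hi.mono_set Set.subset_union_left) (hi.mono_set Set.subset_union_right)
  rw [Set.disjoint_left]
  intro t h1 h2
  exact absurd h1.2 (not_le.mpr h2)

lemma exists_norm_truncated_sub_le (hn : 0 < n) (hφ : IsAdmissibleProfile φ k₁ k₂ k₃)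
    (hΩ : IsAdmissibleAngular Ω) (hα : 0 < α) (hαβ : α < β)
    (f : 𝓢(EuclideanSpace ℝ (Fin (n + 1)), ℂ)) (x : EuclideanSpace ℝ (Fin (n + 1))) :
    ∃ C : ℝ, 0 ≤ C ∧ ∀ ε δ : ℝ, 0 < ε → ε ≤ δ → δ ≤ 1 →
      ‖truncated φ Ω α β ε f x - truncated φ Ω α β δ f x‖ ≤ C * δ ^ (β - α) := by
  have hβ : 0 < β := hα.trans hαβ
  obtain ⟨K, hK0, hK, hK'⟩ := exists_schwartz_bounds f
  obtain ⟨M, hM0, hM⟩ := hΩ.exists_bound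
  set D := 2 * K / β + K * (1 + |deriv φ 1| + (β - α)) / β / (β - α) with hD
  have hD0 : 0 ≤ D := by
    have : 0 < β - α := by linarith
    positivity
  refine ⟨M * D * (sphereMeasure n).real Set.univ, by positivity, fun ε δ hε hεδ hδ => ?_⟩
  rw [truncated_eq_add hn hφ hΩ hα f x hε hεδ, add_sub_cancel_right]
  have hi : IntegrableOn (fun t => f (x - surface φ t) * kernel Ω α β t) (shell n ε δ) :=
    (integrableOn_integrand hn hφ hΩ hα f x hε).mono_set fun t ht => ht.1
  have e := integral_shell_mul_kernel hn hΩ hε hi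
  simp only [integrand]
  rw [e]
  refine (norm_integral_le_of_norm_le_const (C := M * (D * δ ^ (β - α)))
    (ae_of_all _ fun θ => ?_)).trans_eq (by ring)
  rw [norm_mul]
  gcongr
  · exact hM _ (sphere_ne_zero θ)
  · exact norm_integral_ray_le hφ hβ hαβ f hK0 hK hK' x θ hε hεδ hδ

/-- The ray estimate, integrated over the sphere, bounds the difference of two truncations by `C
δ^{β-α}`; completeness of `ℂ` gives the limit. -/
theorem isWellDefined (hn : 0 < n) (hφ : IsAdmissibleProfile φ k₁ k₂ k₃)
    (hΩ : IsAdmissibleAngular Ω) (hα : 0 < α) (hαβ : α < β) : IsWellDefined φ Ω α β := by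
  intro f x
  refine ⟨fun ε hε => integrableOn_integrand hn hφ hΩ hα f x hε, ?_⟩
  apply tendsto_nhds_limUnder
  rw [← cauchy_map_iff_exists_tendsto]
  obtain ⟨C, hC0, hC⟩ := exists_norm_truncated_sub_le hn hφ hΩ hα hαβ f x
  have hs : 0 < β - α := by linarith
  rw [Metric.cauchy_iff]
  refine ⟨inferInstance, fun η hη => ?_⟩
  have hlim : Tendsto (fun d : ℝ => C * d ^ (β - α)) (𝓝[>] 0) (𝓝 0) := by
    have h1 : Tendsto (fun d : ℝ => C * d ^ (β - α)) (𝓝 0) (𝓝 (C * 0 ^ (β - α))) :=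
      ((Real.continuousAt_rpow_const 0 (β - α) (Or.inr hs.le)).tendsto).const_mul C
    rw [Real.zero_rpow hs.ne', mul_zero] at h1
    exact h1.mono_left nhdsWithin_le_nhds
  have hev : ∀ᶠ d in 𝓝[>] (0 : ℝ), d ∈ Set.Ioi (0 : ℝ) ∧ d ≤ 1 ∧ C * d ^ (β - α) < η := by
    filter_upwards [self_mem_nhdsWithin, hlim.eventually (gt_mem_nhds hη),
      mem_nhdsWithin_of_mem_nhds (Iic_mem_nhds (zero_lt_one' ℝ))] with d h1 h2 h3
    exact ⟨h1, h3, h2⟩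
  obtain ⟨d, hd0, hd1, hd⟩ := hev.exists
  refine ⟨(fun ε => truncated φ Ω α β ε f x) '' Set.Ioo 0 d,
    image_mem_map (Ioo_mem_nhdsGT hd0), ?_⟩
  have hmain : ∀ u ∈ Set.Ioo 0 d, ∀ w ∈ Set.Ioo 0 d, u ≤ w →
      dist (truncated φ Ω α β u f x) (truncated φ Ω α β w f x) < η := by
    intro u hu w hw huw
    rw [dist_eq_norm]
    refine (hC u w hu.1 huw (hw.2.le.trans hd1)).trans_lt (lt_of_le_of_lt ?_ hd)
    gcongr
    · exact hw.1.le
    · exact hw.2.le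
  rintro _ ⟨u, hu, rfl⟩ _ ⟨w, hw, rfl⟩
  rcases le_total u w with h | h
  · exact hmain u hu w hw h
  · rw [dist_comm]; exact hmain w hw u hu h

end Limit

/-! ### Interpolation in terms of `L^p` norms. -/

section Interpolation

variable {Y : Type*} [MeasurableSpace Y] {μ : Measure Y}

lemma eLpNorm_ofReal_eq {p : ℝ} (hp : 0 < p) (f : Y → ℂ) :
    eLpNorm f (ENNReal.ofReal p) μ = (∫⁻ y, ENNReal.ofReal (‖f y‖ ^ p) ∂μ) ^ (1 / p) := by
  rw [eLpNorm_eq_lintegral_rpow_enorm_toReal (by simpa using hp) ENNReal.ofReal_ne_top,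
    ENNReal.toReal_ofReal hp.le]
  congr 1
  refine lintegral_congr fun y => ?_
  rw [← ENNReal.ofReal_rpow_of_nonneg (norm_nonneg _) hp.le, ofReal_norm]

lemma eLpNorm_le_of_lintegral_le {p c : ℝ} (hp : 0 < p) (hc : 0 ≤ c) {f g : Y → ℂ}
    (h : ∫⁻ y, ENNReal.ofReal (‖g y‖ ^ p) ∂μ ≤
      ENNReal.ofReal c * ∫⁻ y, ENNReal.ofReal (‖f y‖ ^ p) ∂μ) :
    eLpNorm g (ENNReal.ofReal p) μ ≤
      ENNReal.ofReal (c ^ (1 / p)) * eLpNorm f (ENNReal.ofReal p) μ := by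
  have h1 : 0 ≤ 1 / p := by positivity
  rw [eLpNorm_ofReal_eq hp, eLpNorm_ofReal_eq hp, ← ENNReal.ofReal_rpow_of_nonneg hc h1,
    ← ENNReal.mul_rpow_of_nonneg _ _ h1]
  exact ENNReal.rpow_le_rpow h h1

/-- Interpolation between the `L¹`, `L²` and `L^∞` bounds, with the exponent of the `L²` bound
explicit. -/
theorem exists_eLpNorm_le_of_isInterpolable [SFinite μ] {p : ℝ} (hp : 1 < p) :
    ∃ K : ℝ, 0 < K ∧ ∀ (T : (Y → ℂ) → Y → ℂ) (A B : ℝ), 0 < A → 0 < B → IsInterpolable μ T A B →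
      ∀ f, IsTestFunction μ f → eLpNorm (T f) (ENNReal.ofReal p) μ ≤
        ENNReal.ofReal (K * (A ^ (1 - min (2 - 2 / p) (2 / p)) * B ^ (min (2 - 2 / p) (2 / p)))) *
          eLpNorm f (ENNReal.ofReal p) μ := by
  have hp0 : 0 < p := by linarith
  have key : ∀ K₀ A B u v : ℝ, 0 ≤ K₀ → 0 < A → 0 < B →
      (K₀ * (A ^ u * B ^ v)) ^ (1 / p) = K₀ ^ (1 / p) * (A ^ (u / p) * B ^ (v / p)) := by
    intro K₀ A B u v hK hA hB
    rw [Real.mul_rpow hK (by positivity), Real.mul_rpow (by positivity) (by positivity),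
      ← Real.rpow_mul hA.le, ← Real.rpow_mul hB.le, mul_one_div, mul_one_div]
  rcases lt_trichotomy p 2 with h | h | h
  -- The exponent `s` of the `L²` norm is determined by `1/p = (1 - s) + s/2` for `p < 2`, and by
  -- `1/p = s/2` for `p > 2`.
  · have hs : min (2 - 2 / p) (2 / p) = 2 - 2 / p := by
      apply min_eq_left
      rw [sub_le_iff_le_add, ← add_div, le_div_iff₀ hp0]; linarith
    have hK : 0 < p * (2 / (p - 1) + 4 / (2 - p)) := by
      have h1 : 0 < p - 1 := by linarith
      have h2 : 0 < 2 - p := by linarith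
      positivity
    refine ⟨(p * (2 / (p - 1) + 4 / (2 - p))) ^ (1 / p), by positivity,
      fun T A B hA hB hT f hf => ?_⟩
    have h1 := eLpNorm_le_of_lintegral_le hp0 (by positivity)
      (hT.lintegral_rpow_le_of_lt_two hA hB hp h hf)
    rwa [key _ _ _ _ _ hK.le hA hB, show (2 - p) / p = 1 - (2 - 2 / p) by field_simp; ring,
      show 2 * (p - 1) / p = 2 - 2 / p by field_simp, ← hs] at h1
  · subst h
    refine ⟨1, one_pos, fun T A B hA hB hT f hf => ?_⟩
    have h1 := eLpNorm_le_of_lintegral_le hp0 (by positivity) (hT.bound_two f hf)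
    rw [← Real.rpow_natCast B 2, ← Real.rpow_mul hB.le] at h1
    norm_num at h1 ⊢
    exact h1
  · have hs : min (2 - 2 / p) (2 / p) = 2 / p := by
      apply min_eq_right
      rw [le_sub_iff_add_le, ← add_div, div_le_iff₀ hp0]; linarith
    have hK : 0 < p * (4 / (p - 2)) * 4 ^ (p - 2) := by
      have h1 : 0 < p - 2 := by linarith
      positivity
    refine ⟨(p * (4 / (p - 2)) * 4 ^ (p - 2)) ^ (1 / p), by positivity,
      fun T A B hA hB hT f hf => ?_⟩
    have h1 := eLpNorm_le_of_lintegral_le hp0 (by positivity)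
      (hT.lintegral_rpow_le_of_two_lt hA hB h hf)
    rwa [key _ _ _ _ _ hK.le hA hB, show (p - 2) / p = 1 - 2 / p by field_simp, ← hs] at h1

end Interpolation

/-! ### Summation of the dyadic pieces, passage to the limit and extension to `L^p`. -/

section Bounds

variable {n : ℕ} {φ : ℝ → ℝ} {k₁ k₂ k₃ : ℝ} {Ω : EuclideanSpace ℝ (Fin n) → ℂ} {α β p : ℝ}

/-- Interpolating `a^{-α}` with `a^{-α+βκ/2}` at weight `s` gives `a^{-α+κβs/2}`, whose exponent is
positive for `κ` close enough to `1`. -/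
lemma exists_eLpNorm_shell_le (hφ : IsAdmissibleProfile φ k₁ k₂ k₃) (hn : 2 ≤ n)
    (hΩ : IsAdmissibleAngular Ω) (hα : 0 < α) (hβ : 0 < β) (hp : 1 < p)
    (hs : 2 * α < β * min (2 - 2 / p) (2 / p)) :
    ∃ D e : ℝ, 0 < D ∧ 0 < e ∧ ∀ (a : ℝ), 0 < a → a ≤ 1 →
      ∀ f : 𝓢(EuclideanSpace ℝ (Fin (n + 1)), ℂ),
        eLpNorm (fun x => ∫ t in shell n a (2 * a), integrand φ Ω α β f x t)
            (ENNReal.ofReal p) volume ≤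
          ENNReal.ofReal (D * a ^ e) * eLpNorm f (ENNReal.ofReal p) volume := by
  have hn0 : 0 < n := by omega
  obtain ⟨K, hK0, hK⟩ := exists_eLpNorm_le_of_isInterpolable
    (μ := (volume : Measure (EuclideanSpace ℝ (Fin (n + 1))))) hp
  set s := min (2 - 2 / p) (2 / p) with hsdef
  have hs0 : 0 < s := pos_of_mul_pos_right (by linarith : 0 < β * s) hβ.le
  -- Any `κ` strictly between `2α/(βs)` and `1`.
  obtain ⟨κ, hκ, hκ1⟩ := exists_between ((div_lt_one (by positivity)).mpr hs)
  have hκ0 : 0 < κ := lt_trans (by positivity) hκ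
  rw [div_lt_iff₀ (by positivity)] at hκ
  obtain ⟨C₁, hC₁, h₁⟩ := exists_integral_norm_kernel_shell_le (β := β) hn0 hΩ hα
  obtain ⟨C₂, hC₂, h₂⟩ := exists_norm_multiplier_le hφ hn hΩ hα hβ hκ0 hκ1
  refine ⟨K * (C₁ ^ (1 - s) * C₂ ^ s), -α + κ * (β * s) / 2, by positivity, by linarith,
    fun a ha ha1 f => ?_⟩
  have hint : IntegrableOn (kernel Ω α β) (shell n a (2 * a)) :=
    (integrableOn_kernel hn0 hΩ hα ha).mono_set fun t ht => ht.1
  have hT := isInterpolable_translOp (measurable_surface hφ) hint (h₁ a ha)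
    (fun ζ => h₂ a ζ ha ha1)
  refine (hK _ _ _ (by positivity) (by positivity) hT f (isTestFunction_schwartz f)).trans_eq ?_
  congr 2
  rw [Real.mul_rpow hC₁.le (by positivity), Real.mul_rpow hC₂.le (by positivity),
    ← Real.rpow_mul ha.le, ← Real.rpow_mul ha.le,
    show -α + κ * (β * s) / 2 = -α * (1 - s) + (-α + β * κ / 2) * s by ring, Real.rpow_add ha]
  ring

/-- Away from the origin the kernel is integrable, and its `L¹` norm bounds the multiplier too. The
constant is increased by `1` to be positive. -/
lemma exists_eLpNorm_truncated_one_le (hφ : IsAdmissibleProfile φ k₁ k₂ k₃) (hn : 0 < n)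
    (hΩ : IsAdmissibleAngular Ω) (hα : 0 < α) (hp : 1 < p) :
    ∃ D : ℝ, 0 < D ∧ ∀ f : 𝓢(EuclideanSpace ℝ (Fin (n + 1)), ℂ),
      eLpNorm (truncated φ Ω α β 1 f) (ENNReal.ofReal p) volume ≤
        ENNReal.ofReal D * eLpNorm f (ENNReal.ofReal p) volume := by
  obtain ⟨K, hK0, hK⟩ := exists_eLpNorm_le_of_isInterpolable
    (μ := (volume : Measure (EuclideanSpace ℝ (Fin (n + 1))))) hp
  have hint : IntegrableOn (kernel Ω α β) {t | 1 < ‖t‖} := integrableOn_kernel hn hΩ hα one_pos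
  set A := (∫ t in {t | 1 < ‖t‖}, ‖kernel Ω α β t‖) + 1 with hA
  have hle : ∫ t in {t | 1 < ‖t‖}, ‖kernel Ω α β t‖ ≤ A := by linarith
  have hA0 : 0 < A := by
    have : 0 ≤ ∫ t in {t | 1 < ‖t‖}, ‖kernel Ω α β t‖ := integral_nonneg fun _ => norm_nonneg _
    linarith
  have hT := isInterpolable_translOp (measurable_surface hφ) hint hle (B := A) fun ζ =>
    (norm_integral_le_integral_norm _).trans (by simpa only [norm_mul, norm_osc, one_mul] using hle)
  exact ⟨_, by positivity, fun f => hK _ _ _ hA0 hA0 hT f (isTestFunction_schwartz f)⟩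

lemma aestronglyMeasurable_truncated (hφ : IsAdmissibleProfile φ k₁ k₂ k₃) (hn : 0 < n)
    (hΩ : IsAdmissibleAngular Ω) (hα : 0 < α) {ε : ℝ} (hε : 0 < ε)
    (f : 𝓢(EuclideanSpace ℝ (Fin (n + 1)), ℂ)) :
    AEStronglyMeasurable (truncated φ Ω α β ε f) volume :=
  aestronglyMeasurable_translOp (measurable_surface hφ) (integrableOn_kernel hn hΩ hα hε)
    f.continuous.measurable

/-- Each halving of the truncation radius adds one shell with norm `≤ D q^{J+1}`, where `q = 2^{-e}
< 1`. The geometric series makes the bound uniform in `J`. -/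
lemma exists_eLpNorm_truncated_le (hφ : IsAdmissibleProfile φ k₁ k₂ k₃) (hn : 2 ≤ n)
    (hΩ : IsAdmissibleAngular Ω) (hα : 0 < α) (hβ : 0 < β) (hp : 1 < p)
    (hs : 2 * α < β * min (2 - 2 / p) (2 / p)) :
    ∃ C : ℝ, 0 < C ∧ ∀ (J : ℕ) (f : 𝓢(EuclideanSpace ℝ (Fin (n + 1)), ℂ)),
      eLpNorm (truncated φ Ω α β ((1 / 2) ^ J) f) (ENNReal.ofReal p) volume ≤
        ENNReal.ofReal C * eLpNorm f (ENNReal.ofReal p) volume := by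
  have hn0 : 0 < n := by omega
  obtain ⟨D, e, hD, he, hshell⟩ := exists_eLpNorm_shell_le hφ hn hΩ hα hβ hp hs
  obtain ⟨D₀, hD₀, hone⟩ := exists_eLpNorm_truncated_one_le (β := β) hφ hn0 hΩ hα hp
  set q : ℝ := (1 / 2) ^ e with hq
  have hq0 : 0 < q := by positivity
  have hq1 : q < 1 := Real.rpow_lt_one (by norm_num) (by norm_num) he
  have hsum : Summable fun j : ℕ => q ^ j := summable_geometric_of_lt_one hq0.le hq1
  have hp' : 1 ≤ ENNReal.ofReal p := by
    rw [← ENNReal.ofReal_one]; exact ENNReal.ofReal_le_ofReal hp.le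
  have hpart : ∀ (J : ℕ) (f : 𝓢(EuclideanSpace ℝ (Fin (n + 1)), ℂ)),
      eLpNorm (truncated φ Ω α β ((1 / 2) ^ J) f) (ENNReal.ofReal p) volume ≤
        ENNReal.ofReal (D₀ + D * ∑ j ∈ Finset.range J, q ^ (j + 1)) *
          eLpNorm f (ENNReal.ofReal p) volume := by
    intro J f
    induction J with
    | zero => simpa using hone f
    | succ J ih =>
      set a : ℝ := (1 / 2) ^ (J + 1) with ha
      have ha0 : 0 < a := by positivity
      have ha1 : a ≤ 1 := pow_le_one₀ (by norm_num) (by norm_num)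
      have h2a : (1 / 2 : ℝ) ^ J = 2 * a := by rw [ha, pow_succ]; ring
      have hae : a ^ e = q ^ (J + 1) := by
        rw [ha, hq, ← Real.rpow_natCast, ← Real.rpow_natCast, ← Real.rpow_mul (by norm_num),
          ← Real.rpow_mul (by norm_num), mul_comm]
      have heq : truncated φ Ω α β a f =
          (fun x => ∫ t in shell n a (2 * a), integrand φ Ω α β f x t) +
            truncated φ Ω α β ((1 / 2) ^ J) f := by
        ext x
        rw [h2a, Pi.add_apply]
        exact truncated_eq_add hn0 hφ hΩ hα f x ha0 (by linarith)
      have hint : IntegrableOn (kernel Ω α β) (shell n a (2 * a)) :=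
        (integrableOn_kernel hn0 hΩ hα ha0).mono_set fun t ht => ht.1
      rw [heq]
      refine (eLpNorm_add_le
        (aestronglyMeasurable_translOp (measurable_surface hφ) hint f.continuous.measurable)
        (aestronglyMeasurable_truncated hφ hn0 hΩ hα (by positivity) f) hp').trans ?_
      refine (add_le_add (hshell a ha0 ha1 f) ih).trans_eq ?_
      rw [← add_mul, ← ENNReal.ofReal_add (by positivity) (by positivity), hae,
        Finset.sum_range_succ]
      congr 2
      ring
  refine ⟨D₀ + D * ∑' j : ℕ, q ^ j, by positivity, fun J f => (hpart J f).trans ?_⟩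
  gcongr
  refine (Finset.sum_le_sum fun j _ => ?_).trans
    (hsum.sum_le_tsum (Finset.range J) fun j _ => by positivity)
  exact pow_le_pow_of_le_one hq0.le hq1.le (Nat.le_succ j)

lemma tendsto_truncated_half_pow (hw : IsWellDefined φ Ω α β)
    (f : 𝓢(EuclideanSpace ℝ (Fin (n + 1)), ℂ)) (x : EuclideanSpace ℝ (Fin (n + 1))) :
    Tendsto (fun J : ℕ => truncated φ Ω α β ((1 / 2) ^ J) f x) atTop
      (𝓝 (hypersingular φ Ω α β f x)) :=
  (hw f x).2.comp (tendsto_nhdsWithin_iff.mpr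
    ⟨tendsto_pow_atTop_nhds_zero_of_lt_one (by norm_num) (by norm_num),
      Eventually.of_forall fun J => by simp⟩)

lemma aestronglyMeasurable_hypersingular (hw : IsWellDefined φ Ω α β)
    (hφ : IsAdmissibleProfile φ k₁ k₂ k₃) (hn : 0 < n)
    (hΩ : IsAdmissibleAngular Ω) (hα : 0 < α) (f : 𝓢(EuclideanSpace ℝ (Fin (n + 1)), ℂ)) :
    AEStronglyMeasurable (hypersingular φ Ω α β f) volume :=
  aestronglyMeasurable_of_tendsto_ae atTop
    (fun J : ℕ => aestronglyMeasurable_truncated hφ hn hΩ hα (by positivity) f)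
    (ae_of_all _ fun x => tendsto_truncated_half_pow hw f x)

lemma exists_eLpNorm_hypersingular_le (hw : IsWellDefined φ Ω α β)
    (hφ : IsAdmissibleProfile φ k₁ k₂ k₃) (hn : 2 ≤ n)
    (hΩ : IsAdmissibleAngular Ω) (hα : 0 < α) (hβ : 0 < β) (hp : 1 < p)
    (hs : 2 * α < β * min (2 - 2 / p) (2 / p)) :
    ∃ C : ℝ, 0 < C ∧ ∀ f : 𝓢(EuclideanSpace ℝ (Fin (n + 1)), ℂ),
      eLpNorm (hypersingular φ Ω α β f) (ENNReal.ofReal p) volume ≤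
        ENNReal.ofReal C * eLpNorm f (ENNReal.ofReal p) volume := by
  obtain ⟨C, hC0, hC⟩ := exists_eLpNorm_truncated_le hφ hn hΩ hα hβ hp hs
  refine ⟨C, hC0, fun f => ?_⟩
  -- Fatou's lemma along the radii `2^{-J}`, where pointwise convergence is known everywhere.
  refine (Lp.eLpNorm_lim_le_liminf_eLpNorm
    (fun J : ℕ => aestronglyMeasurable_truncated hφ (by omega) hΩ hα (by positivity) f) _
    (ae_of_all _ fun x => tendsto_truncated_half_pow hw f x)).trans ?_
  exact (liminf_le_liminf (Eventually.of_forall fun J => hC J f)).trans_eq (liminf_const _)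

lemma hypersingular_add (hw : IsWellDefined φ Ω α β)
    (f g : 𝓢(EuclideanSpace ℝ (Fin (n + 1)), ℂ)) :
    hypersingular φ Ω α β ⇑(f + g) = hypersingular φ Ω α β f + hypersingular φ Ω α β g := by
  ext x
  refine tendsto_nhds_unique (hw (f + g) x).2 (((hw f x).2.add (hw g x).2).congr' ?_)
  filter_upwards [self_mem_nhdsWithin] with ε hε
  rw [truncated, truncated, truncated, ← integral_add ((hw f x).1 ε hε) ((hw g x).1 ε hε)]
  refine integral_congr_ae (ae_of_all _ fun t => ?_)
  simp [integrand, add_mul]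

lemma hypersingular_smul (hw : IsWellDefined φ Ω α β) (c : ℂ)
    (f : 𝓢(EuclideanSpace ℝ (Fin (n + 1)), ℂ)) :
    hypersingular φ Ω α β ⇑(c • f) = c • hypersingular φ Ω α β f := by
  ext x
  refine tendsto_nhds_unique (hw (c • f) x).2 (((hw f x).2.const_smul c).congr' ?_)
  refine Eventually.of_forall fun ε => ?_
  simp only [truncated, ← integral_smul]
  refine integral_congr_ae (ae_of_all _ fun t => ?_)
  simp [integrand, mul_assoc]

/-- An operator on Schwartz functions given by a convergent limit of truncations and satisfying an
`L^p` estimate extends to `L^p`. -/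
lemma isBoundedOnLp_of_eLpNorm_le (hw : IsWellDefined φ Ω α β) {p : ℝ≥0∞} (hp : 1 ≤ p)
    (hp' : p ≠ ∞) {C : ℝ} (hC0 : 0 ≤ C)
    (hmeas : ∀ f : 𝓢(EuclideanSpace ℝ (Fin (n + 1)), ℂ),
      AEStronglyMeasurable (hypersingular φ Ω α β f) volume)
    (hC : ∀ f : 𝓢(EuclideanSpace ℝ (Fin (n + 1)), ℂ),
      eLpNorm (hypersingular φ Ω α β f) p volume ≤ ENNReal.ofReal C * eLpNorm f p volume) :
    IsBoundedOnLp φ Ω α β p := by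
  have : Fact (1 ≤ p) := ⟨hp⟩
  have hfin : ∀ f : 𝓢(EuclideanSpace ℝ (Fin (n + 1)), ℂ),
      ENNReal.ofReal C * eLpNorm f p volume ≠ ∞ := fun f =>
    ENNReal.mul_ne_top ENNReal.ofReal_ne_top (f.memLp p volume).eLpNorm_ne_top
  have hmem : ∀ f : 𝓢(EuclideanSpace ℝ (Fin (n + 1)), ℂ),
      MemLp (hypersingular φ Ω α β f) p volume := fun f =>
    ⟨hmeas f, (hC f).trans_lt (hfin f).lt_top⟩
  let Λ : 𝓢(EuclideanSpace ℝ (Fin (n + 1)), ℂ) →ₗ[ℂ]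
      Lp ℂ p (volume : Measure (EuclideanSpace ℝ (Fin (n + 1)))) :=
    { toFun := fun f => (hmem f).toLp _
      map_add' := fun f g => by
        rw [← MemLp.toLp_add, MemLp.toLp_eq_toLp_iff, hypersingular_add hw]
      map_smul' := fun c f => by
        rw [RingHom.id_apply, ← MemLp.toLp_const_smul, MemLp.toLp_eq_toLp_iff,
          hypersingular_smul hw] }
  let e := (SchwartzMap.toLpCLM ℂ ℂ p
    (volume : Measure (EuclideanSpace ℝ (Fin (n + 1))))).toLinearMap
  have hdense : DenseRange e := SchwartzMap.denseRange_toLpCLM (F := ℂ) hp'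
  have hbound : ∀ f, ‖Λ f‖ ≤ C * ‖e f‖ := by
    intro f
    change ‖(hmem f).toLp _‖ ≤ C * ‖f.toLp p volume‖
    rw [Lp.norm_toLp, SchwartzMap.norm_toLp]
    refine (ENNReal.toReal_mono (hfin f) (hC f)).trans_eq ?_
    rw [ENNReal.toReal_mul, ENNReal.toReal_ofReal hC0]
  refine ⟨(Λ.extendOfNorm e).toLinearMap, C, fun g =>
    LinearMap.norm_extendOfNorm_apply_le hdense C hbound g, fun f => ?_⟩
  have h1 : Λ.extendOfNorm e (f.toLp p volume) = Λ f :=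
    LinearMap.extendOfNorm_eq hdense ⟨C, hbound⟩ f
  rw [ContinuousLinearMap.coe_coe, h1]
  exact (hmem f).coeFn_toLp

/-- The two ends of the range of `p` are the two halves of the summability condition: `β(2 - 2/p) >
2α` means `p > β/(β-α)`, and `2β/p > 2α` means `p < β/α`. -/
theorem isBoundedOnLp (hφ : IsAdmissibleProfile φ k₁ k₂ k₃) (hn : 2 ≤ n)
    (hΩ : IsAdmissibleAngular Ω) (hα : 0 < α) (hβ : 2 * α < β)
    (hp : β / (β - α) < p) (hp' : p < β / α) :
    IsBoundedOnLp φ Ω α β (ENNReal.ofReal p) := by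
  have hβα : 0 < β - α := by linarith
  have hp1 : 1 < p := lt_of_le_of_lt ((one_le_div hβα).mpr (by linarith)) hp
  have hp0 : 0 < p := by linarith
  have hs : 2 * α < β * min (2 - 2 / p) (2 / p) := by
    rw [mul_min_of_nonneg _ _ (by linarith : 0 ≤ β), lt_min_iff]
    rw [div_lt_iff₀ hβα] at hp
    rw [lt_div_iff₀ hα] at hp'
    constructor
    · rw [show β * (2 - 2 / p) = 2 * β - 2 * β / p by ring, lt_sub_iff_add_lt,
        ← lt_sub_iff_add_lt', div_lt_iff₀ hp0]
      linarith
    · rw [← mul_div_assoc, lt_div_iff₀ hp0]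
      linarith
  have hw : IsWellDefined φ Ω α β := isWellDefined (by omega) hφ hΩ hα (by linarith)
  obtain ⟨C, hC0, hC⟩ := exists_eLpNorm_hypersingular_le hw hφ hn hΩ hα (by linarith) hp1 hs
  refine isBoundedOnLp_of_eLpNorm_le hw ?_ ENNReal.ofReal_ne_top hC0.le
    (fun f => aestronglyMeasurable_hypersingular hw hφ (by omega) hΩ hα f) hC
  rw [← ENNReal.ofReal_one]
  exact ENNReal.ofReal_le_ofReal hp1.le

end Bounds

end RadialHypersingular

end

theorem theorem1p4 (n : ℕ) (hn : 2 ≤ n) (φ : ℝ → ℝ) (k₁ k₂ k₃ : ℝ)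
    (hφ : RadialHypersingular.IsAdmissibleProfile φ k₁ k₂ k₃)
    (Ω : EuclideanSpace ℝ (Fin n) → ℂ) (hΩ : RadialHypersingular.IsAdmissibleAngular Ω)
    (α β : ℝ) (hα : 0 < 2 * α) (hβ : 2 * α < β) :
    RadialHypersingular.IsWellDefined φ Ω α β ∧
    RadialHypersingular.IsBoundedOnLp φ Ω α β 2 ∧
    ∀ p : ℝ, β / (β - α) < p → p < β / α →
      RadialHypersingular.IsBoundedOnLp φ Ω α β (ENNReal.ofReal p) := by
  have hα' : 0 < α := by linarith
  refine ⟨RadialHypersingular.isWellDefined (by omega) hφ hΩ hα' (by linarith), ?_,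
    fun p hp hp' => RadialHypersingular.isBoundedOnLp hφ hn hΩ hα' hβ hp hp'⟩
  -- `p = 2` is interior to the range, since `β > 2α` gives `β/(β-α) < 2 < β/α`.
  rw [← ENNReal.ofReal_ofNat 2]
  refine RadialHypersingular.isBoundedOnLp hφ hn hΩ hα' hβ ?_ ?_
  · rw [div_lt_iff₀ (by linarith)]
    linarith
  · rw [lt_div_iff₀ hα']
    linarith
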